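/- A curve of length $\ell$ in $\mathbb R^d$ is a sequence of $\ell$ points of $\mathbb R^d$, its vertices. An alignment of curves $P=(p_1,\dots,p_a)$ and $Q=(q_1,\dots,q_b)$ is a sequence of index pairs that starts with $(1,1)$, ends with $(a,b)$, and in which each pair $(i,j)$ is followed by $(i+1,j)$, $(i,j+1)$ or $(i+1,j+1)$. The discrete Fréchet distance is $d_{dF}(P,Q)=\min_\tau\max_{(i,j)\in\tau}\|p_i-q_j\|_2$, the minimum over all alignments $\tau$. The model of computation is a real RAM with unit-cost operations $+,-,\times,/,\sqrt{\cdot},\lfloor\cdot\rfloor$, comparison of reals, indirect addressing, and the choice of a uniformly random integer from $\{0,\dots,\lfloor x\rfloor\}$; space is counted in memory cells. **Theorem.** There are an absolute constant $c>0$, a preprocessing program and a query program (both independent of all parameters) such that the following holds for all integers $n,m,d,k\ge 1$, all reals $0<\varepsilon\le 1$ and $r>0$, and all curves $C_1,\dots,C_n$ of length $m$ in $\mathbb R^d$. 1. The preprocessing program, given $n,m,d,k,\varepsilon,r$ and $C_1,\dots,C_n$, has expected running time at most $nm\cdot\left(c\,d\log m+(c/\varepsilon)^{kd}\right)$. 2.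 For every outcome of its random choices with which it halts, the preprocessing program leaves a data structure $D$ of at most $n\,(c/\varepsilon)^{dk}$ memory cells. 3. Given only such a $D$ (with its size), $k$, $d$ and a curve $Q$ of length $k$ in $\mathbb R^d$, the query program halts after at most $c\,kd$ steps, whatever its random choices, with an answer that depends only on $D$ and $Q$ and is either "no" or an index $j\in\{1,\dots,n\}$. If $d_{dF}(Q,C_i)\le r$ for some $i$, then the answer is an index; and whenever the answer is an index $j$, then $d_{dF}(Q,C_j)\le(1+\varepsilon)r$. 4. $D$ stores grid curves near simplifications of the input curves: for each $D$ there are a set $S$ of curves of length $k$ with all vertices in the grid $\frac{\varepsilon r}{\sqrt d}\mathbb Z^d$, an index $\lambda(Z)\in\{1,\dots,n\}$ for each $Z\in S$, and curves $\Pi_1,\dots,\Pi_n$ of length $k$, such that every $Z\in S$, with $i=\lambda(Z)$, satisfies $d_{dF}(C_i,\Pi_i)\le 2r$ and $d_{dF}(Z,\Pi_i)\le 4r$; and the answer to a query $Q$ is $\lambda(Q')$ if $Q'\in S$ and "no" if $Q'\notin S$, where $Q'$ is obtained from $Q$ by rounding every coordinate of every vertex to the nearest multiple of $\varepsilon r/\sqrt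 d$ (ties upwards). -/

import Mathlib

namespace CurveANN

/-! ### Curves and the discrete Fréchet distance -/

/-- A curve with `len` vertices in `d`-dimensional Euclidean space. -/
abbrev Curve (d len : ℕ) : Type := Fin len → EuclideanSpace ℝ (Fin d)

/-- One hop of an alignment: the first index, the second index, or both, advance by one. -/
def Hop {a b : ℕ} (p q : Fin a × Fin b) : Prop :=
  ((q.1 : ℕ) = p.1 + 1 ∧ (q.2 : ℕ) = p.2) ∨
  ((q.1 : ℕ) = p.1 ∧ (q.2 : ℕ) = p.2 + 1) ∨
  ((q.1 : ℕ) = p.1 + 1 ∧ (q.2 : ℕ) = p.2 + 1)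

/-- An alignment of two curves with `a` and `b` vertices (indices start at `0`): a sequence of
index pairs from the pair of first vertices to the pair of last vertices, proceeding by hops. -/
structure IsAlignment {a b : ℕ} (τ : List (Fin a × Fin b)) : Prop where
  first : ∃ p, τ.head? = some p ∧ (p.1 : ℕ) = 0 ∧ (p.2 : ℕ) = 0
  last : ∃ p, τ.getLast? = some p ∧ (p.1 : ℕ) + 1 = a ∧ (p.2 : ℕ) + 1 = b
  hops : τ.IsChain Hop

/-- The Fréchet cost of an alignment: the maximum of the Euclidean distances of matched vertices
(these are nonnegative and an alignment is nonempty, so starting the maximum at `0` is harmless). -/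
noncomputable def frechetCost {d a b : ℕ} (P : Curve d a) (Q : Curve d b)
    (τ : List (Fin a × Fin b)) : ℝ :=
  (τ.map fun p => ‖P p.1 - Q p.2‖).foldr max 0

/-- The discrete Fréchet distance: the least cost of an alignment. For nonempty curves the
infimum is over a nonempty finite set of costs, hence it is a minimum. -/
noncomputable def dfd {d a b : ℕ} (P : Curve d a) (Q : Curve d b) : ℝ :=
  sInf {x | ∃ τ : List (Fin a × Fin b), IsAlignment τ ∧ x = frechetCost P Q τ}

/-! ### A randomized real RAM

Memory consists of scalar registers and of arrays, all holding real numbers. Registers and array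
names are fixed in the program text, array indices are computed at run time (and rounded down to
a natural number, negative ones to `0`). A program mentions
finitely many constants (natural numbers), registers and arrays. Every basic statement, and every
test of a condition, takes one unit of time; since the expressions of a program have constant
size, charging for each operation separately would change running times by a constant factor
only. -/

/-- Arithmetic expressions: constants, registers, array reads, the four arithmetic operations,
rounding down and square roots. -/
inductive Expr : Type
  | const (c : ℕ)
  | reg (x : ℕ)
  | read (arr : ℕ) (index : Expr)
  | add (e f : Expr)
  | sub (e f : Expr)
  | mul (e f : Expr)
  | div (e f : Expr)
  | floor (e : Expr)
  | sqrt (e : Expr)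

/-- Conditions: comparisons of reals and their Boolean combinations. -/
inductive Cond : Type
  | le (e f : Expr)
  | not (b : Cond)
  | and (b c : Cond)

/-- Programs. -/
inductive Program : Type
  | skip
  | assign (x : ℕ) (e : Expr)
  | write (arr : ℕ) (index e : Expr)
  | random (x : ℕ) (bound : Expr)
  | seq (s t : Program)
  | ite (b : Cond) (s t : Program)
  | loop (b : Cond) (s : Program)

/-- Contents of the memory. -/
structure Memory : Type where
  reg : ℕ → ℝ
  arr : ℕ → ℕ → ℝ

/-- The value of an expression. -/
noncomputable def Expr.eval (M : Memory) : Expr → ℝ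
  | .const c => (c : ℝ)
  | .reg x => M.reg x
  | .read a i => M.arr a ⌊i.eval M⌋₊
  | .add e f => e.eval M + f.eval M
  | .sub e f => e.eval M - f.eval M
  | .mul e f => e.eval M * f.eval M
  | .div e f => e.eval M / f.eval M
  | .floor e => ((⌊e.eval M⌋ : ℤ) : ℝ)
  | .sqrt e => Real.sqrt (e.eval M)

/-- Truth of a condition. -/
def Cond.Holds (M : Memory) : Cond → Prop
  | .le e f => e.eval M ≤ f.eval M
  | .not b => ¬ b.Holds M
  | .and b c => b.Holds M ∧ c.Holds M

/-- Set register `x` to `v`. -/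
def Memory.setReg (M : Memory) (x : ℕ) (v : ℝ) : Memory :=
  { M with reg := Function.update M.reg x v }

/-- Set entry `i` of array `a` to `v`. -/
def Memory.setArr (M : Memory) (a i : ℕ) (v : ℝ) : Memory :=
  { M with arr := Function.update M.arr a (Function.update (M.arr a) i v) }

/-- A configuration: the programs still to be executed, in this order, and the memory.
The machine has halted when nothing is left to execute. -/
structure Config : Type where
  todo : List Program
  mem : Memory

open Classical in
/-- One step of the machine, as a probability distribution on the next configuration. The only
random statement is `random x bound`, which puts into register `x` a uniformly distributed
integer from `{0, …, ⌊bound⌋}`. -/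
noncomputable def step : Config → PMF Config
  | ⟨[], M⟩ => PMF.pure ⟨[], M⟩
  | ⟨.skip :: K, M⟩ => PMF.pure ⟨K, M⟩
  | ⟨.assign x e :: K, M⟩ => PMF.pure ⟨K, M.setReg x (e.eval M)⟩
  | ⟨.write a i e :: K, M⟩ => PMF.pure ⟨K, M.setArr a ⌊i.eval M⌋₊ (e.eval M)⟩
  | ⟨.random x e :: K, M⟩ =>
      (PMF.uniformOfFintype (Fin (⌊e.eval M⌋₊ + 1))).map
        fun v => ⟨K, M.setReg x ((v : ℕ) : ℝ)⟩
  | ⟨.seq s t :: K, M⟩ => PMF.pure ⟨s :: t :: K, M⟩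
  | ⟨.ite b s t :: K, M⟩ => PMF.pure ⟨(if b.Holds M then s else t) :: K, M⟩
  | ⟨.loop b s :: K, M⟩ =>
      PMF.pure ⟨if b.Holds M then s :: .loop b s :: K else K, M⟩

/-- The distribution of the configuration after `t` steps. -/
noncomputable def run : ℕ → Config → PMF Config
  | 0, c => PMF.pure c
  | t + 1, c => (step c).bind (run t)

/-- The expected running time `E[T] = ∑_{t ≥ 0} Pr[T > t]` of program `p` started on memory `M`,
where `T` is the number of steps until the machine halts (`∞` if it does not halt). -/
noncomputable def expectedTime (p : Program) (M : Memory) : ENNReal :=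
  ∑' t : ℕ, (run t ⟨[p], M⟩).toOuterMeasure {c | c.todo ≠ []}

/-- `M'` is a possible final memory of program `p` started on memory `M`. -/
def IsOutcome (p : Program) (M M' : Memory) : Prop :=
  ∃ t : ℕ, (⟨[], M'⟩ : Config) ∈ (run t ⟨[p], M⟩).support

/-- Whatever the random choices, program `p` started on memory `M` halts after at most `T`
steps, with the value `v` in register `0`. -/
def ReturnsWithin (p : Program) (M : Memory) (T : ℝ) (v : ℝ) : Prop :=
  ∃ t : ℕ, (t : ℝ) ≤ T ∧ ∀ c ∈ (run t ⟨[p], M⟩).support, c.todo = [] ∧ c.mem.reg 0 = v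

/-! ### Input and output formats -/

/-- The coordinates of a curve, vertex by vertex, as an array (`0` beyond the last entry). -/
noncomputable def curveArray {d len : ℕ} (P : Curve d len) (a : ℕ) : ℝ :=
  if h : a / d < len ∧ a % d < d then P ⟨a / d, h.1⟩ ⟨a % d, h.2⟩ else 0

/-- The coordinates of a family of curves, curve by curve (`0` beyond the last entry). -/
noncomputable def familyArray {n m d : ℕ} (C : Fin n → Curve d m) (a : ℕ) : ℝ :=
  if h : a / (m * d) < n then curveArray (C ⟨a / (m * d), h⟩) (a % (m * d)) else 0

/-- The initial memory of preprocessing: `n, m, d, k, ε, r` in registers `0, …, 5`, the input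
curves in array `0`, and zeros elsewhere. -/
noncomputable def prepInput {n m d : ℕ} (C : Fin n → Curve d m) (k : ℕ) (ε r : ℝ) : Memory where
  reg := fun x => [(n : ℝ), m, d, k, ε, r].getD x 0
  arr := fun a => if a = 0 then familyArray C else fun _ => 0

/-- The data structure left by preprocessing, as a sequence of memory cells: the first `L` cells
of array `1`, where `L` is the value of register `0`. Nothing else is passed on to queries. -/
noncomputable def dataStructure (M : Memory) : List ℝ :=
  (List.range ⌊M.reg 0⌋₊).map (M.arr 1)

/-- The initial memory of a query: the size of the data structure, `k` and `d` in registers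
`0, 1, 2`, the data structure in array `0`, the query curve in array `1`, and zeros elsewhere. -/
noncomputable def queryInput {d k : ℕ} (D : List ℝ) (Q : Curve d k) : Memory where
  reg := fun x => [(D.length : ℝ), k, d].getD x 0
  arr := fun a =>
    if a = 0 then fun i => D.getD i 0 else if a = 1 then curveArray Q else fun _ => 0

/-- Answers of queries: `0` stands for "no", and `i + 1` for the input curve with index `i`
(indices starting at `0`). -/
def answerCode {n : ℕ} : Option (Fin n) → ℝ
  | none => 0
  | some i => ((i : ℕ) : ℝ) + 1

/-! ### Near neighbors and grid dictionaries -/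

/-- `answer` solves the asymmetric `(1+ε, r)`-approximate near-neighbor problem for the input
curves `C`: whenever some input curve is within distance `r` of the query, an input curve is
returned, and a returned curve is always within distance `(1+ε)r` of the query. -/
def SolvesANNC {n m d k : ℕ} (C : Fin n → Curve d m) (ε r : ℝ)
    (answer : Curve d k → Option (Fin n)) : Prop :=
  ∀ Q : Curve d k,
    ((∃ i, dfd Q (C i) ≤ r) → ∃ j, answer Q = some j) ∧
    ∀ j, answer Q = some j → dfd Q (C j) ≤ (1 + ε) * r

/-- The curve obtained by rounding every coordinate of every vertex to the nearest integer
multiple of `δ`, i.e. every vertex to a nearest point of the grid with edge length `δ`. -/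
noncomputable def roundCurve {d k : ℕ} (δ : ℝ) (Q : Curve d k) : Curve d k :=
  fun j => WithLp.toLp 2 fun t => δ * ((round (Q j t / δ) : ℤ) : ℝ)

open Classical in
/-- `answer` is the look-up of the rounded query in a set `S` of curves with vertices in the grid
of edge length `ε r / √d`, each stored with the index `label` of an input curve, such that a
stored curve is within distance `4 r` of a `k`-vertex simplification of its input curve, where a
simplification is within distance `2 r` of the curve it simplifies. -/
def IsGridDictionary {n m d k : ℕ} (C : Fin n → Curve d m) (ε r : ℝ)
    (answer : Curve d k → Option (Fin n)) : Prop :=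
  ∃ (S : Set (Curve d k)) (label : Curve d k → Fin n) (simp : Fin n → Curve d k),
    (∀ Z ∈ S,
      (∀ j t, ∃ z : ℤ, Z j t = ε * r / Real.sqrt d * z) ∧
      dfd (C (label Z)) (simp (label Z)) ≤ 2 * r ∧
      dfd Z (simp (label Z)) ≤ 4 * r) ∧
    ∀ Q : Curve d k,
      answer Q = if roundCurve (ε * r / Real.sqrt d) Q ∈ S
        then some (label (roundCurve (ε * r / Real.sqrt d) Q)) else none

end CurveANN

/-! Put δ = εr/√d and ρ = (1 + ε/2)r. Rounding to the grid of edge length δ moves a vertex by at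
most √d·δ/2 = εr/2. By the triangle inequality, a query within r of `C i` rounds to a grid curve
within ρ of `C i`, and a grid curve within ρ of `C i` is within (1 + ε)r of every query that rounds
to it. So it suffices to store exactly the grid curves of length k within ρ of some input curve,
each with the index of such a curve (`solvesANNC`). The dictionary description follows: any curve of
length k within ρ ≤ 2r of `C i` can play the role of its simplification, and two such curves are
within 2ρ ≤ 4r of each other (`isGridDictionary`). No simplification is ever computed, and the
summand with log m in the time bound is not needed.

The near grid curves are enumerated through a short code (`exists_decode`). Cut `C i` greedily into
pieces whose vertices are within 3r of the first vertex of the piece. Since 2ρ ≤ 3r, each new piece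
forces the matched vertex of a near grid curve to advance, so there are at most k pieces
(`greedy_fst_le`). The vertices of a near grid curve visit the pieces in order, and each is within ρ
+ 3r ≤ 9r/2 of the first vertex of its piece, which by Cauchy–Schwarz is at most 9d/(2ε) grid units
in the ℓ¹ norm. Divide every coordinate difference by R = ⌊1/ε⌋ + 1. The remainders leave R^(kd)
choices; the quotients and the piece increments have total size O(kd) and fit in unary into 11kd
bits. This gives (2048·R)^(kd) candidates per input curve. Each is decoded, tested by dynamic
programming on the free-space grid (`checkProg_total`) and, if near and new, entered under an
integer key, the Horner value of its coordinates (`keyOf_inj`).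

The s resulting keys are put into a two-level perfect hash table with hash functions x ↦
⌊S·frac(ax/M)⌋. Two distinct keys below U collide for at most a fraction 6/S of the multipliers a as
soon as U·S ≤ M (`card_collisions_le`); no prime is needed. By Markov's inequality at least half of
the multipliers spread the keys over s + 1 buckets with sum of squared sizes at most 14s
(`half_le_card_sum_sq`), and at least half are injective on a bucket of size b with 12b² slots
(`half_le_card_injOn`). Drawing until success costs in expectation about two trials (`Spec.retry`),
and the table has O(s) cells.

Deterministic program parts are treated with `Total`, which yields a final memory and a time bound.
For random parts, `Spec` bounds the expected number of steps among the first N, for every N and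
every remaining program: quantifying over the remaining program makes the bounds compose, and
quantifying over N allows induction for loops of unbounded length. -/

open scoped ENNReal

namespace CurveANN

/-! ### Deterministic big-step execution -/

/-- `Exec s M t M'`: started on memory `M`, the program `s` makes no random choices and halts
after exactly `t` steps with memory `M'`. -/
inductive Exec : Program → Memory → ℕ → Memory → Prop
  | skip (M) : Exec .skip M 1 M
  | assign (x e M) : Exec (.assign x e) M 1 (M.setReg x (e.eval M))
  | write (a i e M) : Exec (.write a i e) M 1 (M.setArr a ⌊i.eval M⌋₊ (e.eval M))
  | seq {s u M t M' t' M''} : Exec s M t M' → Exec u M' t' M'' → Exec (.seq s u) M (t + t' + 1) M''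
  | ite_true {b s u M t M'} : b.Holds M → Exec s M t M' → Exec (.ite b s u) M (t + 1) M'
  | ite_false {b s u M t M'} : ¬ b.Holds M → Exec u M t M' → Exec (.ite b s u) M (t + 1) M'
  | loop_true {b s M t M' t' M''} : b.Holds M → Exec s M t M' → Exec (.loop b s) M' t' M'' →
      Exec (.loop b s) M (t + t' + 1) M''
  | loop_false {b s M} : ¬ b.Holds M → Exec (.loop b s) M 1 M

theorem run_succ (t : ℕ) (c : Config) : run (t + 1) c = (step c).bind (run t) := rfl

/-- The remaining programs `K` and the surplus time `u` are arbitrary, so that a deterministic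
prefix can be cut off any run; this is what the inductive cases for sequences and loops need. -/
theorem Exec.run_add {s : Program} {M M' : Memory} {t : ℕ} (h : Exec s M t M') :
    ∀ (u : ℕ) (K : List Program), run (t + u) ⟨s :: K, M⟩ = run u ⟨K, M'⟩ := by
  induction h with
  | skip => intro u K; rw [add_comm, run_succ, step, PMF.pure_bind]
  | assign => intro u K; rw [add_comm, run_succ, step, PMF.pure_bind]
  | write => intro u K; rw [add_comm, run_succ, step, PMF.pure_bind]
  | @seq _ _ _ t _ t' _ _ _ ih ih' =>
    intro u K
    rw [show t + t' + 1 + u = (t + (t' + u)) + 1 by ring, run_succ, step, PMF.pure_bind, ih, ih']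
  | @ite_true _ _ _ _ t _ hb _ ih =>
    intro u K
    rw [show t + 1 + u = (t + u) + 1 by ring, run_succ, step, PMF.pure_bind, if_pos hb, ih]
  | @ite_false _ _ _ _ t _ hb _ ih =>
    intro u K
    rw [show t + 1 + u = (t + u) + 1 by ring, run_succ, step, PMF.pure_bind, if_neg hb, ih]
  | @loop_true _ _ _ t _ t' _ hb _ _ ih ih' =>
    intro u K
    rw [show t + t' + 1 + u = (t + (t' + u)) + 1 by ring, run_succ, step, PMF.pure_bind, if_pos hb,
      ih, ih']
  | loop_false hb =>
    intro u K
    rw [add_comm, run_succ, step, PMF.pure_bind, if_neg hb]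

theorem Exec.run_eq {s : Program} {M M' : Memory} {t : ℕ} (h : Exec s M t M') (K : List Program) :
    run t ⟨s :: K, M⟩ = PMF.pure ⟨K, M'⟩ := h.run_add 0 K

/-! ### Frames -/

/-- Whether a program contains an assignment to register `x`. -/
def Program.writesReg (x : ℕ) : Program → Bool
  | .skip => false
  | .assign y _ => x == y
  | .write _ _ _ => false
  | .random y _ => x == y
  | .seq s u => s.writesReg x || u.writesReg x
  | .ite _ s u => s.writesReg x || u.writesReg x
  | .loop _ s => s.writesReg x

/-- Whether a program contains a write to array `a`. -/
def Program.writesArr (a : ℕ) : Program → Bool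
  | .skip => false
  | .assign _ _ => false
  | .write b _ _ => a == b
  | .random _ _ => false
  | .seq s u => s.writesArr a || u.writesArr a
  | .ite _ s u => s.writesArr a || u.writesArr a
  | .loop _ s => s.writesArr a

/-- `M` and `M'` agree outside of the registers and arrays that `s` may change. -/
structure Frame (s : Program) (M M' : Memory) : Prop where
  reg : ∀ x, s.writesReg x = false → M'.reg x = M.reg x
  arr : ∀ a, s.writesArr a = false → M'.arr a = M.arr a

@[simp] theorem Memory.setReg_reg (M : Memory) (x y : ℕ) (v : ℝ) :
    (M.setReg x v).reg y = if y = x then v else M.reg y := by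
  simp [Memory.setReg, Function.update_apply]

@[simp] theorem Memory.setReg_arr (M : Memory) (x : ℕ) (v : ℝ) :
    (M.setReg x v).arr = M.arr := rfl

@[simp] theorem Memory.setArr_reg (M : Memory) (a i : ℕ) (v : ℝ) :
    (M.setArr a i v).reg = M.reg := rfl

theorem Memory.setArr_arr (M : Memory) (a i b : ℕ) (v : ℝ) :
    (M.setArr a i v).arr b = if b = a then Function.update (M.arr a) i v else M.arr b := by
  simp [Memory.setArr, Function.update_apply]

@[simp] theorem Memory.setArr_arr_apply (M : Memory) (a i b j : ℕ) (v : ℝ) :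
    (M.setArr a i v).arr b j = if b = a then (if j = i then v else M.arr a j) else M.arr b j := by
  rw [Memory.setArr_arr]; split_ifs <;> simp_all

theorem Frame.refl (s : Program) (M : Memory) : Frame s M M := ⟨fun _ _ => rfl, fun _ _ => rfl⟩

theorem Frame.trans {s : Program} {M M' M'' : Memory} (h : Frame s M M') (h' : Frame s M' M'') :
    Frame s M M'' :=
  ⟨fun x hx => (h'.reg x hx).trans (h.reg x hx), fun x hx => (h'.arr x hx).trans (h.arr x hx)⟩

theorem Frame.of_writes {s u : Program} {M M' : Memory} (h : Frame s M M')
    (hr : ∀ x, u.writesReg x = false → s.writesReg x = false)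
    (ha : ∀ x, u.writesArr x = false → s.writesArr x = false) : Frame u M M' :=
  ⟨fun x hx => h.reg x (hr x hx), fun x hx => h.arr x (ha x hx)⟩

/-- Because the sets of written registers and arrays are computed from the program text, the
preservation of a particular register or array later reduces to `rfl`. -/
theorem Exec.frame {s : Program} {M M' : Memory} {t : ℕ} (h : Exec s M t M') : Frame s M M' := by
  induction h with
  | skip => exact Frame.refl _ _
  | assign x e M =>
    refine ⟨fun y hy => ?_, fun _ _ => rfl⟩
    have : y ≠ x := by simpa [Program.writesReg] using hy
    simp [this]
  | write a i e M =>
    refine ⟨fun _ _ => rfl, fun y hy => ?_⟩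
    have : y ≠ a := by simpa [Program.writesArr] using hy
    simp [Memory.setArr_arr, this]
  | seq _ _ ih ih' =>
    refine (ih.of_writes ?_ ?_).trans (ih'.of_writes ?_ ?_) <;>
      simp +contextual [Program.writesReg, Program.writesArr]
  | ite_true _ _ ih =>
    refine ih.of_writes ?_ ?_ <;> simp +contextual [Program.writesReg, Program.writesArr]
  | ite_false _ _ ih =>
    refine ih.of_writes ?_ ?_ <;> simp +contextual [Program.writesReg, Program.writesArr]
  | loop_true _ _ _ ih ih' =>
    exact Frame.trans (ih.of_writes (u := .loop _ _) (fun _ h => h) (fun _ h => h)) ih'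
  | loop_false => exact Frame.refl _ _

/-! ### Total correctness with a time bound -/

/-- `s` started on `M` halts deterministically within `T` steps, in a memory satisfying `Q`. -/
def Total (s : Program) (M : Memory) (T : ℕ) (Q : Memory → Prop) : Prop :=
  ∃ t M', Exec s M t M' ∧ t ≤ T ∧ Q M'

namespace Total

variable {s u : Program} {M : Memory} {T T' : ℕ} {Q Q' : Memory → Prop}

theorem mono (h : Total s M T Q) (hT : T ≤ T') (hQ : ∀ M', Frame s M M' → Q M' → Q' M') :
    Total s M T' Q' := by
  obtain ⟨t, M', he, ht, hq⟩ := h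
  exact ⟨t, M', he, ht.trans hT, hQ M' he.frame hq⟩

theorem skip (h : Q M) : Total .skip M 1 Q := ⟨1, M, .skip M, le_rfl, h⟩

theorem assign {x : ℕ} {e : Expr} (h : Q (M.setReg x (e.eval M))) : Total (.assign x e) M 1 Q :=
  ⟨1, _, .assign x e M, le_rfl, h⟩

theorem write {a : ℕ} {i e : Expr} (h : Q (M.setArr a ⌊i.eval M⌋₊ (e.eval M))) :
    Total (.write a i e) M 1 Q :=
  ⟨1, _, .write a i e M, le_rfl, h⟩

theorem seq (h : Total s M T fun M' => Frame s M M' → Total u M' T' Q) :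
    Total (.seq s u) M (T + T' + 1) Q := by
  obtain ⟨t, M', he, ht, t', M'', he', ht', hq⟩ := h.mono le_rfl fun _ hf hq => hq hf
  exact ⟨_, M'', he.seq he', by omega, hq⟩

theorem seq' {P : Memory → Prop} (h : Total s M T P)
    (h' : ∀ M', Frame s M M' → P M' → Total u M' T' Q) : Total (.seq s u) M (T + T' + 1) Q :=
  seq (h.mono le_rfl fun M' _ hp hf => h' M' hf hp)

theorem seq_assign {x : ℕ} {e : Expr} (h : Total u (M.setReg x (e.eval M)) T Q) :
    Total (.seq (.assign x e) u) M (T + 2) Q :=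
  (seq (assign fun _ => h)).mono (by omega) fun _ _ h => h

theorem seq_write {a : ℕ} {i e : Expr} (h : Total u (M.setArr a ⌊i.eval M⌋₊ (e.eval M)) T Q) :
    Total (.seq (.write a i e) u) M (T + 2) Q :=
  (seq (write fun _ => h)).mono (by omega) fun _ _ h => h

theorem ite {b : Cond} (h : b.Holds M → Total s M T Q) (h' : ¬ b.Holds M → Total u M T Q) :
    Total (.ite b s u) M (T + 1) Q := by
  by_cases hb : b.Holds M
  · obtain ⟨t, M', he, ht, hq⟩ := h hb
    exact ⟨_, M', .ite_true hb he, by omega, hq⟩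
  · obtain ⟨t, M', he, ht, hq⟩ := h' hb
    exact ⟨_, M', .ite_false hb he, by omega, hq⟩

/-- A loop that makes at most `N` iterations. -/
theorem loop {b : Cond} {τ N : ℕ} (Inv : ℕ → Memory → Prop) (h0 : Inv N M)
    (hbody : ∀ j M', Frame (.loop b s) M M' → Inv j M' → b.Holds M' →
      ∃ i, j = i + 1 ∧ Total s M' τ (Inv i))
    (hQ : ∀ j M', Frame (.loop b s) M M' → Inv j M' → ¬ b.Holds M' → Q M') :
    Total (.loop b s) M (N * (τ + 1) + 1) Q := by
  induction N generalizing M with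
  | zero =>
    by_cases hb : b.Holds M
    · obtain ⟨i, hi, -⟩ := hbody 0 M (Frame.refl _ _) h0 hb
      omega
    · exact ⟨1, M, .loop_false hb, by omega, hQ 0 M (Frame.refl _ _) h0 hb⟩
  | succ N ih =>
    by_cases hb : b.Holds M
    · obtain ⟨i, hi, t, M', he, ht, hI⟩ := hbody _ M (Frame.refl _ _) h0 hb
      obtain rfl : N = i := by omega
      have hf : Frame (.loop b s) M M' := he.frame.of_writes (fun _ h => h) (fun _ h => h)
      obtain ⟨t', M'', he', ht', hq⟩ := ih (M := M') hI
        (fun j M'' hf' => hbody j M'' (hf.trans hf')) (fun j M'' hf' => hQ j M'' (hf.trans hf'))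
      exact ⟨_, M'', .loop_true hb he he', by linarith, hq⟩
    · exact ⟨1, M, .loop_false hb, by omega, hQ _ M (Frame.refl _ _) h0 hb⟩

end Total

/-! ### Notation for programs -/

instance (n : ℕ) : OfNat Expr n := ⟨.const n⟩
instance : Add Expr := ⟨.add⟩
instance : Sub Expr := ⟨.sub⟩
instance : Mul Expr := ⟨.mul⟩
instance : Div Expr := ⟨.div⟩

/-- Sequential composition. -/
scoped infixr:30 " ;; " => Program.seq
/-- Assignment to a register. -/
scoped infix:40 " ::= " => Program.assign

/-- The condition `e < f`. -/
def Cond.lt (e f : Expr) : Cond := .not (.le f e)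

/-- The condition `e = f`. -/
def Cond.eq (e f : Expr) : Cond := .and (.le e f) (.le f e)

/-- `for i = 0, …, e - 1 do s`. -/
def Program.forLoop (i : ℕ) (e : Expr) (s : Program) : Program :=
  i ::= 0 ;; .loop (.lt (.reg i) e) (s ;; i ::= .reg i + 1)

section eval
variable (M : Memory) (e f : Expr)

@[simp] theorem Expr.eval_zero : (0 : Expr).eval M = 0 := Nat.cast_zero
@[simp] theorem Expr.eval_one : (1 : Expr).eval M = 1 := Nat.cast_one
@[simp] theorem Expr.eval_ofNat (n : ℕ) [n.AtLeastTwo] :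
    (ofNat(n) : Expr).eval M = ofNat(n) := rfl
@[simp] theorem Expr.eval_reg (x : ℕ) : (Expr.reg x).eval M = M.reg x := rfl
@[simp] theorem Expr.eval_read (a : ℕ) : (Expr.read a e).eval M = M.arr a ⌊e.eval M⌋₊ := rfl
@[simp] theorem Expr.eval_add : (e + f).eval M = e.eval M + f.eval M := rfl
@[simp] theorem Expr.eval_sub : (e - f).eval M = e.eval M - f.eval M := rfl
@[simp] theorem Expr.eval_mul : (e * f).eval M = e.eval M * f.eval M := rfl
@[simp] theorem Expr.eval_div : (e / f).eval M = e.eval M / f.eval M := rfl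
@[simp] theorem Expr.eval_floor : (Expr.floor e).eval M = ((⌊e.eval M⌋ : ℤ) : ℝ) := rfl
@[simp] theorem Expr.eval_sqrt : (Expr.sqrt e).eval M = Real.sqrt (e.eval M) := rfl
@[simp] theorem Cond.holds_le : (Cond.le e f).Holds M ↔ e.eval M ≤ f.eval M := Iff.rfl
@[simp] theorem Cond.holds_lt : (Cond.lt e f).Holds M ↔ e.eval M < f.eval M := not_le
@[simp] theorem Cond.holds_eq : (Cond.eq e f).Holds M ↔ e.eval M = f.eval M := le_antisymm_iff.symm
@[simp] theorem Cond.holds_and (b c : Cond) :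
    (Cond.and b c).Holds M ↔ b.Holds M ∧ c.Holds M := Iff.rfl

end eval

/-- Each round costs the body plus three steps (test, sequencing, increment); three more go to the
initial sequencing and assignment and to the last test. The invariant is re-established on the
memory whose counter has already been advanced. -/
theorem Total.forLoop {i : ℕ} {e : Expr} {s : Program} {M : Memory} {Q : Memory → Prop} {τ : ℕ}
    (N : ℕ) (Inv : ℕ → Memory → Prop) (hi : s.writesReg i = false)
    (hN : ∀ M', Frame (.forLoop i e s) M M' → e.eval M' = N)
    (h0 : Inv 0 (M.setReg i 0))
    (hbody : ∀ j < N, ∀ M', Frame (.forLoop i e s) M M' → M'.reg i = j → Inv j M' →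
      Total s M' τ fun M'' => Frame s M' M'' → Inv (j + 1) (M''.setReg i (j + 1)))
    (hQ : ∀ M', Frame (.forLoop i e s) M M' → M'.reg i = N → Inv N M' → Q M') :
    Total (.forLoop i e s) M (N * (τ + 3) + 3) Q := by
  have hf0 : Frame (.forLoop i e s) M (M.setReg i 0) := by
    refine ⟨fun x hx => ?_, fun _ _ => rfl⟩
    have : x ≠ i := by rintro rfl; simp [Program.forLoop, Program.writesReg] at hx
    simp [this]
  have hfs : ∀ {M M'}, Frame (.loop (.lt (.reg i) e) (s ;; i ::= .reg i + 1)) M M' →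
      Frame (.forLoop i e s) M M' := fun h => h.of_writes
    (by simp +contextual [Program.forLoop, Program.writesReg])
    (by simp +contextual [Program.forLoop, Program.writesArr])
  refine Total.mono (T := (N * (τ + 2 + 1) + 1) + 2) (Q := Q) ?_ (by linarith) fun _ _ h => h
  refine seq_assign ?_
  rw [Expr.eval_zero]
  refine Total.loop (N := N)
    (fun l M' => ∃ j, j + l = N ∧ M'.reg i = j ∧ Inv j M') ⟨0, by simp, by simp, h0⟩ ?_ ?_
  · rintro l M' hf ⟨j, hjl, hij, hI⟩ hb
    have hf' := hf0.trans (hfs hf)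
    rw [Cond.holds_lt, hN M' hf', Expr.eval_reg, hij, Nat.cast_lt] at hb
    refine ⟨l - 1, by omega, ?_⟩
    refine (seq (T' := 1) ((hbody j hb M' hf' hij hI).mono le_rfl fun M'' hf'' hI'' _ => ?_)).mono
      (by omega) fun _ _ h => h
    have : M''.reg i = j := (hf''.reg i hi).trans hij
    refine assign ⟨j + 1, by omega, by simp [this], ?_⟩
    simpa [this] using hI'' hf''
  · rintro l M' hf ⟨j, hjl, hij, hI⟩ hb
    have hf' := hf0.trans (hfs hf)
    rw [Cond.holds_lt, hN M' hf', Expr.eval_reg, hij, Nat.cast_lt] at hb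
    obtain rfl : j = N := by omega
    exact hQ M' hf' hij hI

/-! ### Expected time and safety of randomized programs -/

/-- The expected number of the first `N` steps before which `c` has not halted. -/
noncomputable def expectedSteps (N : ℕ) (c : Config) : ℝ≥0∞ :=
  ∑ t ∈ Finset.range N, (run t c).toOuterMeasure {c | c.todo ≠ []}

/-- Every final memory reached from `c` within `N` steps satisfies `Φ`. -/
def Safe (Φ : Memory → Prop) (N : ℕ) (c : Config) : Prop :=
  ∀ t ≤ N, ∀ M, (⟨[], M⟩ : Config) ∈ (run t c).support → Φ M

/-- The program `s` started on `M` takes expected time at most `T`, and if it halts, the memory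
then satisfies `Q`. -/
def Spec (s : Program) (M : Memory) (T : ℝ≥0∞) (Q : Memory → Prop) : Prop :=
  ∀ (K : List Program) (N : ℕ),
    (∀ X, (∀ M', Q M' → expectedSteps N ⟨K, M'⟩ ≤ X) → expectedSteps N ⟨s :: K, M⟩ ≤ T + X) ∧
    ∀ Φ, (∀ M', Q M' → Safe Φ N ⟨K, M'⟩) → Safe Φ N ⟨s :: K, M⟩

theorem toOuterMeasure_le_one {α : Type*} (p : PMF α) (S : Set α) : p.toOuterMeasure S ≤ 1 := by
  rw [PMF.toOuterMeasure_apply, ← p.tsum_coe]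
  exact ENNReal.tsum_le_tsum fun a => Set.indicator_le_self' (fun _ _ => zero_le) a

theorem expectedSteps_mono {N N' : ℕ} (h : N ≤ N') (c : Config) :
    expectedSteps N c ≤ expectedSteps N' c :=
  Finset.sum_le_sum_of_subset (Finset.range_mono h)

theorem Safe.mono {Φ : Memory → Prop} {N N' : ℕ} {c : Config} (h : Safe Φ N' c) (hN : N ≤ N') :
    Safe Φ N c := fun t ht => h t (ht.trans hN)

theorem Exec.expectedSteps_le {s : Program} {M M' : Memory} {t : ℕ} (h : Exec s M t M') (N : ℕ)
    (K : List Program) : expectedSteps N ⟨s :: K, M⟩ ≤ t + expectedSteps N ⟨K, M'⟩ := by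
  refine (expectedSteps_mono (Nat.le_add_left N t) _).trans ?_
  unfold expectedSteps
  rw [Finset.sum_range_add]
  refine add_le_add ?_ ?_
  · refine (Finset.sum_le_sum (g := fun _ => (1 : ℝ≥0∞)) fun _ _ => toOuterMeasure_le_one _ _).trans ?_
    simp
  · simp [h.run_add]

/-- A halted configuration is a fixed point of `step`, so the support at later times still contains
it. -/
theorem halted_persists {t u : ℕ} {c : Config} {M : Memory}
    (h : (⟨[], M⟩ : Config) ∈ (run t c).support) (htu : t ≤ u) :
    (⟨[], M⟩ : Config) ∈ (run u c).support := by
  induction t generalizing u c with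
  | zero =>
    obtain rfl : (⟨[], M⟩ : Config) = c := by simpa [run] using h
    clear h htu
    induction u with
    | zero => simp [run]
    | succ u ih => rwa [run_succ, step, PMF.pure_bind]
  | succ t ih =>
    obtain ⟨u, rfl⟩ : ∃ v, u = v + 1 := ⟨u - 1, by omega⟩
    rw [run_succ, PMF.mem_support_bind_iff] at h ⊢
    obtain ⟨c', hc, h⟩ := h
    exact ⟨c', hc, ih h (by omega)⟩

theorem Exec.safe {s : Program} {M M' : Memory} {t : ℕ} (h : Exec s M t M') {N : ℕ}
    {K : List Program} {Φ : Memory → Prop} (hs : Safe Φ N ⟨K, M'⟩) : Safe Φ N ⟨s :: K, M⟩ := by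
  intro u hu M'' hM
  rcases le_total t u with htu | htu
  · obtain ⟨v, rfl⟩ := Nat.exists_eq_add_of_le htu
    rw [h.run_add] at hM
    exact hs v (by omega) M'' hM
  · have := halted_persists hM htu
    rw [h.run_eq] at this
    refine hs 0 (Nat.zero_le _) M'' ?_
    simpa [run] using this

namespace Spec

variable {s u : Program} {M : Memory} {T T' : ℝ≥0∞} {Q Q' : Memory → Prop}

theorem mono (h : Spec s M T Q) (hT : T ≤ T') (hQ : ∀ M', Q M' → Q' M') : Spec s M T' Q' := by
  intro K N
  refine ⟨fun X hX => ?_, fun Φ hΦ => (h K N).2 Φ fun M' hM => hΦ M' (hQ M' hM)⟩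
  exact ((h K N).1 X fun M' hM => hX M' (hQ M' hM)).trans (add_le_add_left hT X)

theorem of_total {n : ℕ} (h : Total s M n Q) : Spec s M n Q := by
  obtain ⟨t, M', he, ht, hq⟩ := h
  intro K N
  refine ⟨fun X hX => ?_, fun Φ hΦ => he.safe (hΦ M' hq)⟩
  exact (he.expectedSteps_le N K).trans (add_le_add (by exact_mod_cast ht) (hX M' hq))

end Spec

theorem expectedSteps_of_step {c c' : Config} (h : step c = PMF.pure c') (N : ℕ) :
    expectedSteps (N + 1) c ≤ 1 + expectedSteps N c' := by
  unfold expectedSteps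
  rw [Finset.sum_range_succ', add_comm]
  refine add_le_add (toOuterMeasure_le_one _ _) ?_
  simp [run_succ, h]

theorem Safe.of_step {c c' : Config} {Φ : Memory → Prop} {N : ℕ} (h : step c = PMF.pure c')
    (hc : c.todo ≠ []) (hs : Safe Φ N c') : Safe Φ (N + 1) c := by
  intro t ht M hM
  cases t with
  | zero =>
    obtain rfl : (⟨[], M⟩ : Config) = c := by simpa [run] using hM
    exact absurd rfl hc
  | succ t =>
    rw [run_succ, h, PMF.pure_bind] at hM
    exact hs t (by omega) M hM

theorem run_random (t x : ℕ) (e : Expr) (K : List Program) (M : Memory) :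
    run (t + 1) ⟨.random x e :: K, M⟩ =
      (PMF.uniformOfFintype (Fin (⌊e.eval M⌋₊ + 1))).bind fun v =>
        run t ⟨K, M.setReg x ((v : ℕ) : ℝ)⟩ := by
  rw [run_succ, step, PMF.bind_map]
  refine (PMF.bind_bind _ _ _).trans (congrArg _ (funext fun v => ?_))
  exact PMF.pure_bind _ _

theorem expectedSteps_random (N x : ℕ) (e : Expr) (K : List Program) (M : Memory) :
    expectedSteps (N + 1) ⟨.random x e :: K, M⟩ ≤
      1 + ∑ v : Fin (⌊e.eval M⌋₊ + 1), ((⌊e.eval M⌋₊ + 1 : ℕ) : ℝ≥0∞)⁻¹ *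
        expectedSteps N ⟨K, M.setReg x (v : ℕ)⟩ := by
  unfold expectedSteps
  rw [Finset.sum_range_succ', add_comm]
  refine add_le_add (toOuterMeasure_le_one _ _) ?_
  simp only [Finset.mul_sum]
  rw [Finset.sum_comm]
  refine Finset.sum_le_sum fun t _ => ?_
  rw [run_random, PMF.toOuterMeasure_bind_apply, tsum_fintype]
  simp [PMF.uniformOfFintype_apply]

theorem Safe.random {Φ : Memory → Prop} {N x : ℕ} {e : Expr} {K : List Program} {M : Memory}
    (h : ∀ v < ⌊e.eval M⌋₊ + 1, Safe Φ N ⟨K, M.setReg x (v : ℕ)⟩) :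
    Safe Φ (N + 1) ⟨.random x e :: K, M⟩ := by
  intro t ht M' hM
  cases t with
  | zero => simp [run] at hM
  | succ t =>
    rw [run_random, PMF.mem_support_bind_iff] at hM
    obtain ⟨v, -, hv⟩ := hM
    exact h v v.2 t (by omega) M' hv

/-- The specification of `s` is applied with `u` pushed onto the remaining programs; this is why
`Spec` quantifies over them. -/
theorem Spec.seq {s u : Program} {M : Memory} {T T' : ℝ≥0∞} {Q : Memory → Prop}
    (h : Spec s M T fun M' => Spec u M' T' Q) : Spec (.seq s u) M (T + T' + 1) Q := by
  intro K N
  refine ⟨fun X hX => ?_, fun Φ hΦ => ?_⟩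
  · refine (expectedSteps_mono (Nat.le_succ N) _).trans
      ((expectedSteps_of_step (by rw [step]) N).trans ?_)
    have := (h (u :: K) N).1 (T' + X) fun M' hM => (hM K N).1 X hX
    calc _ ≤ 1 + (T + (T' + X)) := by gcongr
      _ = _ := by ring
  · refine Safe.mono (Safe.of_step (c' := ⟨s :: u :: K, M⟩) (by rw [step]) (by simp) ?_)
      (Nat.le_succ N)
    exact (h (u :: K) N).2 Φ fun M' hM => (hM K N).2 Φ hΦ

theorem Spec.loop_false {b : Cond} {s : Program} {M : Memory} {Q : Memory → Prop}
    (hb : ¬ b.Holds M) (h : Q M) : Spec (.loop b s) M 1 Q := by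
  have : Total (.loop b s) M 1 Q := ⟨1, M, .loop_false hb, le_rfl, h⟩
  simpa using of_total this

theorem Spec.loop_true {b : Cond} {s : Program} {M : Memory} {Q : Memory → Prop} {T T' : ℝ≥0∞}
    (hb : b.Holds M) (h : Spec s M T fun M' => Spec (.loop b s) M' T' Q) :
    Spec (.loop b s) M (T + T' + 1) Q := by
  intro K N
  have hst : step ⟨.loop b s :: K, M⟩ = PMF.pure ⟨s :: .loop b s :: K, M⟩ := by
    rw [step, if_pos hb]
  refine ⟨fun X hX => ?_, fun Φ hΦ => ?_⟩
  · refine (expectedSteps_mono (Nat.le_succ N) _).trans ((expectedSteps_of_step hst N).trans ?_)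
    have := (h (.loop b s :: K) N).1 (T' + X) fun M' hM => (hM K N).1 X hX
    calc _ ≤ 1 + (T + (T' + X)) := by gcongr
      _ = _ := by ring
  · refine Safe.mono (Safe.of_step hst (by simp) ?_) (Nat.le_succ N)
    exact (h (.loop b s :: K) N).2 Φ fun M' hM => (hM K N).2 Φ hΦ

/-- The time `τ j` depends on the iteration: the buckets of a hash table have different sizes, and
only the sum of these is under control. -/
theorem Spec.forLoop {i : ℕ} {e : Expr} {s : Program} {M : Memory} {Q : Memory → Prop}
    (N : ℕ) (τ : ℕ → ℝ≥0∞) (Inv : ℕ → Memory → Prop)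
    (hN : ∀ j M', Inv j M' → e.eval M' = N)
    (h0 : Inv 0 (M.setReg i 0))
    (hbody : ∀ j < N, ∀ M' : Memory, M'.reg i = j → Inv j M' →
      Spec s M' (τ j) fun M'' => M''.reg i = j ∧ Inv (j + 1) (M''.setReg i (j + 1)))
    (hQ : ∀ M', Inv N M' → Q M') :
    Spec (.forLoop i e s) M (∑ j ∈ Finset.range N, (τ j + 3) + 3) Q := by
  have key : ∀ l j, j + l = N → ∀ M' : Memory, M'.reg i = j → Inv j M' →
      Spec (.loop (.lt (.reg i) e) (s ;; i ::= .reg i + 1)) M'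
        (∑ j ∈ Finset.Ico j N, (τ j + 3) + 1) Q := by
    intro l
    induction l with
    | zero =>
      rintro j rfl M' hij hI
      have hb : ¬ (Cond.lt (.reg i) e).Holds M' := by
        rw [Cond.holds_lt, hN _ M' hI, Expr.eval_reg, hij]; simp
      simpa using Spec.loop_false hb (hQ M' (by simpa using hI))
    | succ l ih =>
      rintro j hj M' hij hI
      have hb : (Cond.lt (.reg i) e).Holds M' := by
        rw [Cond.holds_lt, hN _ M' hI, Expr.eval_reg, hij, Nat.cast_lt]; omega
      rw [Finset.sum_eq_sum_Ico_succ_bot (by omega)]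
      have := Spec.loop_true hb (T := τ j + 1 + 1) (T' := ∑ j ∈ Finset.Ico (j + 1) N, (τ j + 3) + 1)
        (Q := Q) (s := s ;; i ::= .reg i + 1) ?_
      · refine this.mono (le_of_eq ?_) fun _ h => h
        ring
      · refine Spec.seq ((hbody j (by omega) M' hij hI).mono le_rfl fun M'' hM => ?_)
        obtain ⟨hij', hI'⟩ := hM
        refine (Spec.of_total (n := 1) (Total.assign ?_)).mono (by simp) fun _ h => h
        refine ih (j + 1) (by omega) _ (by simp [hij']) ?_
        simpa [hij'] using hI'
  refine Spec.mono (T := 1 + (∑ j ∈ Finset.range N, (τ j + 3) + 1) + 1) (Q := Q) ?_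
    (le_of_eq (by ring)) fun _ h => h
  refine Spec.seq ((Spec.of_total (n := 1) (Total.assign ?_)).mono (by simp) fun _ h => h)
  rw [Finset.range_eq_Ico]
  exact key N 0 (by simp) _ (by simp) (by simpa using h0)

/-! ### Retry loops with success probability at least one half -/

/-- Good values cost at most `x`, all others at most `y ≥ x`. Since at least half of the values are
good, the average is largest when exactly half are. -/
theorem uniform_average_le {B : ℕ} (hB : 0 < B) (good : Finset (Fin B)) (hg : B ≤ 2 * good.card)
    (f : Fin B → ℝ≥0∞) {x y : ℝ≥0∞} (hxy : x ≤ y) (hx : ∀ v ∈ good, f v ≤ x) (hy : ∀ v, f v ≤ y) :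
    ∑ v, (B : ℝ≥0∞)⁻¹ * f v ≤ 2⁻¹ * x + 2⁻¹ * y := by
  rcases eq_or_ne y ⊤ with rfl | hyt
  · simp [ENNReal.mul_top]
  have hxt : x ≠ ⊤ := ne_top_of_le_ne_top hyt hxy
  have hc : good.card ≤ B := by simpa using Finset.card_le_univ good
  obtain ⟨l, hl⟩ := Nat.exists_eq_add_of_le hc
  have hl' : goodᶜ.card = l := by rw [Finset.card_compl, Fintype.card_fin]; omega
  have h1 : ∑ v, f v ≤ good.card * x + l * y := by
    rw [← Finset.sum_add_sum_compl good]
    refine add_le_add ?_ ?_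
    · simpa using Finset.sum_le_sum hx
    · have := Finset.sum_le_sum (s := goodᶜ) fun v _ => hy v
      simpa [hl'] using this
  rw [← Finset.mul_sum]
  refine (mul_le_mul_right h1 _).trans ?_
  lift x to NNReal using hxt
  lift y to NNReal using hyt
  have hB' : (B : NNReal) ≠ 0 := by positivity
  have e1 : (B : ℝ≥0∞)⁻¹ = ((B : NNReal)⁻¹ : NNReal) := by
    rw [ENNReal.coe_inv hB']; simp
  have e2 : (2 : ℝ≥0∞)⁻¹ = ((2 : NNReal)⁻¹ : NNReal) := by
    rw [ENNReal.coe_inv two_ne_zero]; simp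
  rw [e1, e2]
  norm_cast
  rw [inv_mul_le_iff₀ (by positivity), ← NNReal.coe_le_coe]
  have hxy' : (x : ℝ) ≤ y := by exact_mod_cast hxy
  push_cast
  have hg' : (B : ℝ) ≤ 2 * good.card := by exact_mod_cast hg
  have hl'' : (B : ℝ) = good.card + l := by exact_mod_cast hl
  rw [hl''] at hg' ⊢
  nlinarith [mul_nonneg (sub_nonneg.2 hg') (sub_nonneg.2 hxy')]

/-- A loop whose body draws a random number and then acts deterministically, such that at least
half of the numbers end the loop. -/
theorem Spec.retry {b : Cond} {s : Program} {x : ℕ} {e : Expr} {τ B : ℕ} (I : Memory → Prop)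
    (hB : 0 < B) (he : ∀ M, I M → ⌊e.eval M⌋₊ + 1 = B) (good : Finset (Fin B))
    (hg : B ≤ 2 * good.card)
    (hbody : ∀ M, I M → ∀ v : Fin B, Total s (M.setReg x (v : ℕ)) τ fun M' =>
      I M' ∧ (v ∈ good → ¬ b.Holds M'))
    {M : Memory} (hM : I M) :
    Spec (.loop b (.random x e ;; s)) M (2 * τ + 7) fun M' => I M' ∧ ¬ b.Holds M' := by
  intro K N
  -- The loop need not terminate surely, so the induction is on the time horizon: after a failed
  -- trial the same loop runs with a shorter horizon.
  induction N using Nat.strong_induction_on generalizing M with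
  | _ N ih =>
  by_cases hb : b.Holds M
  swap
  · obtain ⟨h1, h2⟩ := Spec.loop_false (s := .random x e ;; s)
      (Q := fun M' => I M' ∧ ¬ b.Holds M') hb ⟨hM, hb⟩ K N
    refine ⟨fun X hX => (h1 X hX).trans ?_, h2⟩
    gcongr
    calc (1 : ℝ≥0∞) ≤ 7 := by norm_num
      _ ≤ _ := le_add_self
  have hs1 : step ⟨.loop b (.random x e ;; s) :: K, M⟩ =
      PMF.pure ⟨(.random x e ;; s) :: .loop b (.random x e ;; s) :: K, M⟩ := by
    rw [step, if_pos hb]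
  have hs2 : step ⟨(.random x e ;; s) :: .loop b (.random x e ;; s) :: K, M⟩ =
      PMF.pure ⟨.random x e :: s :: .loop b (.random x e ;; s) :: K, M⟩ := by rw [step]
  obtain rfl := he M hM
  rcases N with _ | N
  · refine ⟨fun X _ => by simp [expectedSteps], fun Φ _ t ht M' hM' => ?_⟩
    obtain rfl : t = 0 := by omega
    simp [run] at hM'
  constructor
  · intro X hX
    have hX' : ∀ M', I M' ∧ ¬ b.Holds M' → expectedSteps N ⟨K, M'⟩ ≤ X := fun M' h =>
      (expectedSteps_mono (Nat.le_succ N) _).trans (hX M' h)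
    have hrand := expectedSteps_random N x e (s :: .loop b (.random x e ;; s) :: K) M
    -- The bound E = 2τ + 7 + X is the fixed point of E = 3 + (τ + 1 + X)/2 + (τ + E)/2: three steps
    -- for the test, the sequencing and the draw, then with weight one half either a final test or
    -- another start of the loop.
    have havg := uniform_average_le hB good hg
      (fun v => expectedSteps N ⟨s :: .loop b (.random x e ;; s) :: K, M.setReg x (v : ℕ)⟩)
      (x := τ + (1 + X)) (y := τ + (2 * τ + 7 + X)) ?_ ?_ ?_
    · calc expectedSteps (N + 1) ⟨.loop b (.random x e ;; s) :: K, M⟩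
          ≤ 1 + expectedSteps N ⟨(.random x e ;; s) :: .loop b (.random x e ;; s) :: K, M⟩ :=
            expectedSteps_of_step hs1 N
        _ ≤ 1 + (1 + expectedSteps N ⟨.random x e :: s :: .loop b (.random x e ;; s) :: K, M⟩) := by
            gcongr
            exact (expectedSteps_mono (Nat.le_succ N) _).trans (expectedSteps_of_step hs2 N)
        _ ≤ 1 + (1 + (1 + (2⁻¹ * (τ + (1 + X)) + 2⁻¹ * (τ + (2 * τ + 7 + X))))) := by
            gcongr
            exact (expectedSteps_mono (Nat.le_succ N) _).trans
              (hrand.trans (add_le_add le_rfl havg))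
        _ = 3 + (2⁻¹ * 2) * (τ + τ + X + 4) := by ring
        _ = 2 * τ + 7 + X := by
            rw [ENNReal.inv_mul_cancel two_ne_zero ENNReal.ofNat_ne_top]; ring
    · gcongr
      calc (1 : ℝ≥0∞) ≤ 7 := by norm_num
        _ ≤ _ := le_add_self
    · intro v hv
      obtain ⟨t, M', hex, ht, hI, hnb⟩ := hbody M hM v
      refine (hex.expectedSteps_le N _).trans (add_le_add (by exact_mod_cast ht) ?_)
      exact (Spec.loop_false (s := .random x e ;; s) (Q := fun M' => I M' ∧ ¬ b.Holds M')
        (hnb hv) ⟨hI, hnb hv⟩ K N).1 X hX'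
    · intro v
      obtain ⟨t, M', hex, ht, hI, -⟩ := hbody M hM v
      refine (hex.expectedSteps_le N _).trans (add_le_add (by exact_mod_cast ht) ?_)
      exact (ih N (Nat.lt_succ_self N) hI).1 X hX'
  · intro Φ hΦ
    refine Safe.of_step hs1 (by simp) ?_
    refine Safe.mono (Safe.of_step hs2 (by simp) ?_) (Nat.le_succ N)
    refine Safe.mono (Safe.random (N := N) fun v hv => ?_) (Nat.le_succ N)
    obtain ⟨t, M', hex, ht, hI, -⟩ := hbody M hM ⟨v, hv⟩
    exact hex.safe ((ih N (Nat.lt_succ_self N) hI).2 Φ fun M' h => (hΦ M' h).mono (Nat.le_succ N))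

/-- With nothing left to execute after `s`, the truncated expectations are exactly the partial sums
of the series that defines `expectedTime`. -/
theorem Spec.expectedTime_le {s : Program} {M : Memory} {T : ℝ≥0∞} {Q : Memory → Prop}
    (h : Spec s M T Q) : expectedTime s M ≤ T := by
  refine ENNReal.tsum_le_of_sum_range_le fun N => ?_
  have h0 : ∀ M', expectedSteps N ⟨[], M'⟩ ≤ 0 := by
    intro M'
    have : ∀ t, run t ⟨[], M'⟩ = PMF.pure ⟨[], M'⟩ := by
      intro t
      induction t with
      | zero => rfl
      | succ t ih => rw [run_succ, step, PMF.pure_bind, ih]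
    simp [expectedSteps, this]
  simpa [expectedSteps] using (h [] N).1 0 fun M' _ => h0 M'

theorem Spec.of_isOutcome {s : Program} {M M' : Memory} {T : ℝ≥0∞} {Q : Memory → Prop}
    (h : Spec s M T Q) (hM : IsOutcome s M M') : Q M' := by
  obtain ⟨t, ht⟩ := hM
  refine (h [] t).2 Q (fun M₁ hQ u _ M₂ hM₂ => ?_) t le_rfl M' ht
  have : ∀ t, run t ⟨[], M₁⟩ = PMF.pure ⟨[], M₁⟩ := by
    intro t
    induction t with
    | zero => rfl
    | succ t ih => rw [run_succ, step, PMF.pure_bind, ih]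
  rw [this] at hM₂
  obtain rfl : M₂ = M₁ := by simpa using hM₂
  exact hQ

theorem Total.returnsWithin {s : Program} {M : Memory} {T : ℕ} {v : ℝ}
    (h : Total s M T fun M' => M'.reg 0 = v) {T' : ℝ} (hT : (T : ℝ) ≤ T') :
    ReturnsWithin s M T' v := by
  obtain ⟨t, M', he, ht, hv⟩ := h
  refine ⟨t, le_trans (by exact_mod_cast ht) hT, fun c hc => ?_⟩
  rw [he.run_eq] at hc
  obtain rfl : c = ⟨[], M'⟩ := by simpa using hc
  exact ⟨rfl, hv⟩

/-! ### Reachability in the free-space grid -/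

/-- `Reach G i j`: there is a path of hops from `(0, 0)` to `(i, j)` through pairs satisfying `G`. -/
inductive Reach (G : ℕ → ℕ → Prop) : ℕ → ℕ → Prop
  | start : G 0 0 → Reach G 0 0
  | right {i j} : Reach G i j → G (i + 1) j → Reach G (i + 1) j
  | up {i j} : Reach G i j → G i (j + 1) → Reach G i (j + 1)
  | diag {i j} : Reach G i j → G (i + 1) (j + 1) → Reach G (i + 1) (j + 1)

namespace Reach

variable {G H : ℕ → ℕ → Prop} {i j l : ℕ}

theorem holds (h : Reach G i j) : G i j := by cases h <;> assumption

theorem imp (h : Reach G i j) (hGH : ∀ i' ≤ i, ∀ j' ≤ j, G i' j' → H i' j') : Reach H i j := by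
  induction h with
  | start h => exact .start (hGH 0 le_rfl 0 le_rfl h)
  | right _ h ih =>
    exact .right (ih fun i' hi j' hj => hGH i' (by omega) j' hj) (hGH _ le_rfl _ le_rfl h)
  | up _ h ih =>
    exact .up (ih fun i' hi j' hj => hGH i' hi j' (by omega)) (hGH _ le_rfl _ le_rfl h)
  | diag _ h ih =>
    exact .diag (ih fun i' hi j' hj => hGH i' (by omega) j' (by omega)) (hGH _ le_rfl _ le_rfl h)

theorem swap (h : Reach G i j) : Reach (fun a b => G b a) j i := by
  induction h with
  | start h => exact .start h
  | right _ h ih => exact .up ih h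
  | up _ h ih => exact .right ih h
  | diag _ h ih => exact .diag ih h

theorem comp_start (hG : G 0 0) (h : Reach H j l) (hj : j = 0) :
    Reach (fun a c => ∃ b, G a b ∧ H b c) 0 l := by
  induction h with
  | start h => exact .start ⟨0, hG, h⟩
  | right => omega
  | up _ h ih => subst hj; exact .up (ih rfl) ⟨0, hG, h⟩
  | diag => omega

/-- This is the combinatorial half of the triangle inequality: two paths that share the middle index
are merged into one path, pairing the outer indices that have a common middle partner. -/
theorem comp (h : Reach G i j) (h' : Reach H j l) :
    Reach (fun a c => ∃ b, G a b ∧ H b c) i l := by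
  induction h generalizing l with
  | start hG => exact comp_start hG h' rfl
  | right h hg ih => exact .right (ih h') ⟨_, hg, h'.holds⟩
  | @up i j h hg ih =>
    -- Walk back along the second path until it entered the middle index j + 1; up to there the
    -- outer index `i` stays fixed while the last index varies.
    generalize hj : j + 1 = j' at h'
    induction h' with
    | start => omega
    | @right j₁ l₁ h₁ _ _ =>
      obtain rfl : j = j₁ := by omega
      exact ih h₁
    | up _ hh ih₁ => subst hj; exact .up (ih₁ rfl) ⟨_, hg, hh⟩
    | @diag j₁ l₁ h₁ hh _ =>
      obtain rfl : j = j₁ := by omega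
      exact .up (ih h₁) ⟨_, hg, hh⟩
  | @diag i j h hg ih =>
    generalize hj : j + 1 = j' at h'
    induction h' with
    | start => omega
    | @right j₁ l₁ h₁ hh _ =>
      obtain rfl : j = j₁ := by omega
      exact .right (ih h₁) ⟨_, hg, hh⟩
    | up _ hh ih₁ => subst hj; exact .up (ih₁ rfl) ⟨_, hg, hh⟩
    | @diag j₁ l₁ h₁ hh _ =>
      obtain rfl : j = j₁ := by omega
      exact .diag (ih h₁) ⟨_, hg, hh⟩

/-- Every first index can be matched monotonically. -/
theorem exists_monotone (h : Reach G i j) :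
    ∃ v : ℕ → ℕ, Monotone v ∧ (∀ a, v a ≤ j) ∧ ∀ a ≤ i, G a (v a) := by
  -- The partner of a first index is the second index at which the path first reaches it. New first
  -- indices are appended with the current second index, the maximum so far, which keeps the
  -- matching monotone.
  have extend : ∀ (i j j' : ℕ) (v : ℕ → ℕ), j ≤ j' → Monotone v → (∀ a, v a ≤ j) →
      (∀ a ≤ i, G a (v a)) → G (i + 1) j' →
      ∃ v : ℕ → ℕ, Monotone v ∧ (∀ a, v a ≤ j') ∧ ∀ a ≤ i + 1, G a (v a) := by
    intro i j j' v hj hv hle hG hg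
    refine ⟨fun a => if a ≤ i then v a else j', fun a b hab => ?_, fun a => ?_, fun a ha => ?_⟩
    · dsimp only
      split_ifs
      · exact hv hab
      · exact (hle a).trans hj
      · omega
      · exact le_rfl
    · dsimp only
      split_ifs
      · exact (hle a).trans hj
      · exact le_rfl
    · dsimp only
      split_ifs with h
      · exact hG a h
      · obtain rfl : a = i + 1 := by omega
        exact hg
  induction h with
  | start h =>
    refine ⟨fun _ => 0, monotone_const, fun _ => le_rfl, fun a ha => ?_⟩
    obtain rfl : a = 0 := by omega
    exact h
  | @right i j _ h ih => obtain ⟨v, hv, hle, hG⟩ := ih; exact extend i j j v le_rfl hv hle hG h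
  | up _ _ ih =>
    obtain ⟨v, hv, hle, hG⟩ := ih
    exact ⟨v, hv, fun a => (hle a).trans (Nat.le_succ _), hG⟩
  | @diag i j _ h ih =>
    obtain ⟨v, hv, hle, hG⟩ := ih
    exact extend i j (j + 1) v (Nat.le_succ j) hv hle hG h

theorem of_diag (n : ℕ) (h : ∀ i ≤ n, G i i) : Reach G n n := by
  induction n with
  | zero => exact .start (h 0 le_rfl)
  | succ n ih => exact .diag (ih fun i hi => h i (by omega)) (h _ le_rfl)

theorem of_forall (n l : ℕ) (h : ∀ i j, G i j) : Reach G n l := by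
  induction n with
  | succ n ih => exact .right ih (h _ _)
  | zero =>
    induction l with
    | zero => exact .start (h 0 0)
    | succ l ih => exact .up ih (h _ _)

/-- This is the recursion evaluated by the dynamic program. -/
theorem iff_step : Reach G i j ↔ G i j ∧ ((i = 0 ∧ j = 0) ∨ (∃ i', i = i' + 1 ∧ Reach G i' j) ∨
    (∃ j', j = j' + 1 ∧ Reach G i j') ∨
    ∃ i' j', i = i' + 1 ∧ j = j' + 1 ∧ Reach G i' j') := by
  constructor
  · intro h
    refine ⟨h.holds, ?_⟩
    cases h with
    | start => exact .inl ⟨rfl, rfl⟩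
    | right h => exact .inr (.inl ⟨_, rfl, h⟩)
    | up h => exact .inr (.inr (.inl ⟨_, rfl, h⟩))
    | diag h => exact .inr (.inr (.inr ⟨_, _, rfl, rfl, h⟩))
  · rintro ⟨hG, ⟨rfl, rfl⟩ | ⟨i', rfl, h⟩ | ⟨j', rfl, h⟩ | ⟨i', j', rfl, rfl, h⟩⟩
    · exact .start hG
    · exact .right h hG
    · exact .up h hG
    · exact .diag h hG

end Reach

/-! ### Alignments as paths -/

section dfd

variable {d a b e : ℕ} (P : Curve d a) (Q : Curve d b)

/-- The vertices with indices `i` and `j` are within distance `x`. -/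
def Near (x : ℝ) (i j : ℕ) : Prop := ∃ (h : i < a) (h' : j < b), ‖P ⟨i, h⟩ - Q ⟨j, h'⟩‖ ≤ x

variable {P Q}

theorem frechetCost_le_iff {τ : List (Fin a × Fin b)} {x : ℝ} (hx : 0 ≤ x) :
    frechetCost P Q τ ≤ x ↔ ∀ p ∈ τ, ‖P p.1 - Q p.2‖ ≤ x := by
  unfold frechetCost
  induction τ with
  | nil => simpa
  | cons p τ ih => simp [ih]

/-- Costs therefore lie in a finite set, and the infimum in `dfd` is attained once an alignment
exists. -/
theorem frechetCost_mem (τ : List (Fin a × Fin b)) :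
    frechetCost P Q τ ∈ insert 0 (Set.range fun p : Fin a × Fin b => ‖P p.1 - Q p.2‖) := by
  unfold frechetCost
  induction τ with
  | nil => simp
  | cons p τ ih =>
    simp only [List.map_cons, List.foldr_cons]
    rcases max_cases ‖P p.1 - Q p.2‖ ((τ.map fun p => ‖P p.1 - Q p.2‖).foldr max 0) with h | h
    · rw [h.1]; exact .inr ⟨p, rfl⟩
    · rw [h.1]; exact ih

theorem reach_of_chain {x : ℝ} (τ : List (Fin a × Fin b)) : ∀ p, (p :: τ).IsChain Hop →
    Reach (Near P Q x) p.1 p.2 → (∀ q ∈ τ, ‖P q.1 - Q q.2‖ ≤ x) →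
    ∀ q, (p :: τ).getLast? = some q → Reach (Near P Q x) q.1 q.2 := by
  induction τ with
  | nil =>
    intro p _ hp _ q hq
    obtain rfl : p = q := by simpa using hq
    exact hp
  | cons p' τ ih =>
    intro p hc hp hτ q hq
    rw [List.isChain_cons_cons] at hc
    refine ih p' hc.2 ?_ (fun q hq => hτ q (by simp [hq])) q (by simpa using hq)
    have hG : Near P Q x p'.1 p'.2 := ⟨p'.1.2, p'.2.2, hτ p' (by simp)⟩
    rcases hc.1 with ⟨h1, h2⟩ | ⟨h1, h2⟩ | ⟨h1, h2⟩ <;> rw [h1, h2] at hG ⊢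
    · exact .right hp hG
    · exact .up hp hG
    · exact .diag hp hG

theorem chain_of_reach {x : ℝ} {i j : ℕ} (h : Reach (Near P Q x) i j) :
    ∃ (τ : List (Fin a × Fin b)) (q : Fin a × Fin b), (q.1 : ℕ) = i ∧ (q.2 : ℕ) = j ∧
      τ.getLast? = some q ∧ τ.IsChain Hop ∧ (∀ q ∈ τ, ‖P q.1 - Q q.2‖ ≤ x) ∧
      ∃ p, τ.head? = some p ∧ (p.1 : ℕ) = 0 ∧ (p.2 : ℕ) = 0 := by
  have extend : ∀ (i j i' j' : ℕ), (∀ (p q : Fin a × Fin b), (p.1 : ℕ) = i → (p.2 : ℕ) = j →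
      (q.1 : ℕ) = i' → (q.2 : ℕ) = j' → Hop p q) → Near P Q x i' j' →
      (∃ (τ : List (Fin a × Fin b)) (q : Fin a × Fin b), (q.1 : ℕ) = i ∧ (q.2 : ℕ) = j ∧
        τ.getLast? = some q ∧ τ.IsChain Hop ∧ (∀ q ∈ τ, ‖P q.1 - Q q.2‖ ≤ x) ∧
        ∃ p, τ.head? = some p ∧ (p.1 : ℕ) = 0 ∧ (p.2 : ℕ) = 0) →
      (∃ (τ : List (Fin a × Fin b)) (q : Fin a × Fin b), (q.1 : ℕ) = i' ∧ (q.2 : ℕ) = j' ∧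
        τ.getLast? = some q ∧ τ.IsChain Hop ∧ (∀ q ∈ τ, ‖P q.1 - Q q.2‖ ≤ x) ∧
        ∃ p, τ.head? = some p ∧ (p.1 : ℕ) = 0 ∧ (p.2 : ℕ) = 0) := by
    rintro i j i' j' hhop ⟨hi, hj, hG⟩ ⟨τ, q, h1, h2, h3, h4, h5, p, h6, h7⟩
    refine ⟨τ ++ [(⟨i', hi⟩, ⟨j', hj⟩)], (⟨i', hi⟩, ⟨j', hj⟩), rfl, rfl, by simp, ?_, ?_, p, ?_, h7⟩
    · rw [List.isChain_append]
      refine ⟨h4, by simp, fun y hy z hz => ?_⟩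
      rw [h3] at hy
      obtain rfl : q = y := by simpa using hy
      obtain rfl : (⟨i', hi⟩, ⟨j', hj⟩) = z := by simpa using hz
      exact hhop _ _ h1 h2 rfl rfl
    · intro y hy
      rcases List.mem_append.1 hy with hy | hy
      · exact h5 y hy
      · obtain rfl : y = (⟨i', hi⟩, ⟨j', hj⟩) := by simpa using hy
        exact hG
    · simp [List.head?_append, h6]
  induction h with
  | start h =>
    obtain ⟨hi, hj, hG⟩ := h
    exact ⟨[(⟨0, hi⟩, ⟨0, hj⟩)], (⟨0, hi⟩, ⟨0, hj⟩), rfl, rfl, rfl, by simp, by simpa using hG, _,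
      rfl, rfl, rfl⟩
  | @right i j _ hG ih =>
    exact extend i j _ _ (fun p q h1 h2 h3 h4 => .inl ⟨by omega, by omega⟩) hG ih
  | @up i j _ hG ih =>
    exact extend i j _ _ (fun p q h1 h2 h3 h4 => .inr (.inl ⟨by omega, by omega⟩)) hG ih
  | @diag i j _ hG ih =>
    exact extend i j _ _ (fun p q h1 h2 h3 h4 => .inr (.inr ⟨by omega, by omega⟩)) hG ih

theorem exists_alignment_iff_reach {x : ℝ} (hx : 0 ≤ x) (ha : 1 ≤ a) (hb : 1 ≤ b) :
    (∃ τ : List (Fin a × Fin b), IsAlignment τ ∧ frechetCost P Q τ ≤ x) ↔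
      Reach (Near P Q x) (a - 1) (b - 1) := by
  constructor
  · rintro ⟨τ, ⟨⟨p, hp, hp1, hp2⟩, ⟨q, hq, hq1, hq2⟩, hc⟩, hcost⟩
    rw [frechetCost_le_iff hx] at hcost
    obtain ⟨τ', rfl⟩ : ∃ τ', τ = p :: τ' := List.head?_eq_some_iff.1 hp
    have := reach_of_chain τ' p hc ?_ (fun q hq => hcost q (by simp [hq])) q hq
    · rwa [show (q.1 : ℕ) = a - 1 by omega, show (q.2 : ℕ) = b - 1 by omega] at this
    · have hG : Near P Q x p.1 p.2 := ⟨p.1.2, p.2.2, hcost p (by simp)⟩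
      rw [hp1, hp2] at hG ⊢
      exact .start hG
  · intro h
    obtain ⟨τ, q, h1, h2, h3, h4, h5, p, h6, h7, h8⟩ := chain_of_reach h
    exact ⟨τ, ⟨⟨p, h6, h7, h8⟩, ⟨q, h3, by omega, by omega⟩, h4⟩, (frechetCost_le_iff hx).2 h5⟩

theorem frechetCost_nonneg (τ : List (Fin a × Fin b)) : 0 ≤ frechetCost P Q τ := by
  rcases frechetCost_mem (P := P) (Q := Q) τ with h | ⟨p, hp⟩
  · exact h.ge
  · rw [← hp]; exact norm_nonneg _

/-- Nonempty curves have an alignment (every path through the index grid is one at a large enough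
cost bound), so the infimum is a minimum and the distance becomes a reachability question. -/
theorem dfd_le_iff {x : ℝ} (hx : 0 ≤ x) (ha : 1 ≤ a) (hb : 1 ≤ b) :
    dfd P Q ≤ x ↔ Reach (Near P Q x) (a - 1) (b - 1) := by
  rw [← exists_alignment_iff_reach hx ha hb]
  set S := {x | ∃ τ : List (Fin a × Fin b), IsAlignment τ ∧ x = frechetCost P Q τ} with hS
  have hbdd : BddBelow S := ⟨0, by rintro x ⟨τ, -, rfl⟩; exact frechetCost_nonneg τ⟩
  constructor
  · intro h
    have hfin : S.Finite := ((Set.finite_range _).insert 0).subset (by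
      rintro x ⟨τ, -, rfl⟩
      exact frechetCost_mem τ)
    have hne : S.Nonempty := by
      obtain ⟨y, hy⟩ : ∃ y, ∀ (i : Fin a) (j : Fin b), ‖P i - Q j‖ ≤ y := by
        obtain ⟨y, hy⟩ := (Set.finite_range fun p : Fin a × Fin b => ‖P p.1 - Q p.2‖).bddAbove
        exact ⟨y, fun i j => hy ⟨(i, j), rfl⟩⟩
      have hy0 : 0 ≤ y := (norm_nonneg _).trans (hy ⟨0, ha⟩ ⟨0, hb⟩)
      have : Reach (Near P Q y) (a - 1) (b - 1) := by
        refine (Reach.of_forall (G := fun _ _ => True) _ _ fun _ _ => trivial).imp ?_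
        intro i hi j hj _
        exact ⟨by omega, by omega, hy _ _⟩
      obtain ⟨τ, hτ, -⟩ := (exists_alignment_iff_reach hy0 ha hb).2 this
      exact ⟨_, τ, hτ, rfl⟩
    obtain ⟨τ, hτ, hcost⟩ := hne.csInf_mem hfin
    exact ⟨τ, hτ, hcost ▸ h⟩
  · rintro ⟨τ, hτ, hcost⟩
    exact (csInf_le hbdd ⟨τ, hτ, rfl⟩).trans hcost

theorem dfd_comm_le {x : ℝ} (hx : 0 ≤ x) (ha : 1 ≤ a) (hb : 1 ≤ b) (h : dfd P Q ≤ x) :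
    dfd Q P ≤ x := by
  rw [dfd_le_iff hx hb ha]
  refine ((dfd_le_iff hx ha hb).1 h).swap.imp ?_
  rintro i - j - ⟨hi, hj, h⟩
  exact ⟨hj, hi, by rwa [norm_sub_rev]⟩

theorem dfd_triangle_le {R : Curve d e} {x y : ℝ} (hx : 0 ≤ x) (hy : 0 ≤ y) (ha : 1 ≤ a)
    (hb : 1 ≤ b) (he : 1 ≤ e) (h : dfd P Q ≤ x) (h' : dfd Q R ≤ y) : dfd P R ≤ x + y := by
  rw [dfd_le_iff (add_nonneg hx hy) ha he]
  refine (((dfd_le_iff hx ha hb).1 h).comp ((dfd_le_iff hy hb he).1 h')).imp ?_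
  rintro i - j - ⟨l, ⟨hi, hl, h1⟩, ⟨_, hj, h2⟩⟩
  refine ⟨hi, hj, ?_⟩
  calc _ ≤ _ := norm_sub_le_norm_sub_add_norm_sub _ (Q ⟨l, hl⟩) _
    _ ≤ _ := add_le_add h1 h2

theorem dfd_le_of_forall {Q : Curve d a} {x : ℝ} (hx : 0 ≤ x) (ha : 1 ≤ a)
    (h : ∀ i, ‖P i - Q i‖ ≤ x) : dfd P Q ≤ x := by
  rw [dfd_le_iff hx ha ha]
  refine (Reach.of_diag (G := fun i j => i = j) _ fun _ _ => rfl).imp ?_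
  rintro i hi j hj rfl
  exact ⟨by omega, by omega, h _⟩

theorem norm_le_of_forall_abs_le {y : ℝ} (v : EuclideanSpace ℝ (Fin d))
    (h : ∀ t, |v t| ≤ y) (hy : 0 ≤ y) : ‖v‖ ≤ Real.sqrt d * y := by
  rw [EuclideanSpace.norm_eq, ← Real.sqrt_sq hy, ← Real.sqrt_mul (Nat.cast_nonneg d)]
  refine Real.sqrt_le_sqrt ?_
  calc _ ≤ ∑ _t : Fin d, y ^ 2 := Finset.sum_le_sum fun t _ => by
        rw [Real.norm_eq_abs]; exact pow_le_pow_left₀ (abs_nonneg _) (h t) 2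
    _ = _ := by simp

theorem dfd_roundCurve_le {k : ℕ} {δ : ℝ} (hδ : 0 < δ) (hk : 1 ≤ k) (Q : Curve d k) :
    dfd Q (roundCurve δ Q) ≤ Real.sqrt d * (δ / 2) := by
  refine dfd_le_of_forall (by positivity) hk fun j => norm_le_of_forall_abs_le _ (fun t => ?_)
    (by positivity)
  have h := abs_sub_round (Q j t / δ)
  have : (Q j - roundCurve δ Q j) t = δ * (Q j t / δ - round (Q j t / δ)) := by
    simp only [roundCurve, PiLp.sub_apply]
    field_simp
  rw [this, abs_mul, abs_of_pos hδ]
  nlinarith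

/-- Cauchy–Schwarz. It cancels the √d in the grid edge length when Euclidean distances are turned
into numbers of grid steps. -/
theorem sum_abs_le_sqrt_mul_norm (v : EuclideanSpace ℝ (Fin d)) :
    ∑ t, |v t| ≤ Real.sqrt d * ‖v‖ := by
  rw [EuclideanSpace.norm_eq, ← Real.sqrt_mul (Nat.cast_nonneg d)]
  refine Real.le_sqrt_of_sq_le ?_
  have := sq_sum_le_card_mul_sum_sq (s := Finset.univ) (f := fun t => |v t|)
  simpa using this

end dfd

/-! ### Curves as coordinate arrays -/

/-- The vector of the `d` entries of the array `A` starting at position `i`. -/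
noncomputable def row (d : ℕ) (A : ℕ → ℝ) (i : ℕ) : EuclideanSpace ℝ (Fin d) :=
  WithLp.toLp 2 fun t => A (i + t)

/-- Squared distance of two vectors stored in arrays. -/
def sqDist (d : ℕ) (A B : ℕ → ℝ) (i j : ℕ) : ℝ :=
  ∑ t ∈ Finset.range d, (A (i + t) - B (j + t)) ^ 2

theorem sqDist_eq_norm_sq (d : ℕ) (A B : ℕ → ℝ) (i j : ℕ) :
    sqDist d A B i j = ‖row d A i - row d B j‖ ^ 2 := by
  rw [EuclideanSpace.norm_sq_eq, sqDist, Finset.sum_range]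
  simp [row]

theorem sqDist_le_sq_iff {d : ℕ} {A B : ℕ → ℝ} {i j : ℕ} {x : ℝ} (hx : 0 ≤ x) :
    sqDist d A B i j ≤ x ^ 2 ↔ ‖row d A i - row d B j‖ ≤ x := by
  rw [sqDist_eq_norm_sq, sq_le_sq₀ (norm_nonneg _) hx]

theorem sqDist_congr {d : ℕ} {A A' B B' : ℕ → ℝ} {i i' j j' : ℕ}
    (hA : ∀ t < d, A (i + t) = A' (i' + t)) (hB : ∀ t < d, B (j + t) = B' (j' + t)) :
    sqDist d A B i j = sqDist d A' B' i' j' :=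
  Finset.sum_congr rfl fun t ht => by
    rw [hA t (Finset.mem_range.1 ht), hB t (Finset.mem_range.1 ht)]

theorem curveArray_apply {d len : ℕ} (P : Curve d len) {j t : ℕ} (hj : j < len) (ht : t < d) :
    curveArray P (j * d + t) = P ⟨j, hj⟩ ⟨t, ht⟩ := by
  have h1 : (j * d + t) / d = j := by
    rw [mul_comm, Nat.mul_add_div (by omega), Nat.div_eq_of_lt ht, add_zero]
  have h2 : (j * d + t) % d = t := by
    rw [mul_comm, Nat.mul_add_mod, Nat.mod_eq_of_lt ht]
  rw [curveArray, dif_pos (by rw [h1, h2]; exact ⟨hj, ht⟩)]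
  have key : ∀ a b (ha : a < len) (hb : b < d), a = j → b = t →
      P ⟨a, ha⟩ ⟨b, hb⟩ = P ⟨j, hj⟩ ⟨t, ht⟩ := by
    rintro _ _ _ _ rfl rfl
    rfl
  exact key _ _ _ _ h1 h2

theorem familyArray_apply {n m d : ℕ} (C : Fin n → Curve d m) {i a : ℕ} (hi : i < n)
    (ha : a < m * d) : familyArray C (i * (m * d) + a) = curveArray (C ⟨i, hi⟩) a := by
  have h1 : (i * (m * d) + a) / (m * d) = i := by
    rw [mul_comm, Nat.mul_add_div (by omega), Nat.div_eq_of_lt ha, add_zero]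
  have h2 : (i * (m * d) + a) % (m * d) = a := by
    rw [mul_comm, Nat.mul_add_mod, Nat.mod_eq_of_lt ha]
  rw [familyArray, dif_pos (by rw [h1]; exact hi), h2]
  congr 2
  exact Fin.ext h1

theorem row_curveArray {d len : ℕ} (P : Curve d len) {j : ℕ} (hj : j < len) :
    row d (curveArray P) (j * d) = P ⟨j, hj⟩ := by
  ext t
  exact curveArray_apply P hj t.2

theorem near_iff {d a b : ℕ} {P : Curve d a} {Q : Curve d b} {x : ℝ} (hx : 0 ≤ x) {i j : ℕ}
    (hi : i < a) (hj : j < b) :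
    Near P Q x i j ↔ sqDist d (curveArray P) (curveArray Q) (i * d) (j * d) ≤ x ^ 2 := by
  rw [sqDist_le_sq_iff hx, row_curveArray P hi, row_curveArray Q hj]
  exact ⟨fun ⟨_, _, h⟩ => h, fun h => ⟨hi, hj, h⟩⟩

theorem add_lt_mul_of_lt {j t k d : ℕ} (hj : j < k) (ht : t < d) : j * d + t < k * d :=
  calc j * d + t < j * d + d := by omega
    _ = (j + 1) * d := by ring
    _ ≤ k * d := Nat.mul_le_mul_right d hj

/-- Pairs of vertices of two curves in arrays that are within distance `x`. -/
def NearRows (d : ℕ) (A B : ℕ → ℝ) (x : ℝ) (i j : ℕ) : Prop :=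
  sqDist d A B (i * d) (j * d) ≤ x ^ 2

theorem dfd_le_iff_reach {d a b : ℕ} {P : Curve d a} {Q : Curve d b} {x : ℝ} (hx : 0 ≤ x)
    (ha : 1 ≤ a) (hb : 1 ≤ b) {A B : ℕ → ℝ} (hA : ∀ t < a * d, A t = curveArray P t)
    (hB : ∀ t < b * d, B t = curveArray Q t) :
    dfd P Q ≤ x ↔ Reach (NearRows d A B x) (a - 1) (b - 1) := by
  rw [dfd_le_iff hx ha hb]
  have key : ∀ i ≤ a - 1, ∀ j ≤ b - 1, Near P Q x i j ↔ NearRows d A B x i j := by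
    intro i hi j hj
    rw [near_iff hx (by omega) (by omega), NearRows]
    rw [sqDist_congr (fun t ht => (hA _ (add_lt_mul_of_lt (by omega) ht)).symm)
      (fun t ht => (hB _ (add_lt_mul_of_lt (by omega) ht)).symm)]
  exact ⟨fun h => h.imp fun i hi j hj => (key i hi j hj).1,
    fun h => h.imp fun i hi j hj => (key i hi j hj).2⟩

/-! ### Greedy partition of a curve -/

open Classical in
/-- Greedy partition into pieces within distance `y` of their first vertices: the index of the
piece of vertex `v` and the index of its first vertex. -/
noncomputable def greedy (d : ℕ) (A : ℕ → ℝ) (y : ℝ) : ℕ → ℕ × ℕ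
  | 0 => (0, 0)
  | v + 1 =>
    if NearRows d A A y (v + 1) (greedy d A y v).2 then greedy d A y v
    else ((greedy d A y v).1 + 1, v + 1)

section greedy

variable {d : ℕ} {A : ℕ → ℝ} {y : ℝ}

theorem nearRows_self (i : ℕ) : NearRows d A A y i i := by
  simpa [NearRows, sqDist] using sq_nonneg y

theorem greedy_near (v : ℕ) : NearRows d A A y v (greedy d A y v).2 := by
  cases v with
  | zero => exact nearRows_self 0
  | succ v =>
    rw [greedy]
    split_ifs with h
    · exact h
    · exact nearRows_self _

theorem greedy_snd_le (v : ℕ) : (greedy d A y v).2 ≤ v := by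
  induction v with
  | zero => simp [greedy]
  | succ v ih =>
    rw [greedy]
    split_ifs
    · exact ih.trans (Nat.le_succ v)
    · exact le_rfl

theorem greedy_fst_mono : Monotone fun v => (greedy d A y v).1 := by
  refine monotone_nat_of_le_succ fun v => ?_
  change (greedy d A y v).1 ≤ (greedy d A y (v + 1)).1
  conv_rhs => rw [greedy]
  split_ifs <;> simp

/-- A curve that can be matched to `Z` within distance `x` has no more pieces than vertices of `Z`
used. -/
theorem greedy_fst_le {Z : ℕ → ℝ} {x : ℝ} (hx : 0 ≤ x) (hxy : 2 * x ≤ y) {u : ℕ → ℕ}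
    (hu : Monotone u) {l : ℕ} (hZ : ∀ v ≤ l, NearRows d Z A x (u v) v) :
    ∀ v ≤ l, (greedy d A y v).1 ≤ u (greedy d A y v).2 := by
  intro v
  induction v with
  | zero => simp [greedy]
  | succ v ih =>
    intro hv
    have ih := ih (by omega)
    rw [greedy]
    split_ifs with h
    · exact ih
    · have hle := greedy_snd_le (d := d) (A := A) (y := y) v
      -- If the vertex of `Z` matched to the new first vertex equalled the one matched to the
      -- previous first vertex, these two would be within 2x ≤ y, and no new piece would have been
      -- opened.
      refine lt_of_le_of_lt ih (lt_of_le_of_ne (hu (by omega)) fun heq => h ?_)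
      have h1 := (sqDist_le_sq_iff hx).1 (hZ (v + 1) hv)
      have h2 := (sqDist_le_sq_iff hx).1 (hZ (greedy d A y v).2 (by omega))
      rw [heq] at h2
      refine (sqDist_le_sq_iff (by linarith)).2 ?_
      rw [norm_sub_rev] at h1
      calc _ ≤ _ := norm_sub_le_norm_sub_add_norm_sub _ (row d Z (u (v + 1) * d)) _
        _ ≤ x + x := add_le_add h1 h2
        _ ≤ y := by linarith

end greedy

/-! ### Coding of candidate curves by numbers -/

/-- The number of trailing binary ones of `b`, and what remains after removing them and the
following zero. -/
def unary (b : ℕ) : ℕ × ℕ :=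
  if h : b % 2 = 1 then ((unary (b / 2)).1 + 1, (unary (b / 2)).2) else (0, b / 2)
termination_by b
decreasing_by all_goals omega

theorem unary_odd {b : ℕ} (h : b % 2 = 1) :
    unary b = ((unary (b / 2)).1 + 1, (unary (b / 2)).2) := by
  rw [unary, dif_pos h]

theorem unary_even {b : ℕ} (h : ¬ b % 2 = 1) : unary b = (0, b / 2) := by
  rw [unary, dif_neg h]

theorem unary_snd_le (b : ℕ) : (unary b).2 ≤ b := by
  induction b using Nat.strong_induction_on with
  | _ b ih =>
  by_cases h : b % 2 = 1
  · rw [unary_odd h]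
    exact (ih (b / 2) (by omega)).trans (Nat.div_le_self _ _)
  · rw [unary_even h]
    exact Nat.div_le_self _ _

/-- In binary, `c` consists of the digits of `b`, followed by a zero and `a` ones. -/
theorem exists_unary (a b : ℕ) : ∃ c, unary c = (a, b) ∧ c + 1 = 2 ^ a * (2 * b + 1) := by
  induction a with
  | zero =>
    refine ⟨2 * b, ?_, by ring⟩
    rw [unary_even (by omega)]
    simp
  | succ a ih =>
    obtain ⟨c, hc, he⟩ := ih
    refine ⟨2 * c + 1, ?_, ?_⟩
    · rw [unary_odd (by omega), show (2 * c + 1) / 2 = c by omega, hc]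
    · rw [pow_succ]; nlinarith

/-- One step of decoding: the codes of the remaining coordinates. -/
def decStep (R : ℕ) (σ : ℕ × ℕ) : ℕ × ℕ :=
  ((unary (unary (unary σ.1).2).2).2, σ.2 / R)

/-- The increment of the piece index in a decoding step. -/
def decInc (σ : ℕ × ℕ) : ℕ := (unary σ.1).1

/-- The coordinate difference in a decoding step. -/
def decDiff (R : ℕ) (σ : ℕ × ℕ) : ℤ :=
  -(R * (unary (unary σ.1).2).1 : ℕ) + (R * (unary (unary (unary σ.1).2).2).1 : ℕ) + (σ.2 % R : ℕ)

theorem decStep_fst_le (R : ℕ) (σ : ℕ × ℕ) : (decStep R σ).1 ≤ σ.1 :=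
  (unary_snd_le _).trans ((unary_snd_le _).trans (unary_snd_le _))

theorem decStep_iterate_fst_le (R : ℕ) (σ : ℕ × ℕ) (t : ℕ) : ((decStep R)^[t] σ).1 ≤ σ.1 := by
  induction t with
  | zero => rfl
  | succ t ih =>
    rw [Function.iterate_succ_apply']
    exact (decStep_fst_le _ _).trans ih

/-- Each coordinate contributes three unary blocks to `b`, every one with a terminating zero (hence
the 3K), and one base-R digit to `g`. The first coordinate sits in the lowest positions, so the code
is built from the last coordinate backwards. -/
theorem exists_code {R : ℕ} (K : ℕ) (inc dn up dig : ℕ → ℕ) (hdig : ∀ t, dig t < R) :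
    ∃ b g, b + 1 ≤ 2 ^ (∑ t ∈ Finset.range K, (inc t + dn t + up t) + 3 * K) ∧ g < R ^ K ∧
      ∀ t < K, decInc ((decStep R)^[t] (b, g)) = inc t ∧
        decDiff R ((decStep R)^[t] (b, g)) = -(R * dn t : ℕ) + (R * up t : ℕ) + (dig t : ℕ) := by
  induction K generalizing inc dn up dig with
  | zero => exact ⟨0, 0, by simp, by simp, by simp⟩
  | succ K ih =>
    obtain ⟨b, g, hb, hg, h⟩ := ih (fun t => inc (t + 1)) (fun t => dn (t + 1))
      (fun t => up (t + 1)) (fun t => dig (t + 1)) fun t => hdig _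
    obtain ⟨b₁, h₁, hb₁⟩ := exists_unary (up 0) b
    obtain ⟨b₂, h₂, hb₂⟩ := exists_unary (dn 0) b₁
    obtain ⟨b₃, h₃, hb₃⟩ := exists_unary (inc 0) b₂
    have hR : 0 < R := (Nat.zero_le _).trans_lt (hdig 0)
    have hdiv : (dig 0 + R * g) / R = g := by
      rw [Nat.add_mul_div_left _ _ hR, Nat.div_eq_of_lt (hdig 0), zero_add]
    have hmod : (dig 0 + R * g) % R = dig 0 := by
      rw [Nat.add_mul_mod_self_left, Nat.mod_eq_of_lt (hdig 0)]
    have hstep : decStep R (b₃, dig 0 + R * g) = (b, g) := by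
      simp only [decStep, h₃, h₂, h₁, hdiv]
    refine ⟨b₃, dig 0 + R * g, ?_, ?_, ?_⟩
    · have e : ∀ a c c' : ℕ, c + 1 = 2 ^ a * (2 * c' + 1) → c + 1 ≤ 2 ^ (a + 1) * (c' + 1) := by
        intro a c c' h
        rw [h, pow_succ, mul_assoc]
        exact Nat.mul_le_mul_left _ (by omega)
      calc b₃ + 1 ≤ 2 ^ (inc 0 + 1) * (2 ^ (dn 0 + 1) * (2 ^ (up 0 + 1) * (b + 1))) :=
            (e _ _ _ hb₃).trans (Nat.mul_le_mul_left _ ((e _ _ _ hb₂).trans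
              (Nat.mul_le_mul_left _ (e _ _ _ hb₁))))
        _ ≤ 2 ^ (inc 0 + 1) * (2 ^ (dn 0 + 1) * (2 ^ (up 0 + 1) *
            2 ^ (∑ t ∈ Finset.range K, (inc (t + 1) + dn (t + 1) + up (t + 1)) + 3 * K))) := by
            gcongr
        _ = _ := by
            rw [Finset.sum_range_succ', ← pow_add, ← pow_add, ← pow_add]
            congr 1
            ring
    · rw [pow_succ]
      calc dig 0 + R * g < R + R * g := by have := hdig 0; omega
        _ = (g + 1) * R := by ring
        _ ≤ _ := Nat.mul_le_mul_right R hg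
    · intro t ht
      cases t with
      | zero => simp [decInc, decDiff, h₃, h₂, h₁, hmod]
      | succ t =>
        rw [Function.iterate_succ_apply, hstep]
        exact h t (by omega)

theorem sum_range_mul_le {d : ℕ} (k : ℕ) (f : ℕ → ℝ) {x : ℝ}
    (h : ∀ j < k, ∑ t ∈ Finset.range d, f (j * d + t) ≤ x) :
    ∑ t ∈ Finset.range (k * d), f t ≤ k * x := by
  induction k with
  | zero => simp
  | succ k ih =>
    rw [add_mul, one_mul, Finset.sum_range_add]
    push_cast
    have := h k (by omega)
    have := ih fun j hj => h j (by omega)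
    linarith

/-- The number of values of a coordinate digit. -/
noncomputable def digitBase (ε : ℝ) : ℕ := ⌊1 / ε⌋₊ + 1

/-- Every grid curve near the curve `A` is decoded from a pair of small numbers, relative to the
pieces of the greedy partition of `A`. -/
theorem exists_decode {d m k : ℕ} (hd : 1 ≤ d) (hm : 1 ≤ m) (hk : 1 ≤ k) {ε r δ : ℝ} (hε : 0 < ε)
    (hε1 : ε ≤ 1) (hr : 0 < r) (hδ : δ = ε * r / Real.sqrt d) {A : ℕ → ℝ} {rep : ℕ → ℕ}
    (hrep : ∀ v < m, rep (greedy d A (3 * r) v).1 = (greedy d A (3 * r) v).2) {z : ℕ → ℤ}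
    (h : Reach (NearRows d (fun t => δ * z t) A ((1 + ε / 2) * r)) (k - 1) (m - 1)) :
    ∃ b g, b < 2 ^ (11 * (k * d)) ∧ g < digitBase ε ^ (k * d) ∧ ∀ t < k * d,
      z t = ⌊A (rep (∑ s ∈ Finset.range (t + 1), decInc ((decStep (digitBase ε))^[s] (b, g))) * d +
          t % d) / δ⌋ + decDiff (digitBase ε) ((decStep (digitBase ε))^[t] (b, g)) := by
  set R := digitBase ε with hR
  set ρ := (1 + ε / 2) * r with hρ
  have hρ0 : 0 ≤ ρ := by positivity
  -- This is where ε ≤ 1 enters. It gives both 2ρ ≤ 3r, needed for counting pieces, and ρ + 3r ≤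
  -- 9r/2.
  have hρr : ρ ≤ 3 / 2 * r := by rw [hρ]; nlinarith
  have hsd : 0 < Real.sqrt d := Real.sqrt_pos.2 (by exact_mod_cast hd)
  have hδ0 : 0 < δ := by rw [hδ]; positivity
  have hRε : 1 / ε ≤ R := by rw [hR, digitBase]; push_cast; exact (Nat.lt_floor_add_one _).le
  have hR0 : 0 < R := by rw [hR, digitBase]; omega
  obtain ⟨v, hv, hvm, hvn⟩ := h.exists_monotone
  obtain ⟨u, hu, huk, hun⟩ := h.swap.exists_monotone
  -- The coordinate `t` belongs to the vertex t / d of the grid curve; `p t` is the piece containing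
  -- the input vertex matched to it.
  set p : ℕ → ℕ := fun t => (greedy d A (3 * r) (v (t / d))).1 with hp
  have hpm : Monotone p := fun s t hst => greedy_fst_mono (hv (Nat.div_le_div_right hst))
  have hpk : ∀ t, p t ≤ k - 1 := fun t =>
    (greedy_fst_le hρ0 (by linarith) hu (l := m - 1) (fun a ha => hun a ha) _ (hvm _)).trans (huk _)
  -- The difference to be coded: relative to the rounded-down coordinate of the first vertex of the
  -- piece, in grid units.
  set x : ℕ → ℤ := fun t => z t - ⌊A (rep (p t) * d + t % d) / δ⌋ with hx
  -- The pieces are visited in order, so natural increments suffice. They telescope to an index at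
  -- most k - 1.
  set inc : ℕ → ℕ := fun t => p t - (if t = 0 then 0 else p (t - 1)) with hinc
  have hincsum : ∀ t, ∑ s ∈ Finset.range (t + 1), inc s = p t := by
    intro t
    induction t with
    | zero => simp [hinc]
    | succ t ih =>
      rw [Finset.sum_range_succ, ih]
      have := hpm (show t ≤ t + 1 by omega)
      simp only [hinc, Nat.succ_ne_zero, if_false, Nat.add_sub_cancel]
      omega
  obtain ⟨b, g, hb, hg, hbg⟩ := exists_code (R := R) (k * d) inc (fun t => (-(x t / R)).toNat)
    (fun t => (x t / R).toNat) (fun t => (x t % R).toNat) fun t => by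
      have := Int.emod_lt_of_pos (x t) (by exact_mod_cast hR0 : (0 : ℤ) < R)
      have := Int.emod_nonneg (x t) (by exact_mod_cast hR0.ne' : (R : ℤ) ≠ 0)
      omega
  refine ⟨b, g, ?_, hg, fun t ht => ?_⟩
  · have hK : 1 ≤ k * d := Nat.mul_pos hk hd
    have h1 : ∑ t ∈ Finset.range (k * d), inc t ≤ k * d := by
      have := hincsum (k * d - 1)
      rw [Nat.sub_add_cancel hK] at this
      rw [this]
      exact (hpk _).trans ((Nat.sub_le _ _).trans (Nat.le_mul_of_pos_right k hd))
    -- For each of the k vertices the ℓ¹ distance is at most √d·(9r/2), which is 9d/(2ε) after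
    -- division by δ.
    have h2 : ∑ t ∈ Finset.range (k * d), |((z t : ℝ) - A (rep (p t) * d + t % d) / δ)| ≤
        k * (9 / 2 * d / ε) := by
      refine sum_range_mul_le k _ fun j hj => ?_
      have hj' := hvn j (by omega)
      have hg' := greedy_near (d := d) (A := A) (y := 3 * r) (v j)
      rw [← hrep (v j) (by have := hvm j; omega)] at hg'
      have e1 := (sqDist_le_sq_iff hρ0).1 hj'
      have e2 := (sqDist_le_sq_iff (by positivity)).1 hg'
      have e3 := (norm_sub_le_norm_sub_add_norm_sub (row d (fun t => δ * z t) (j * d))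
        (row d A (v j * d)) (row d A (rep (greedy d A (3 * r) (v j)).1 * d)))
      have e4 := (sum_abs_le_sqrt_mul_norm _).trans
        (mul_le_mul_of_nonneg_left (e3.trans (add_le_add e1 e2)) hsd.le)
      have e5 : ∀ t ∈ Finset.range d,
          |((z (j * d + t) : ℝ) - A (rep (p (j * d + t)) * d + (j * d + t) % d) / δ)| =
          |δ * z (j * d + t) - A (rep (greedy d A (3 * r) (v j)).1 * d + t)| / δ := by
        intro t ht
        have ht := Finset.mem_range.1 ht
        have h1 : (j * d + t) / d = j := by
          rw [mul_comm, Nat.mul_add_div (by omega), Nat.div_eq_of_lt ht, add_zero]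
        have h2 : (j * d + t) % d = t := by
          rw [mul_comm, Nat.mul_add_mod, Nat.mod_eq_of_lt ht]
        simp only [hp, h1, h2]
        rw [eq_div_iff hδ0.ne', ← abs_of_pos hδ0, ← abs_mul, abs_of_pos hδ0]
        congr 1
        field_simp
      rw [Finset.sum_congr rfl e5, ← Finset.sum_div, div_le_iff₀ hδ0, Finset.sum_range]
      have e6 : 9 / 2 * (d : ℝ) / ε * δ = Real.sqrt d * (9 / 2 * r) := by
        rw [hδ]
        field_simp
        rw [Real.sq_sqrt (Nat.cast_nonneg d)]
      rw [e6]
      refine le_trans ?_ (e4.trans ?_)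
      · simp [row]
      · gcongr; linarith
    -- At most one of the two truncations is nonzero, so each term is |x t / R|. As R ≥ 1/ε, it is
    -- at most ε|x t| + 1, and rounding down the base point costs at most ε ≤ 1 more. Altogether 9/2
    -- + 2 = 13/2 per coordinate on average.
    have h3 : ∑ t ∈ Finset.range (k * d), (((-(x t / R)).toNat + (x t / R).toNat : ℕ) : ℝ) ≤
        13 / 2 * (k * d : ℕ) := by
      have : ∀ t ∈ Finset.range (k * d), (((-(x t / R)).toNat + (x t / R).toNat : ℕ) : ℝ) ≤
          ε * |((z t : ℝ) - A (rep (p t) * d + t % d) / δ)| + 2 := by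
        intro t _
        have e1 : (((-(x t / R)).toNat + (x t / R).toNat : ℕ) : ℝ) = |((x t / R : ℤ) : ℝ)| := by
          rw [← Int.cast_abs, ← Int.cast_natCast]
          congr 1
          rw [Int.abs_eq_natAbs]
          omega
        have e2 : |((x t / R : ℤ) : ℝ)| ≤ |(x t : ℝ)| / R + 1 := by
          have a1 : ((x t / R : ℤ) : ℝ) * R + ((x t % R : ℤ) : ℝ) = x t := by
            exact_mod_cast Int.ediv_mul_add_emod (x t) R
          have a2 : (0 : ℝ) ≤ ((x t % R : ℤ) : ℝ) := by
            exact_mod_cast Int.emod_nonneg (x t) (by exact_mod_cast hR0.ne' : (R : ℤ) ≠ 0)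
          have a3 : ((x t % R : ℤ) : ℝ) ≤ R := by
            exact_mod_cast (Int.emod_lt_of_pos (x t) (by exact_mod_cast hR0 : (0 : ℤ) < R)).le
          have a4 : (0 : ℝ) < R := by exact_mod_cast hR0
          rw [← add_le_add_iff_right (-1 : ℝ), add_neg_cancel_right, le_div_iff₀ a4]
          rcases abs_cases ((x t / R : ℤ) : ℝ) with ⟨h, _⟩ | ⟨h, _⟩ <;> rw [h] <;>
            [have := le_abs_self (x t : ℝ); have := neg_abs_le (x t : ℝ)] <;> nlinarith
        have e3 : |(x t : ℝ)| ≤ |((z t : ℝ) - A (rep (p t) * d + t % d) / δ)| + 1 := by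
          have a1 := Int.floor_le (A (rep (p t) * d + t % d) / δ)
          have a2 := (Int.lt_floor_add_one (A (rep (p t) * d + t % d) / δ)).le
          simp only [hx, Int.cast_sub]
          rw [abs_le]
          constructor
          · have := neg_abs_le ((z t : ℝ) - A (rep (p t) * d + t % d) / δ)
            linarith
          · have := le_abs_self ((z t : ℝ) - A (rep (p t) * d + t % d) / δ)
            linarith
        have e4 : |(x t : ℝ)| / R ≤ ε * |(x t : ℝ)| := by
          rw [div_le_iff₀ (by exact_mod_cast hR0)]
          have : 1 ≤ ε * R := by rwa [div_le_iff₀' hε] at hRε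
          nlinarith [abs_nonneg (x t : ℝ)]
        rw [e1]
        nlinarith
      refine (Finset.sum_le_sum this).trans ?_
      rw [Finset.sum_add_distrib, ← Finset.mul_sum]
      have e1 := mul_le_mul_of_nonneg_left h2 hε.le
      have e2 : ε * (k * (9 / 2 * d / ε)) = 9 / 2 * (k * d) := by field_simp
      simp only [Finset.sum_const, Finset.card_range, nsmul_eq_mul]
      push_cast
      linarith
    -- Per coordinate: 1 for the increments, 13/2 for the quotients and 3 terminators, hence at most
    -- 11 bits.
    have h4 : ∑ t ∈ Finset.range (k * d), (inc t + (-(x t / R)).toNat + (x t / R).toNat) +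
        3 * (k * d) ≤ 11 * (k * d) := by
      have e1 : 2 * ∑ t ∈ Finset.range (k * d), ((-(x t / R)).toNat + (x t / R).toNat) ≤
          13 * (k * d) := by
        have : (2 : ℝ) * ∑ t ∈ Finset.range (k * d),
            (((-(x t / R)).toNat + (x t / R).toNat : ℕ) : ℝ) ≤ 13 * (k * d : ℕ) := by linarith
        exact_mod_cast this
      have e2 : ∑ t ∈ Finset.range (k * d), (inc t + (-(x t / R)).toNat + (x t / R).toNat) =
          ∑ t ∈ Finset.range (k * d), inc t +
          ∑ t ∈ Finset.range (k * d), ((-(x t / R)).toNat + (x t / R).toNat) := by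
        rw [← Finset.sum_add_distrib]
        exact Finset.sum_congr rfl fun _ _ => by ring
      omega
    exact lt_of_lt_of_le (Nat.lt_of_succ_le hb) (Nat.pow_le_pow_right (by omega) h4)
  · have e : ∑ s ∈ Finset.range (t + 1), decInc ((decStep R)^[s] (b, g)) = p t := by
      rw [← hincsum t]
      refine Finset.sum_congr rfl fun s hs => (hbg s ?_).1
      have := Finset.mem_range.1 hs
      omega
    rw [e, (hbg t ht).2]
    have h1 := Int.mul_ediv_add_emod (x t) R
    have h2 := Int.emod_nonneg (x t) (by exact_mod_cast hR0.ne' : (R : ℤ) ≠ 0)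
    have h3 : (((x t / R).toNat : ℕ) : ℤ) - ((-(x t / R)).toNat : ℕ) = x t / R := by omega
    have h4 : (((x t % R).toNat : ℕ) : ℤ) = x t % R := by omega
    push_cast
    rw [h4]
    have h5 : z t = ⌊A (rep (p t) * d + t % d) / δ⌋ + x t := by simp [hx]
    rw [h5]
    linear_combination -h1 - R * h3

/-! ### Multiplicative hashing -/

/-- The hash value of `x` for the multiplier `a`: the fractional part of `a x / M`, scaled to
`{0, …, S - 1}`. -/
def hash (M S a x : ℕ) : ℕ := a * x % M * S / M

theorem hash_lt {M S a x : ℕ} (hM : 0 < M) (hS : 0 < S) : hash M S a x < S := by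
  rw [hash, Nat.div_lt_iff_lt_mul hM, mul_comm S]
  exact Nat.mul_lt_mul_of_pos_right (Nat.mod_lt _ hM) hS

theorem natCast_div_floor (a b : ℕ) : ((⌊(a : ℝ) / b⌋ : ℤ) : ℝ) = ((a / b : ℕ) : ℝ) := by
  rw [← Nat.floor_div_eq_div (K := ℝ) a b, natCast_floor_eq_intCast_floor (by positivity)]

/-- The left side is what the machine computes with real arithmetic; it has no integer remainder
operation. -/
theorem hash_eq_floor (M S a x : ℕ) :
    ((⌊(S : ℝ) * ((a : ℝ) * x / M - ((⌊(a : ℝ) * x / M⌋ : ℤ) : ℝ))⌋ : ℤ) : ℝ) = hash M S a x := by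
  have h := natCast_div_floor (a * x) M
  push_cast at h
  rcases Nat.eq_zero_or_pos M with rfl | hM
  · simp [hash]
  have hM' : (M : ℝ) ≠ 0 := by positivity
  have e : (a : ℝ) * x / M - ((a * x / M : ℕ) : ℝ) = ((a * x % M : ℕ) : ℝ) / M := by
    have : ((M * (a * x / M) + a * x % M : ℕ) : ℝ) = (a * x : ℕ) := by
      rw [Nat.div_add_mod]
    push_cast at this
    field_simp
    linarith
  rw [h, e, hash, ← natCast_div_floor]
  rw [show (S : ℝ) * (((a * x % M : ℕ) : ℝ) / M) = ((a * x % M * S : ℕ) : ℝ) / M by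
    push_cast; ring]

/-- With E = x - y, a collision forces aE to lie within M/S of a multiple qM. Here q takes at most E
+ 1 values, and for each of them the multipliers lie in an interval of length 2M/(ES). That makes at
most 2E(2M/(ES) + 1) = 4M/S + 2E multipliers, and ES ≤ US ≤ M absorbs the last term. -/
theorem card_collisions_le {M S U x y : ℕ} (hS : 0 < S) (hUM : U * S ≤ M) (hx : x < U)
    (hyx : y < x) :
    ((Finset.range M).filter fun a => hash M S a x = hash M S a y).card * S ≤ 6 * M := by
  obtain ⟨D, rfl⟩ := Nat.exists_eq_add_of_lt hyx
  set E := D + 1 with hE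
  set F := (Finset.range M).filter fun a => hash M S a (y + D + 1) = hash M S a y with hF
  have hM : 0 < M := lt_of_lt_of_le (Nat.mul_pos (by omega) hS) hUM
  set q : ℕ → ℤ := fun a => (a * (y + D + 1) / M : ℕ) - (a * y / M : ℕ) with hq
  -- Equal hash values mean that the two remainders times S have the same quotient modulo M, so they
  -- differ by less than M.
  have hclose : ∀ a ∈ F, |(a : ℤ) * E - M * q a| * S < M := by
    intro a ha
    have hh : hash M S a (y + D + 1) = hash M S a y := (Finset.mem_filter.1 ha).2
    unfold hash at hh
    have h1 := Nat.div_add_mod (a * (y + D + 1) % M * S) M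
    have h2 := Nat.div_add_mod (a * y % M * S) M
    have h3 := Nat.mod_lt (a * (y + D + 1) % M * S) hM
    have h4 := Nat.mod_lt (a * y % M * S) hM
    have h5 := Nat.div_add_mod (a * (y + D + 1)) M
    have h6 := Nat.div_add_mod (a * y) M
    have h7 : (a : ℤ) * E - M * q a = (a * (y + D + 1) % M : ℕ) - (a * y % M : ℕ) := by
      simp only [hq, hE]
      zify at h5 h6 ⊢
      linear_combination h6 - h5
    rw [h7, ← abs_of_nonneg (Int.natCast_nonneg S), ← abs_mul, sub_mul, abs_lt]
    rw [hh] at h1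
    constructor
    · zify at h1 h2 h3 h4 ⊢
      have := Int.natCast_nonneg (a * (y + D + 1) % M * S % M)
      push_cast at this
      linarith
    · zify at h1 h2 h3 h4 ⊢
      have := Int.natCast_nonneg (a * y % M * S % M)
      push_cast at this
      linarith
  have hS' : (1 : ℤ) ≤ S := by exact_mod_cast hS
  have hM' : (0 : ℤ) < M := by exact_mod_cast hM
  -- The product aE lies between 0 and ME and is less than M away from M·q.
  have hq0 : ∀ a ∈ F, 0 ≤ q a ∧ q a ≤ E := by
    intro a ha
    have h := hclose a ha
    have haM : (a : ℤ) < M := by exact_mod_cast Finset.mem_range.1 (Finset.mem_filter.1 ha).1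
    have ha0 : (0 : ℤ) ≤ a * E := by positivity
    have h' : |(a : ℤ) * E - M * q a| < M :=
      lt_of_le_of_lt (le_mul_of_one_le_right (abs_nonneg _) hS') h
    rw [abs_lt] at h'
    constructor
    · by_contra hneg
      have : q a ≤ -1 := by omega
      nlinarith
    · by_contra hneg
      have : (E : ℤ) + 1 ≤ q a := by omega
      have hE0 : (0 : ℤ) ≤ E := by positivity
      nlinarith
  -- Sort the colliding multipliers by their nearby multiple of M: at most E + 1 fibres, whose sizes
  -- are bounded separately.
  have hcard := Finset.card_le_mul_card_image_of_maps_to (s := F) (t := Finset.range (E + 1))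
    (f := fun a => (q a).toNat) (fun a ha => by
      have := hq0 a ha
      rw [Finset.mem_range]
      omega) (2 * M / (E * S) + 1) ?_
  · rw [Finset.card_range] at hcard
    have hES : E * S ≤ M := (Nat.mul_le_mul_right S (by omega)).trans hUM
    have h1 : 2 * M / (E * S) * (E * S) ≤ 2 * M := Nat.div_mul_le_self _ _
    calc F.card * S ≤ (2 * M / (E * S) + 1) * (E + 1) * S := Nat.mul_le_mul_right S hcard
      _ ≤ (2 * M / (E * S) + 1) * (2 * E) * S := by gcongr; omega
      _ = 2 * (2 * M / (E * S) * (E * S)) + 2 * (E * S) := by ring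
      _ ≤ 6 * M := by omega
  · intro c _
    set F' := F.filter fun a => (q a).toNat = c with hF'
    rcases F'.eq_empty_or_nonempty with h0 | hne
    · rw [h0]; simp
    · obtain ⟨a₀, ha₀, hmin⟩ : ∃ a₀ ∈ F', ∀ a ∈ F', a₀ ≤ a :=
        ⟨F'.min' hne, F'.min'_mem hne, fun a ha => F'.min'_le a ha⟩
      -- Multipliers with the same q have products with E less than 2M/S apart; the interval starts
      -- at the smallest of them.
      have hsub : F' ⊆ Finset.Icc a₀ (a₀ + 2 * M / (E * S)) := by
        intro a ha
        have hle := hmin a ha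
        rw [Finset.mem_Icc]
        refine ⟨hle, ?_⟩
        have k1 := hclose a (Finset.mem_filter.1 ha).1
        have k2 := hclose a₀ (Finset.mem_filter.1 ha₀).1
        have k3 : q a = q a₀ := by
          have := hq0 a (Finset.mem_filter.1 ha).1
          have := hq0 a₀ (Finset.mem_filter.1 ha₀).1
          have := (Finset.mem_filter.1 ha).2
          have := (Finset.mem_filter.1 ha₀).2
          omega
        rw [k3] at k1
        have k4 := le_abs_self ((a : ℤ) * E - M * q a₀)
        have k5 := neg_abs_le ((a₀ : ℤ) * E - M * q a₀)
        have k6 : ((a : ℤ) - a₀) * (E * S) ≤ 2 * M := by nlinarith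
        have k7 : (a - a₀) * (E * S) ≤ 2 * M := by
          zify
          rw [Nat.cast_sub hle]
          exact k6
        have := (Nat.le_div_iff_mul_le (Nat.mul_pos (by omega) hS)).2 k7
        omega
      refine (Finset.card_le_card hsub).trans ?_
      rw [Nat.card_Icc]
      generalize 2 * M / (E * S) = w
      omega

theorem card_collisions_le' {M S U x y : ℕ} (hS : 0 < S) (hUM : U * S ≤ M) (hx : x < U)
    (hy : y < U) (hxy : x ≠ y) :
    ((Finset.range M).filter fun a => hash M S a x = hash M S a y).card * S ≤ 6 * M := by
  rcases lt_or_gt_of_ne hxy with h | h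
  · simpa only [eq_comm] using card_collisions_le hS hUM hy h
  · exact card_collisions_le hS hUM hx h

/-- The number of ordered pairs of distinct elements of `X` that collide. -/
def collisions (M S a : ℕ) (X : Finset ℕ) : ℕ :=
  (X.offDiag.filter fun p => hash M S a p.1 = hash M S a p.2).card

/-- Exchange the summations over multipliers and pairs; each of the fewer than |X|² ordered pairs of
distinct keys, if there are any, contributes at most 6M/S. -/
theorem sum_collisions_le {M S U : ℕ} (hS : 0 < S) (hUM : U * S ≤ M) {X : Finset ℕ}
    (hX : ∀ x ∈ X, x < U) :
    (∑ a ∈ Finset.range M, collisions M S a X) * S ≤ X.card ^ 2 * (6 * M) := by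
  have : ∑ a ∈ Finset.range M, collisions M S a X = ∑ p ∈ X.offDiag,
      ((Finset.range M).filter fun a => hash M S a p.1 = hash M S a p.2).card := by
    simp only [collisions, Finset.card_filter]
    exact Finset.sum_comm
  rw [this, Finset.sum_mul]
  calc _ ≤ ∑ p ∈ X.offDiag, 6 * M := Finset.sum_le_sum fun p hp => by
        rw [Finset.mem_offDiag] at hp
        exact card_collisions_le' hS hUM (hX _ hp.1) (hX _ hp.2.1) hp.2.2
    _ ≤ _ := by
        rw [Finset.sum_const, smul_eq_mul, Finset.offDiag_card, ← sq]
        exact Nat.mul_le_mul_right _ (Nat.sub_le _ _)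

/-! ### At least half of the multipliers are good -/

/-- Markov's inequality: the average of `f` is at most c/2, so `f` reaches c for at most half of the
arguments. -/
theorem half_le_card_of_markov {M c : ℕ} (hc : 0 < c) (f : ℕ → ℕ)
    (hf : ∑ a ∈ Finset.range M, f a * 2 ≤ M * c) :
    M ≤ 2 * (Finset.univ.filter fun a : Fin M => f a < c).card := by
  set bad := Finset.univ.filter fun a : Fin M => ¬ f a < c with hbad
  have h1 : (Finset.univ.filter fun a : Fin M => f a < c).card + bad.card = M := by
    rw [hbad, Finset.card_filter_add_card_filter_not, Finset.card_univ, Fintype.card_fin]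
  have h2 : bad.card * (c * 2) ≤ M * c := by
    refine le_trans ?_ hf
    rw [Finset.sum_range, ← smul_eq_mul]
    refine (Finset.card_nsmul_le_sum bad (fun a : Fin M => f a * 2) (c * 2) fun a ha => ?_).trans
      (Finset.sum_le_sum_of_subset (Finset.subset_univ _))
    have := (Finset.mem_filter.1 ha).2
    omega
  have h3 : bad.card * 2 ≤ M := by
    refine Nat.le_of_mul_le_mul_right (c := c) ?_ hc
    linarith
  omega

/-- The sum of the squared bucket sizes. -/
theorem sum_sq_buckets {M S : ℕ} (hM : 0 < M) (hS : 0 < S) (a : ℕ) (X : Finset ℕ) :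
    ∑ i ∈ Finset.range S, (X.filter fun x => hash M S a x = i).card ^ 2 =
      X.card + collisions M S a X := by
  have h1 : ((X ×ˢ X).filter fun p => hash M S a p.1 = hash M S a p.2).card =
      ∑ i ∈ Finset.range S, (X.filter fun x => hash M S a x = i).card ^ 2 := by
    rw [Finset.card_eq_sum_card_fiberwise (t := Finset.range S) (f := fun p => hash M S a p.1)
      (fun p _ => by simpa using hash_lt hM hS)]
    refine Finset.sum_congr rfl fun i _ => ?_
    rw [sq, ← Finset.card_product]
    congr 1
    ext p
    simp only [Finset.mem_filter, Finset.mem_product]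
    constructor
    · rintro ⟨⟨⟨h1, h2⟩, h3⟩, h4⟩; exact ⟨⟨h1, h4⟩, h2, h3 ▸ h4⟩
    · rintro ⟨⟨h1, h4⟩, h2, h3⟩; exact ⟨⟨⟨h1, h2⟩, h4.trans h3.symm⟩, h4⟩
  rw [← h1, ← Finset.diag_union_offDiag, Finset.filter_union, Finset.card_union_of_disjoint
    (Finset.disjoint_filter_filter (Finset.disjoint_diag_offDiag X)), collisions]
  congr 1
  rw [Finset.filter_true_of_mem, Finset.diag_card]
  intro p hp
  rw [(Finset.mem_diag.1 hp).2]

/-- The sum of squared bucket sizes counts the ordered pairs with equal hash values: s diagonal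
pairs plus the collisions, of which there are on average at most 6s²/(s + 1). -/
theorem half_le_card_sum_sq {M U : ℕ} (hM : 0 < M) {L : List ℕ} (hL : L.Nodup)
    (hU : ∀ x ∈ L, x < U) (hUM : U * (L.length + 1) ≤ M) :
    M ≤ 2 * (Finset.univ.filter fun a : Fin M => ∑ i ∈ Finset.range (L.length + 1),
      (L.filter fun x => hash M (L.length + 1) a x = i).length ^ 2 ≤ 14 * L.length).card := by
  set S := L.length + 1 with hS
  have hcard : L.toFinset.card = L.length := List.toFinset_card_of_nodup hL
  have h := sum_collisions_le (by omega) hUM (X := L.toFinset) fun x hx => hU x (by simpa using hx)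
  have hsum : ∀ a : ℕ, ∑ i ∈ Finset.range S, (L.filter fun x => hash M S a x = i).length ^ 2 =
      L.length + collisions M S a L.toFinset := by
    intro a
    rw [← hcard, ← sum_sq_buckets hM (by omega)]
    refine Finset.sum_congr rfl fun i _ => ?_
    rw [← List.toFinset_card_of_nodup (hL.filter _), List.toFinset_filter]
    simp
  -- Twice the average stays below 13s + 1, and fewer than 13s + 1 collisions means a sum of squares
  -- of at most 14s.
  refine (half_le_card_of_markov (M := M) (c := 13 * L.length + 1) (by omega)
    (fun a => collisions M S a L.toFinset) ?_).trans ?_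
  · refine Nat.le_of_mul_le_mul_right (c := S) ?_ (by omega)
    rw [← Finset.sum_mul]
    rw [hcard] at h
    calc _ = ((∑ a ∈ Finset.range M, collisions M S a L.toFinset) * S) * 2 := by ring
      _ ≤ L.length ^ 2 * (6 * M) * 2 := Nat.mul_le_mul_right 2 h
      _ ≤ M * (13 * L.length + 1) * S := by rw [hS]; nlinarith [Nat.zero_le (M * L.length)]
  · refine Nat.mul_le_mul_left 2 (Finset.card_le_card fun a ha => ?_)
    rw [Finset.mem_filter] at ha ⊢
    refine ⟨ha.1, ?_⟩
    rw [hsum]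
    omega

/-- With 12b² slots the average number of collisions is at most 1/2, so at least half of the
multipliers have none. -/
theorem half_le_card_injOn {M U T : ℕ} {L : List ℕ} (hL : L.Nodup)
    (hU : ∀ x ∈ L, x < U) (hT : T = 12 * L.length * L.length) (hUM : U * T ≤ M) :
    M ≤ 2 * (Finset.univ.filter fun a : Fin M => ∀ x ∈ L, ∀ y ∈ L,
      hash M T a x = hash M T a y → x = y).card := by
  have hcard : L.toFinset.card = L.length := List.toFinset_card_of_nodup hL
  have hgood : ∀ a, collisions M T a L.toFinset < 1 → ∀ x ∈ L, ∀ y ∈ L,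
      hash M T a x = hash M T a y → x = y := by
    intro a ha x hx y hy hxy
    by_contra hne
    rw [Nat.lt_one_iff, collisions, Finset.card_eq_zero] at ha
    have : (x, y) ∈ (∅ : Finset (ℕ × ℕ)) := by
      rw [← ha]
      simp [hx, hy, hne, hxy]
    simp at this
  refine (half_le_card_of_markov (M := M) (c := 1) (by omega)
    (fun a => collisions M T a L.toFinset) ?_).trans ?_
  -- An empty bucket gets no slots, and the collision bound, which needs a positive range, does not
  -- apply to it.
  · rcases L.length.eq_zero_or_pos with h0 | h0
    · obtain rfl := List.length_eq_zero_iff.1 h0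
      simp [collisions]
    · have hT0 : 0 < T := by rw [hT]; positivity
      have h := sum_collisions_le hT0 hUM (X := L.toFinset) fun x hx => hU x (by simpa using hx)
      rw [hcard] at h
      refine Nat.le_of_mul_le_mul_right (c := T) ?_ hT0
      rw [← Finset.sum_mul]
      calc _ = ((∑ a ∈ Finset.range M, collisions M T a L.toFinset) * T) * 2 := by ring
        _ ≤ L.length ^ 2 * (6 * M) * 2 := Nat.mul_le_mul_right 2 h
        _ = M * 1 * T := by rw [hT]; ring
  · refine Nat.mul_le_mul_left 2 (Finset.card_le_card fun a ha => ?_)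
    rw [Finset.mem_filter] at ha ⊢
    exact ⟨ha.1, hgood a ha.2⟩

open CurveANN.Expr (reg read)
open CurveANN.Program (forLoop)

/-! ### The preprocessing program

Registers: `0`–`5` hold `n, m, d, k, ε, r`; `6`: `k d`; `7`: the edge length of the grid; `8`: the
base of coordinate digits; `9`: the number of candidates per curve; `10`: the number of digit
sequences; `11`: a bound on grid coordinates; `12`: the number of keys; `13`: the current curve;
`14`: the current candidate; `15`, `16`: its code; `17`: a loop counter; `18`: the current piece;
`19`: a grid coordinate; `20`: a key; `21`, `22`: a vertex and the last piece of the greedy partition;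
`23`, `24`: a squared distance and its loop counter; `27`, `28`: vertex indices of an alignment;
`29`: the base of keys; `30`: the squared distance threshold; `31`: a bound on keys; `32`: the
modulus of hash functions; `33`: the number of buckets; `34`: the sum of their squared sizes; `35`: the
primary multiplier; `36`: a hash value; `37`: a key; `38`: the number of slots in use; `39`: the
current bucket; `40`: the number of its slots; `41`: whether two of its keys collide; `42`: its
multiplier; `43`: a position in the data structure.

Arrays: `0`: input; `1`: data structure; `2`: candidate curve; `3`: reachability table; `4`: first
vertices of pieces; `5`: list of keys; `6`: labels of keys; `7`: bucket sizes; `8`: buckets. -/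

/-- The position of vertex `v` of the current curve in the input. -/
def vertexPos (v : Expr) : Expr := reg 13 * (reg 1 * reg 2) + v * reg 2

/-- Remove trailing binary ones and the following zero from register `15`, adding `e` to
register `x` for each of the ones. -/
def unaryProg (x : ℕ) (e : Expr) : Program :=
  .loop (.eq (reg 15 - 2 * Expr.floor (reg 15 / 2)) 1)
    (x ::= reg x + e ;; 15 ::= Expr.floor (reg 15 / 2)) ;;
  15 ::= Expr.floor (reg 15 / 2)

/-- Put the squared distance of two vectors into register `23`. -/
def distProg (a a' : ℕ) (e e' : Expr) : Program :=
  23 ::= 0 ;;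
  forLoop 24 (reg 2) (23 ::= reg 23 + (read a (e + reg 24) - read a' (e' + reg 24)) *
    (read a (e + reg 24) - read a' (e' + reg 24)))

/-- Compute the greedy partition of the current curve. -/
def greedyProg : Program :=
  22 ::= 0 ;; .write 4 0 0 ;;
  forLoop 21 (reg 1)
    (distProg 0 0 (vertexPos (reg 21)) (vertexPos (read 4 (reg 22))) ;;
      .ite (.le (reg 23) (9 * (reg 5 * reg 5))) .skip
        (22 ::= reg 22 + 1 ;; .write 4 (reg 22) (reg 21)))

/-- Decode one coordinate. -/
def decodeStepProg : Program :=
  unaryProg 18 1 ;;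
  19 ::= Expr.floor (read 0 (vertexPos (read 4 (reg 18)) +
    (reg 17 - reg 2 * Expr.floor (reg 17 / reg 2))) / reg 7) ;;
  unaryProg 19 (0 - reg 8) ;;
  unaryProg 19 (reg 8) ;;
  19 ::= reg 19 + (reg 16 - reg 8 * Expr.floor (reg 16 / reg 8)) ;;
  16 ::= Expr.floor (reg 16 / reg 8) ;;
  .write 2 (reg 17) (reg 7 * reg 19) ;;
  20 ::= reg 20 * reg 29 + (reg 19 + reg 11)

/-- Decode a candidate curve and compute its key. -/
def decodeProg : Program :=
  18 ::= 0 ;; 20 ::= 0 ;; forLoop 17 (reg 6) decodeStepProg ;; 20 ::= reg 20 + 1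

/-- The position of the entry `(j, v)` in the reachability table. -/
def tablePos (j v : Expr) : Expr := j * (reg 1 + 1) + v

/-- Compute the reachability table of the candidate curve and the current curve. -/
def checkProg : Program :=
  .write 3 0 1 ;;
  forLoop 27 (reg 3) (forLoop 28 (reg 1)
    (distProg 2 0 (reg 27 * reg 2) (vertexPos (reg 28)) ;;
      .ite (.and (.le (reg 23) (reg 30))
          (.lt 0 (read 3 (tablePos (reg 27) (reg 28)) + read 3 (tablePos (reg 27) (reg 28 + 1)) +
            read 3 (tablePos (reg 27 + 1) (reg 28)))))
        (.write 3 (tablePos (reg 27 + 1) (reg 28 + 1)) 1)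
        (.write 3 (tablePos (reg 27 + 1) (reg 28 + 1)) 0)))

/-- Insert the key of the candidate curve if it is near and new. -/
def insertProg : Program :=
  .ite (.and (.lt 0 (read 3 (tablePos (reg 3) (reg 1)))) (.le (read 6 (reg 20)) 0))
    (.write 6 (reg 20) (reg 13 + 1) ;; .write 5 (reg 12) (reg 20) ;; 12 ::= reg 12 + 1)
    .skip

/-- Process one candidate. -/
def candidateProg : Program :=
  15 ::= Expr.floor (reg 14 / reg 10) ;; 16 ::= reg 14 - reg 10 * reg 15 ;;
  decodeProg ;; checkProg ;; insertProg

/-- Collect the keys of all grid curves near input curves. -/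
def collectProg : Program :=
  forLoop 13 (reg 0) (greedyProg ;; forLoop 14 (reg 9) candidateProg)

/-- Compute the bound on grid coordinates. -/
def boundProg : Program :=
  11 ::= 0 ;;
  forLoop 17 (reg 0 * (reg 1 * reg 2))
    (.ite (.lt (reg 11) (read 0 (reg 17))) (11 ::= read 0 (reg 17)) .skip ;;
      .ite (.lt (reg 11) (0 - read 0 (reg 17))) (11 ::= 0 - read 0 (reg 17)) .skip) ;;
  11 ::= Expr.floor ((reg 11 + 2 * reg 5) / reg 7) + 1

/-- Compute the parameters. -/
def setupProg : Program :=
  6 ::= reg 3 * reg 2 ;;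
  7 ::= reg 4 * reg 5 / Expr.sqrt (reg 2) ;;
  8 ::= Expr.floor (1 / reg 4) + 1 ;;
  30 ::= (1 + reg 4 / 2) * reg 5 * ((1 + reg 4 / 2) * reg 5) ;;
  boundProg ;;
  29 ::= 2 * reg 11 + 1 ;;
  9 ::= 1 ;; 10 ::= 1 ;; 31 ::= 1 ;;
  forLoop 17 (reg 6)
    (9 ::= reg 9 * (2048 * reg 8) ;; 10 ::= reg 10 * reg 8 ;; 31 ::= reg 31 * reg 29) ;;
  31 ::= reg 31 + 1

/-- The hash value of `x` for multiplier `a`, modulus `M` and range `S`. -/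
def hashExpr (M S a x : Expr) : Expr := Expr.floor (S * (a * x / M - Expr.floor (a * x / M)))

/-- Distribute the keys to buckets. -/
def bucketProg : Program :=
  forLoop 17 (reg 33) (.write 7 (reg 17) 0) ;;
  34 ::= 0 ;;
  forLoop 17 (reg 12)
    (37 ::= read 5 (reg 17) ;;
      36 ::= hashExpr (reg 32) (reg 33) (reg 35) (reg 37) ;;
      .write 8 (reg 36 * reg 33 + read 7 (reg 36)) (reg 37) ;;
      34 ::= reg 34 + (2 * read 7 (reg 36) + 1) ;;
      .write 7 (reg 36) (read 7 (reg 36) + 1))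

/-- Distribute the keys to buckets with small sum of squared sizes. -/
def primaryProg : Program :=
  33 ::= reg 12 + 1 ;;
  32 ::= reg 31 * (12 * reg 12 * reg 12 + reg 12 + 1) ;;
  34 ::= 14 * reg 12 + 1 ;;
  .loop (.lt (14 * reg 12) (reg 34)) (.random 35 (reg 32 - 1) ;; bucketProg)

/-- Load the key with index in register `17` of the current bucket and compute its position. -/
def slotProg : Program :=
  37 ::= read 8 (reg 39 * reg 33 + reg 17) ;;
  43 ::= 5 + 3 * reg 33 + 2 * (reg 38 + hashExpr (reg 32) (reg 40) (reg 42) (reg 37))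

/-- Write the keys of the current bucket to their slots, and test whether they collide. -/
def placeProg : Program :=
  41 ::= 0 ;;
  forLoop 17 (read 7 (reg 39))
    (slotProg ;; .write 1 (reg 43) (reg 37) ;; .write 1 (reg 43 + 1) (read 6 (reg 37))) ;;
  forLoop 17 (read 7 (reg 39))
    (slotProg ;; .ite (.eq (read 1 (reg 43)) (reg 37)) .skip (41 ::= 1))

/-- Place the keys of all buckets. -/
def secondaryProg : Program :=
  38 ::= 0 ;;
  forLoop 39 (reg 33)
    (40 ::= 12 * read 7 (reg 39) * read 7 (reg 39) ;;
      41 ::= 1 ;;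
      .loop (.lt 0 (reg 41)) (.random 42 (reg 32 - 1) ;; placeProg) ;;
      .write 1 (5 + 3 * reg 39) (reg 42) ;;
      .write 1 (6 + 3 * reg 39) (reg 38) ;;
      .write 1 (7 + 3 * reg 39) (reg 40) ;;
      38 ::= reg 38 + reg 40)

/-- Write the header of the data structure. -/
def headerProg : Program :=
  .write 1 0 (reg 7) ;; .write 1 1 (reg 11) ;; .write 1 2 (reg 32) ;; .write 1 3 (reg 35) ;;
  .write 1 4 (reg 33) ;; 0 ::= 5 + 3 * reg 33 + 2 * reg 38

/-- The preprocessing program. -/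
def prepProg : Program :=
  setupProg ;; collectProg ;; primaryProg ;; secondaryProg ;; headerProg

/-! ### The query program

Registers: `0`: answer; `1`: `k`; `2`: `d`; `3`: `k d`; `4`: key; `5`: whether a coordinate is out
of bounds; `6`: a loop counter; `7`: a rounded coordinate; `8`, `9`: positions in the data structure.
-/

/-- Round the query curve and compute its key. -/
def roundProg : Program :=
  forLoop 6 (reg 3)
    (7 ::= Expr.floor (read 1 (reg 6) / read 0 0 + 1 / 2) ;;
      .ite (.and (.le (0 - read 0 1) (reg 7)) (.le (reg 7) (read 0 1))) .skip (5 ::= 1) ;;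
      4 ::= reg 4 * (2 * read 0 1 + 1) + (reg 7 + read 0 1))

/-- Look up the key. -/
def lookupProg : Program :=
  8 ::= 5 + 3 * hashExpr (read 0 2) (read 0 4) (read 0 3) (reg 4) ;;
  9 ::= 5 + 3 * read 0 4 + 2 * (read 0 (reg 8 + 1) +
    hashExpr (read 0 2) (read 0 (reg 8 + 2)) (read 0 (reg 8)) (reg 4)) ;;
  .ite (.eq (read 0 (reg 9)) (reg 4)) (0 ::= read 0 (reg 9 + 1)) (0 ::= 0)

/-- The query program. -/
def queryProg : Program :=
  3 ::= reg 1 * reg 2 ;; 4 ::= 0 ;; 5 ::= 0 ;; roundProg ;; 4 ::= reg 4 + 1 ;;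
  .ite (.lt 0 (reg 5)) (0 ::= 0) lookupProg

/-! ### Auxiliary facts on frames and rounding -/

/-- A frame depends only on which registers are written, so the expression `e` and the value `v` are
unrelated; later uses put `0` for `e`. -/
theorem Frame.seq_assign {s : Program} {x : ℕ} {e : Expr} {M M' : Memory} {v : ℝ}
    (h : Frame s (M.setReg x v) M') : Frame (x ::= e ;; s) M M' := by
  refine ⟨fun y hy => ?_, fun a ha => ?_⟩
  · simp only [Program.writesReg, Bool.or_eq_false_iff, beq_eq_false_iff_ne] at hy
    rw [h.reg y hy.2]
    simp [hy.1]
  · simp only [Program.writesArr, Bool.false_or] at ha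
    exact h.arr a ha

theorem Frame.seq_write {s : Program} {b : ℕ} {i e : Expr} {M M' : Memory} {l : ℕ} {v : ℝ}
    (h : Frame s (M.setArr b l v) M') : Frame (.write b i e ;; s) M M' := by
  refine ⟨fun y hy => ?_, fun a ha => ?_⟩
  · simp only [Program.writesReg, Bool.false_or] at hy
    exact h.reg y hy
  · simp only [Program.writesArr, Bool.or_eq_false_iff, beq_eq_false_iff_ne] at ha
    rw [h.arr a ha.2, Memory.setArr_arr, if_neg ha.1]

theorem floor_eq_of_eq {x : ℝ} {n : ℕ} (h : x = n) : ⌊x⌋₊ = n := by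
  rw [h, Nat.floor_natCast]

theorem natCast_mod_eq (a b : ℕ) :
    (a : ℝ) - b * ((⌊(a : ℝ) / b⌋ : ℤ) : ℝ) = ((a % b : ℕ) : ℝ) := by
  rw [natCast_div_floor]
  have : ((b * (a / b) + a % b : ℕ) : ℝ) = a := by rw [Nat.div_add_mod]
  push_cast at this
  linarith

theorem natCast_half_floor (a : ℕ) : ((⌊(a : ℝ) / 2⌋ : ℤ) : ℝ) = ((a / 2 : ℕ) : ℝ) := by
  exact_mod_cast natCast_div_floor a 2

/-! ### Specifications of the parts of the preprocessing program -/

/-- Every removed binary one halves the code, so a code below 2^β allows at most β rounds of four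
steps. -/
theorem unaryProg_total {M : Memory} {x b β : ℕ} {e : Expr} {E : ℝ} (hx : x ≠ 15)
    (hb : M.reg 15 = b) (hβ : b < 2 ^ β) (he : ∀ M', Frame (unaryProg x e) M M' → e.eval M' = E) :
    Total (unaryProg x e) M (4 * β + 3) fun M' =>
      M'.reg 15 = (unary b).2 ∧ M'.reg x = M.reg x + (unary b).1 * E := by
  have hfr : ∀ {M'}, Frame (.loop (.eq (reg 15 - 2 * Expr.floor (reg 15 / 2)) 1)
      (x ::= reg x + e ;; 15 ::= Expr.floor (reg 15 / 2))) M M' → Frame (unaryProg x e) M M' :=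
    fun h => h.of_writes (by simp +contextual [unaryProg, Program.writesReg])
      (by simp +contextual [unaryProg, Program.writesArr])
  have hcond : ∀ {M' : Memory} {b' : ℕ}, M'.reg 15 = b' →
      ((Cond.eq (reg 15 - 2 * Expr.floor (reg 15 / 2)) 1).Holds M' ↔ b' % 2 = 1) := by
    intro M' b' h
    have := natCast_mod_eq b' 2
    rw [Nat.cast_ofNat] at this
    simp only [Cond.holds_eq, Expr.eval_sub, Expr.eval_mul, Expr.eval_reg, Expr.eval_ofNat,
      Expr.eval_floor, Expr.eval_div, Expr.eval_one, h]
    rw [this]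
    norm_cast
  refine (Total.seq' (T' := 1) (Total.loop (N := β) (τ := 3) (fun l M' => ∃ b' : ℕ, M'.reg 15 = b' ∧
    b' < 2 ^ l ∧ (unary b).2 = (unary b').2 ∧
      M.reg x + (unary b).1 * E = M'.reg x + (unary b').1 * E)
    ⟨b, hb, hβ, rfl, rfl⟩ ?_ (Q := fun M' => ∃ b' : ℕ, M'.reg 15 = b' ∧
      b' / 2 = (unary b).2 ∧ M'.reg x = M.reg x + (unary b).1 * E) ?_) ?_).mono (by omega)
      fun _ _ h => h
  · rintro j M' hf ⟨b', h1, h2, h3, h4⟩ hc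
    rw [hcond h1] at hc
    have hj : j ≠ 0 := by
      rintro rfl
      simp at h2
      omega
    obtain ⟨i, rfl⟩ : ∃ i, j = i + 1 := ⟨j - 1, by omega⟩
    refine ⟨i, rfl, ?_⟩
    rw [unary_odd hc] at h3 h4
    refine Total.seq_assign (Total.assign ⟨b' / 2, ?_, ?_, h3, ?_⟩)
    · simp [h1, hx.symm, natCast_half_floor]
    · rw [pow_succ] at h2
      omega
    · rw [h4]
      simp only [Expr.eval_add, Expr.eval_reg, Memory.setReg_reg, hx, if_true, if_false,
        he M' (hfr hf)]
      push_cast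
      ring
  · rintro j M' hf ⟨b', h1, h2, h3, h4⟩ hc
    rw [hcond h1] at hc
    rw [unary_even hc] at h3 h4
    exact ⟨b', h1, h3.symm, by simpa using h4.symm⟩
  · rintro M' hf ⟨b', h1, h2, h3⟩
    refine Total.assign ⟨?_, ?_⟩
    · simp [h1, natCast_half_floor, h2]
    · simp [hx, h3]

theorem distProg_total {M : Memory} {a a' d i i' : ℕ} {e e' : Expr} (hd : M.reg 2 = d)
    (he : ∀ M', Frame (distProg a a' e e') M M' → e.eval M' = i)
    (he' : ∀ M', Frame (distProg a a' e e') M M' → e'.eval M' = i') :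
    Total (distProg a a' e e') M (4 * d + 5) fun M' =>
      M'.reg 23 = sqDist d (M.arr a) (M.arr a') i i' := by
  refine Total.seq_assign (Total.forLoop (τ := 1) d
    (fun j M' => M'.reg 23 = ∑ t ∈ Finset.range j, (M.arr a (i + t) - M.arr a' (i' + t)) ^ 2)
    rfl ?_ ?_ ?_ ?_ |>.mono (T' := 4 * d + 3) (by omega) fun _ _ h => h)
  · intro M' hf
    exact (hf.reg 2 rfl).trans hd
  · simp
  · intro j hj M' hf hj' hI
    have hf' := Frame.seq_assign (e := 0) hf
    refine Total.assign fun _ => ?_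
    have h1 : M'.arr a = M.arr a := hf'.arr a rfl
    have h2 : M'.arr a' = M.arr a' := hf'.arr a' rfl
    simp [hI, Finset.sum_range_succ, he M' hf', he' M' hf', hj', h1, h2, Nat.floor_add_natCast, sq]
  · intro M' _ _ hI
    exact hI

theorem vertexPos_eval {M : Memory} {e : Expr} {m d i v : ℕ} (hm : M.reg 1 = m) (hd : M.reg 2 = d)
    (hi : M.reg 13 = i) (he : e.eval M = v) :
    (vertexPos e).eval M = ((i * (m * d) + v * d : ℕ) : ℝ) := by
  simp [vertexPos, hm, hd, hi, he]

/-- The coordinate array of the current input curve. -/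
def inputCurve (A : ℕ → ℝ) (m d i : ℕ) (t : ℕ) : ℝ := A (i * (m * d) + t)

theorem sqDist_inputCurve (A B : ℕ → ℝ) (m d i j v : ℕ) :
    sqDist d B A j (i * (m * d) + v * d) = sqDist d B (inputCurve A m d i) j (v * d) :=
  sqDist_congr (fun _ _ => rfl) fun t _ => by rw [inputCurve, add_assoc]

theorem greedyProg_total {M : Memory} {m d i : ℕ} {r : ℝ} (hm : M.reg 1 = m) (hd : M.reg 2 = d)
    (hr : M.reg 5 = r) (hi : M.reg 13 = i)
    (hrep : ∃ rep : ℕ → ℕ, ∀ l, M.arr 4 l = rep l) :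
    Total greedyProg M (m * (4 * d + 13) + 7) fun M' => ∃ rep : ℕ → ℕ, (∀ l, M'.arr 4 l = rep l) ∧
      ∀ v < m, rep (greedy d (inputCurve (M.arr 0) m d i) (3 * r) v).1 =
        (greedy d (inputCurve (M.arr 0) m d i) (3 * r) v).2 := by
  set A := inputCurve (M.arr 0) m d i with hA
  set y := 3 * r with hy
  refine Total.seq_assign (Total.seq_write (T := m * (4 * d + 13) + 3) ?_)
  -- With truncated subtraction the invariants for 0 and 1 processed vertices coincide: the first
  -- round compares vertex 0 with itself and opens no piece.
  refine (Total.forLoop (τ := 4 * d + 10) m (fun j M' => ∃ rep : ℕ → ℕ, (∀ l, M'.arr 4 l = rep l) ∧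
    M'.reg 22 = (greedy d A y (j - 1)).1 ∧ ∀ v ≤ j - 1, rep (greedy d A y v).1 = (greedy d A y v).2)
    rfl ?_ ?_ ?_ ?_).mono (by linarith) fun _ _ h => h
  · intro M' hf
    exact (hf.reg 1 rfl).trans hm
  · obtain ⟨rep, hrep⟩ := hrep
    refine ⟨Function.update rep 0 0, fun l => ?_, by simp [greedy], fun v hv => ?_⟩
    · by_cases hl : l = 0 <;> simp [hl, hrep]
    · obtain rfl : v = 0 := by omega
      simp [greedy]
  · rintro j hj M' hf hj' ⟨rep, h1, h2, h3⟩
    have hf' : Frame greedyProg M M' := Frame.seq_assign (Frame.seq_write hf)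
    have hlast : rep (greedy d A y (j - 1)).1 = (greedy d A y (j - 1)).2 := h3 _ le_rfl
    refine (Total.seq (T' := 4) (distProg_total (d := d) (i := i * (m * d) + j * d)
      (i' := i * (m * d) + (greedy d A y (j - 1)).2 * d) ((hf'.reg 2 rfl).trans hd) ?_ ?_ |>.mono
        le_rfl fun M'' hf'' hI hf''' => ?_)).mono (by omega) fun _ _ h => h
    · intro M'' hf''
      exact vertexPos_eval ((hf''.reg 1 rfl).trans ((hf'.reg 1 rfl).trans hm))
        ((hf''.reg 2 rfl).trans ((hf'.reg 2 rfl).trans hd))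
        ((hf''.reg 13 rfl).trans ((hf'.reg 13 rfl).trans hi)) ((hf''.reg 21 rfl).trans hj')
    · intro M'' hf''
      refine vertexPos_eval ((hf''.reg 1 rfl).trans ((hf'.reg 1 rfl).trans hm))
        ((hf''.reg 2 rfl).trans ((hf'.reg 2 rfl).trans hd))
        ((hf''.reg 13 rfl).trans ((hf'.reg 13 rfl).trans hi)) ?_
      rw [Expr.eval_read, Expr.eval_reg, hf''.reg 22 rfl, h2, Nat.floor_natCast, hf''.arr 4 rfl, h1,
        hlast]
    · rw [sqDist_inputCurve] at hI
      have hI' : M''.reg 23 = sqDist d A A (j * d) ((greedy d A y (j - 1)).2 * d) := by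
        rw [hI, hf'.arr 0 rfl]
        exact sqDist_congr (fun t _ => by rw [hA, inputCurve, add_assoc]) fun _ _ => rfl
      have h22 : M''.reg 22 = (greedy d A y (j - 1)).1 := (hf''.reg 22 rfl).trans h2
      have h21 : M''.reg 21 = j := (hf''.reg 21 rfl).trans hj'
      have h4 : ∀ l, M''.arr 4 l = rep l := fun l => by rw [hf''.arr 4 rfl, h1]
      have hcond : (Cond.le (reg 23) (9 * (reg 5 * reg 5))).Holds M'' ↔
          NearRows d A A y j (greedy d A y (j - 1)).2 := by
        have h5 : M''.reg 5 = r := (hf''.reg 5 rfl).trans ((hf'.reg 5 rfl).trans hr)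
        rw [Cond.holds_le]
        simp only [Expr.eval_reg, Expr.eval_mul, Expr.eval_ofNat, hI', h5, NearRows, hy]
        rw [show 9 * (r * r) = (3 * r) ^ 2 by ring]
      refine Total.ite (T := 3) (fun hc => ?_) fun hc => ?_
      · rw [hcond] at hc
        refine (Total.skip fun _ => ⟨rep, by simpa using h4, ?_, fun v hv => ?_⟩).mono (by omega)
          fun _ _ h => h
        · cases j with
          | zero => simpa using h22
          | succ j => simpa [greedy, Nat.add_sub_cancel] using
              (by rw [if_pos (by simpa using hc)]; simpa using h22)
        · rcases Nat.lt_or_ge (j - 1) v with h | h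
          · obtain rfl : v = j := by omega
            obtain ⟨j, rfl⟩ : ∃ i, v = i + 1 := ⟨v - 1, by omega⟩
            rw [greedy, if_pos (by simpa using hc)]
            exact hlast
          · exact h3 v h
      · rw [hcond] at hc
        have hj0 : j ≠ 0 := by
          rintro rfl
          exact hc (nearRows_self _)
        obtain ⟨j, rfl⟩ : ∃ i, j = i + 1 := ⟨j - 1, by omega⟩
        rw [Nat.add_sub_cancel] at hc h22 h3
        have hg : greedy d A y (j + 1) = ((greedy d A y j).1 + 1, j + 1) := by
          rw [greedy, if_neg hc]
        refine Total.seq_assign (Total.write fun _ =>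
          ⟨Function.update rep ((greedy d A y j).1 + 1) (j + 1), fun l => ?_, ?_, fun v hv => ?_⟩)
        · have : ⌊((greedy d A y j).1 : ℝ) + 1⌋₊ = (greedy d A y j).1 + 1 :=
            floor_eq_of_eq (by push_cast; rfl)
          by_cases hl : l = (greedy d A y j).1 + 1 <;> simp [hl, h22, this, h21, h4]
        · simp [hg, h22]
        · rw [Nat.add_sub_cancel] at hv
          rcases Nat.lt_or_ge j v with h | h
          · obtain rfl : v = j + 1 := by omega
            rw [hg]
            simp
          · have := greedy_fst_mono (d := d) (A := A) (y := y) h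
            dsimp only at this
            rw [Function.update_of_ne (by omega)]
            exact h3 v h
  · rintro M' _ _ ⟨rep, h1, h2, h3⟩
    exact ⟨rep, h1, fun v hv => h3 v (by omega)⟩

/-- The key of an integer vector, without the final increment: its Horner evaluation. -/
def horner (W : ℕ) (z : ℕ → ℤ) : ℕ → ℤ
  | 0 => 0
  | t + 1 => horner W z t * (2 * W + 1) + (z t + W)

/-- The integer vector decoded from a pair of numbers. -/
noncomputable def decodeVec (A : ℕ → ℝ) (rep : ℕ → ℕ) (d R : ℕ) (δ : ℝ) (σ : ℕ × ℕ) (t : ℕ) : ℤ :=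
  ⌊A (rep (∑ s ∈ Finset.range (t + 1), decInc ((decStep R)^[s] σ)) * d + t % d) / δ⌋ +
    decDiff R ((decStep R)^[t] σ)

/-- Nothing is assumed about the code beyond its size. A senseless code may refer to a piece that
does not exist, but array `4` holds natural numbers everywhere, so some integer vector results; the
later distance test decides about it. -/
theorem decodeProg_total {M : Memory} {m d i K R W b g β : ℕ} {δ : ℝ} {rep : ℕ → ℕ}
    (hm : M.reg 1 = m) (hd : M.reg 2 = d) (hK : M.reg 6 = K) (hδ : M.reg 7 = δ) (hR : M.reg 8 = R)
    (hW : M.reg 11 = W) (hi : M.reg 13 = i) (hb : M.reg 15 = b) (hg : M.reg 16 = g)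
    (h29 : M.reg 29 = 2 * W + 1) (hrep : ∀ l, M.arr 4 l = rep l) (hβ : b < 2 ^ β) :
    Total decodeProg M (K * (12 * β + 30) + 10) fun M' =>
      (∀ t < K, M'.arr 2 t = δ * decodeVec (inputCurve (M.arr 0) m d i) rep d R δ (b, g) t) ∧
      M'.reg 20 = horner W (decodeVec (inputCurve (M.arr 0) m d i) rep d R δ (b, g)) K + 1 := by
  set A := inputCurve (M.arr 0) m d i with hA
  set z := decodeVec A rep d R δ (b, g) with hz
  set st : ℕ → ℕ × ℕ := fun t => (decStep R)^[t] (b, g) with hst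
  have hsucc : ∀ t, st (t + 1) = decStep R (st t) := fun t => Function.iterate_succ_apply' _ _ _
  refine Total.seq_assign (Total.seq_assign (T := K * (12 * β + 30) + 6) ?_)
  refine (Total.seq' (T' := 1) (Total.forLoop (τ := 12 * β + 27) K
    (fun j M' => M'.reg 15 = (st j).1 ∧ M'.reg 16 = (st j).2 ∧
      M'.reg 18 = ((∑ s ∈ Finset.range j, decInc (st s) : ℕ) : ℝ) ∧
      (∀ t < j, M'.arr 2 t = δ * z t) ∧ M'.reg 20 = horner W z j)
    rfl ?_ ?_ ?_ ?_ (Q := fun M' => (∀ t < K, M'.arr 2 t = δ * z t) ∧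
      M'.reg 20 = horner W z K)) ?_).mono (by linarith) fun _ _ h => h
  · intro M' hf
    exact (hf.reg 6 rfl).trans (by simpa using hK)
  · simp [hst, hb, hg, horner]
  · rintro j hj M' hf hj' ⟨h15, h16, h18, h2, h20⟩
    have hreg : ∀ x, Program.writesReg x (18 ::= 0 ;; 20 ::= 0 ;; forLoop 17 (reg 6) decodeStepProg)
        = false → M'.reg x = M.reg x :=
      (Frame.seq_assign (e := 0) (Frame.seq_assign (e := 0) hf)).reg
    have harr : ∀ x, Program.writesArr x (forLoop 17 (reg 6) decodeStepProg)
        = false → M'.arr x = M.arr x := hf.arr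
    have hβj : (st j).1 < 2 ^ β := (decStep_iterate_fst_le R (b, g) j).trans_lt hβ
    have hβ1 : (unary (st j).1).2 < 2 ^ β := (unary_snd_le _).trans_lt hβj
    have hβ2 : (unary (unary (st j).1).2).2 < 2 ^ β := (unary_snd_le _).trans_lt hβ1
    refine Total.mono (T := (4 * β + 3) + ((4 * β + 3) + ((4 * β + 3) + 7 + 1) + 1 + 2) + 1)
      ?_ (by omega) fun _ _ h => h
    refine Total.seq ((unaryProg_total (by norm_num) h15 hβj (E := 1) fun _ _ => by simp).mono
      le_rfl fun M₁ hf₁ h₁ _ => ?_)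
    refine Total.seq_assign ?_
    refine Total.seq ((unaryProg_total (b := (unary (st j).1).2) (by norm_num) (by simpa using h₁.1)
      hβ1 (E := -R) fun M' hM' => ?_).mono le_rfl fun M₂ hf₂ h₂ _ => ?_)
    · have := (hM'.reg 8 rfl).trans (hf₁.reg 8 rfl |>.trans ((hreg 8 rfl).trans hR))
      simp [this]
    refine Total.seq (T := 4 * β + 3) (T' := 7)
      ((unaryProg_total (b := (unary (unary (st j).1).2).2) (by norm_num) h₂.1
      hβ2 (E := R) fun M' hM' => ?_).mono le_rfl fun M₃ hf₃ h₃ _ => ?_)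
    · exact (hM'.reg 8 rfl).trans ((hf₂.reg 8 rfl).trans
        (hf₁.reg 8 rfl |>.trans ((hreg 8 rfl).trans hR)))
    have hr₃ : ∀ x, x ≠ 15 → x ≠ 18 → x ≠ 19 → M₃.reg x = M'.reg x := by
      intro x hx15 hx18 hx19
      rw [hf₃.reg x (by simp [unaryProg, Program.writesReg, *]),
        hf₂.reg x (by simp [unaryProg, Program.writesReg, *]), Memory.setReg_reg, if_neg hx19,
        hf₁.reg x (by simp [unaryProg, Program.writesReg, *])]
    have ha₃ : ∀ x, M₃.arr x = M'.arr x := fun x =>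
      (hf₃.arr x rfl).trans ((hf₂.arr x rfl).trans (hf₁.arr x rfl))
    have h18' : M₁.reg 18 = ((∑ s ∈ Finset.range (j + 1), decInc (st s) : ℕ) : ℝ) := by
      rw [h₁.2, h18, Finset.sum_range_succ, decInc]
      push_cast
      ring
    have hbase : Expr.eval M₁ (Expr.floor (read 0 (vertexPos (read 4 (reg 18)) +
        (reg 17 - reg 2 * Expr.floor (reg 17 / reg 2))) / reg 7)) =
        ((⌊A (rep (∑ s ∈ Finset.range (j + 1), decInc (st s)) * d + j % d) / δ⌋ : ℤ) : ℝ) := by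
      have hpos := vertexPos_eval (M := M₁) (e := read 4 (reg 18))
        (v := rep (∑ s ∈ Finset.range (j + 1), decInc (st s)))
        (hf₁.reg 1 rfl |>.trans ((hreg 1 rfl).trans hm))
        (hf₁.reg 2 rfl |>.trans ((hreg 2 rfl).trans hd))
        (hf₁.reg 13 rfl |>.trans ((hreg 13 rfl).trans hi)) (by
          rw [Expr.eval_read, Expr.eval_reg, h18', Nat.floor_natCast, hf₁.arr 4 rfl, harr 4 rfl]
          exact hrep _)
      have hmod : Expr.eval M₁ (reg 17 - reg 2 * Expr.floor (reg 17 / reg 2)) = (j % d : ℕ) := by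
        simp only [Expr.eval_sub, Expr.eval_mul, Expr.eval_floor, Expr.eval_div, Expr.eval_reg]
        rw [hf₁.reg 17 rfl, hj', hf₁.reg 2 rfl, hreg 2 rfl, hd, natCast_mod_eq]
      rw [Expr.eval_floor, Expr.eval_div, Expr.eval_read, Expr.eval_add, hpos, hmod, ← Nat.cast_add,
        Nat.floor_natCast, Expr.eval_reg, hf₁.reg 7 rfl, hreg 7 rfl, hδ, hf₁.arr 0 rfl, harr 0 rfl,
        hA, inputCurve, add_assoc]
    have h19 : M₃.reg 19 + ((st j).2 % R : ℕ) = z j := by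
      rw [h₃.2, h₂.2, Memory.setReg_reg, if_pos rfl, hbase, hz]
      simp only [decodeVec, decDiff, hst, Int.cast_add, Int.cast_neg, Int.cast_natCast, Nat.cast_mul,
        Int.cast_mul]
      ring
    have h16' : M₃.reg 16 - M₃.reg 8 * ((⌊M₃.reg 16 / M₃.reg 8⌋ : ℤ) : ℝ) = ((st j).2 % R : ℕ) := by
      rw [hr₃ 16 (by norm_num) (by norm_num) (by norm_num), h16,
        hr₃ 8 (by norm_num) (by norm_num) (by norm_num), hreg 8 rfl, hR, natCast_mod_eq]
    have h16'' : ((⌊M₃.reg 16 / M₃.reg 8⌋ : ℤ) : ℝ) = ((st j).2 / R : ℕ) := by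
      rw [hr₃ 16 (by norm_num) (by norm_num) (by norm_num), h16,
        hr₃ 8 (by norm_num) (by norm_num) (by norm_num), hreg 8 rfl, hR, natCast_div_floor]
    refine Total.seq_assign (Total.seq_assign (Total.seq_write (Total.assign fun _ => ?_)))
    have e15 : M₃.reg 15 = (st (j + 1)).1 := by rw [h₃.1, hsucc, decStep]
    have e18 : M₃.reg 18 = M₁.reg 18 := by
      rw [hf₃.reg 18 rfl, hf₂.reg 18 rfl, Memory.setReg_reg, if_neg (by norm_num)]
    have e7 : M₃.reg 7 = δ := by
      rw [hr₃ 7 (by norm_num) (by norm_num) (by norm_num), hreg 7 rfl, hδ]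
    have e29 : M₃.reg 29 = 2 * W + 1 := by
      rw [hr₃ 29 (by norm_num) (by norm_num) (by norm_num), hreg 29 rfl]; simpa using h29
    have e11 : M₃.reg 11 = W := by
      rw [hr₃ 11 (by norm_num) (by norm_num) (by norm_num), hreg 11 rfl]; simpa using hW
    have e20 : M₃.reg 20 = horner W z j := by
      rw [hr₃ 20 (by norm_num) (by norm_num) (by norm_num), h20]
    have e17 : M₃.reg 17 = j := by
      rw [hr₃ 17 (by norm_num) (by norm_num) (by norm_num), hj']
    refine ⟨by simpa using e15, ?_, by simpa [e18] using h18', fun t ht => ?_, ?_⟩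
    · simp [hsucc, decStep, h16'']
    · by_cases htj : t = j
      · simp [htj, e17, e7, h16', h19]
      · simp [htj, e17, ha₃, h2 t (by omega)]
    · simp [horner, e20, e29, h16', h19, e11]
  · rintro M' _ _ ⟨-, -, -, h2, h20⟩
    exact ⟨h2, h20⟩
  · rintro M' _ ⟨h2, h20⟩
    exact Total.assign ⟨by simpa using h2, by simp [h20]⟩

/-! ### The reachability table -/

/-- The entries `(j', v')` of the table with `j' < j`, or `j' = j` and `v' < v`, are correct, and so
is the border of the table. -/
structure TableInv (G : ℕ → ℕ → Prop) (m : ℕ) (T : ℕ → ℝ) (j v : ℕ) : Prop where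
  corner : T 0 = 1
  border : ∀ b < m, T (b + 1) = 0
  border' : ∀ a, T ((a + 1) * (m + 1)) = 0
  nonneg : ∀ x, 0 ≤ T x
  entry : ∀ a b, b < m → (a < j ∨ a = j ∧ b < v) →
    (0 < T ((a + 1) * (m + 1) + (b + 1)) ↔ Reach G a b)

/-- Entry (j + 1, v + 1) of the table stands for the pair (j, v). The shift adds a border, so that
boundary pairs need no case distinction in the program; the 1 in the corner acts as the predecessor
of the start. As no entry is negative, positivity of the sum is a disjunction. -/
theorem TableInv.predecessor {G : ℕ → ℕ → Prop} {m j v : ℕ} {T : ℕ → ℝ} (h : TableInv G m T j v)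
    (hv : v < m) (hG : G j v) :
    0 < T (j * (m + 1) + v) + T (j * (m + 1) + (v + 1)) + T ((j + 1) * (m + 1) + v) ↔
      Reach G j v := by
  have h1 : 0 < T (j * (m + 1) + v) ↔ (j = 0 ∧ v = 0) ∨
      ∃ i' j', j = i' + 1 ∧ v = j' + 1 ∧ Reach G i' j' := by
    rcases j with _ | j <;> rcases v with _ | v
    · simp [h.corner]
    · simp [h.border v (by omega)]
    · simp [h.border' j]
    · rw [h.entry j v (by omega) (.inl (by omega))]
      simp
  have h2 : 0 < T (j * (m + 1) + (v + 1)) ↔ ∃ i', j = i' + 1 ∧ Reach G i' v := by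
    rcases j with _ | j
    · simp [h.border v hv]
    · rw [h.entry j v (by omega) (.inl (by omega))]
      simp
  have h3 : 0 < T ((j + 1) * (m + 1) + v) ↔ ∃ j', v = j' + 1 ∧ Reach G j j' := by
    rcases v with _ | v
    · simp [h.border' j]
    · rw [h.entry j v (by omega) (.inr ⟨rfl, by omega⟩)]
      simp
  have h4 : ∀ x y z : ℝ, 0 ≤ x → 0 ≤ y → 0 ≤ z → (0 < x + y + z ↔ 0 < x ∨ 0 < y ∨ 0 < z) := by
    intro x y z hx hy hz
    constructor
    · intro h
      by_contra! hc
      linarith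
    · rintro (h | h | h) <;> linarith
  rw [h4 _ _ _ (h.nonneg _) (h.nonneg _) (h.nonneg _), h1, h2, h3, Reach.iff_step (i := j)]
  constructor
  · rintro ((h | h) | h | h)
    · exact ⟨hG, .inl h⟩
    · exact ⟨hG, .inr (.inr (.inr h))⟩
    · exact ⟨hG, .inr (.inl h)⟩
    · exact ⟨hG, .inr (.inr (.inl h))⟩
  · rintro ⟨-, h | h | h | h⟩
    · exact .inl (.inl h)
    · exact .inr (.inl h)
    · exact .inr (.inr h)
    · exact .inl (.inr h)

theorem TableInv.update {G : ℕ → ℕ → Prop} {m j v : ℕ} {T : ℕ → ℝ} (h : TableInv G m T j v)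
    (hv : v < m) {x : ℝ} (hx0 : 0 ≤ x) (hx : 0 < x ↔ Reach G j v) :
    TableInv G m (Function.update T ((j + 1) * (m + 1) + (v + 1)) x) j (v + 1) := by
  have hdm : ∀ a b, b ≤ m → (a * (m + 1) + b) / (m + 1) = a ∧ (a * (m + 1) + b) % (m + 1) = b := by
    intro a b hb
    rw [mul_comm a, Nat.mul_add_div (by omega), Nat.mul_add_mod, Nat.div_eq_of_lt (by omega),
      Nat.mod_eq_of_lt (by omega)]
    simp
  have hne : ∀ a b, b ≤ m → (a ≠ j + 1 ∨ b ≠ v + 1) →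
      a * (m + 1) + b ≠ (j + 1) * (m + 1) + (v + 1) := by
    intro a b hb hab heq
    have h1 := hdm a b hb
    rw [heq] at h1
    have h2 := hdm (j + 1) (v + 1) (by omega)
    omega
  refine ⟨?_, fun b hb => ?_, fun a => ?_, fun y => ?_, fun a b hb hab => ?_⟩
  · rw [Function.update_of_ne (by simp), h.corner]
  · rw [Function.update_of_ne (by simpa using hne 0 (b + 1) (by omega) (by omega)), h.border b hb]
  · rw [Function.update_of_ne (by simpa using hne (a + 1) 0 (by omega) (by omega)), h.border' a]
  · rw [Function.update_apply]
    split_ifs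
    · exact hx0
    · exact h.nonneg y
  · by_cases hab' : a = j ∧ b = v
    · obtain ⟨rfl, rfl⟩ := hab'
      rw [Function.update_self, hx]
    · rw [Function.update_of_ne (hne (a + 1) (b + 1) (by omega) (by omega)),
        h.entry a b hb (by omega)]

theorem TableInv.next_row {G : ℕ → ℕ → Prop} {m j : ℕ} {T : ℕ → ℝ} (h : TableInv G m T j m) :
    TableInv G m T (j + 1) 0 :=
  ⟨h.corner, h.border, h.border', h.nonneg, fun a b hb hab => h.entry a b hb (by omega)⟩

/-- The border of the reachability table, except for its corner, contains zeros, and there are no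
negative entries. -/
structure TableBorder (m : ℕ) (T : ℕ → ℝ) : Prop where
  border : ∀ b < m, T (b + 1) = 0
  border' : ∀ a, T ((a + 1) * (m + 1)) = 0
  nonneg : ∀ x, 0 ≤ T x

theorem tablePos_eval {M : Memory} {e e' : Expr} {m j v : ℕ} (hm : M.reg 1 = m)
    (he : e.eval M = j) (he' : e'.eval M = v) :
    ⌊(tablePos e e').eval M⌋₊ = j * (m + 1) + v :=
  floor_eq_of_eq (by simp [tablePos, hm, he, he'])

/-- The border is never changed except for the corner, which is set afresh. So the table can be
reused for the next candidate without clearing: stale inner entries are overwritten before they are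
read. -/
theorem checkProg_total {M : Memory} {m d k i : ℕ} {ρ : ℝ} (hm : M.reg 1 = m) (hd : M.reg 2 = d)
    (hk : M.reg 3 = k) (hi : M.reg 13 = i) (hρ : M.reg 30 = ρ ^ 2)
    (hborder : TableBorder m (M.arr 3)) :
    Total checkProg M (k * (m * (4 * d + 11) + 6) + 5) fun M' => TableBorder m (M'.arr 3) ∧
      ∀ a < k, ∀ b < m, (0 < M'.arr 3 ((a + 1) * (m + 1) + (b + 1)) ↔
        Reach (NearRows d (M.arr 2) (inputCurve (M.arr 0) m d i) ρ) a b) := by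
  set A := inputCurve (M.arr 0) m d i with hA
  set G := NearRows d (M.arr 2) A ρ with hG
  refine Total.seq_write (T := k * (m * (4 * d + 11) + 6) + 3) ?_
  refine (Total.forLoop (τ := m * (4 * d + 11) + 3) k (fun j M' => TableInv G m (M'.arr 3) j 0)
    rfl ?_ ?_ ?_ ?_).mono le_rfl fun _ _ h => h
  · intro M' hf
    exact (hf.reg 3 rfl).trans hk
  · refine ⟨?_, fun b hb => ?_, fun a => ?_, fun x => ?_, fun a b _ hab => by omega⟩
    · simp
    · simpa using hborder.border b hb
    · simpa using hborder.border' a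
    · have := hborder.nonneg x
      by_cases hx : x = 0 <;> simp [hx, this]
  · intro j hj M' hf hj' hI
    have hf' : Frame checkProg M M' := Frame.seq_write hf
    refine (Total.forLoop (τ := 4 * d + 8) m (fun v M' => TableInv G m (M'.arr 3) j v)
      rfl ?_ ?_ ?_ ?_).mono (by linarith) fun _ _ h => h
    · intro M'' hf''
      exact (hf''.reg 1 rfl).trans ((hf'.reg 1 rfl).trans hm)
    · simpa using hI
    · intro v hv M₁ hf₁ hv' hI₁
      have h1 : M₁.reg 1 = m := (hf₁.reg 1 rfl).trans ((hf'.reg 1 rfl).trans hm)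
      have h2 : M₁.reg 2 = d := (hf₁.reg 2 rfl).trans ((hf'.reg 2 rfl).trans hd)
      have h13 : M₁.reg 13 = i := (hf₁.reg 13 rfl).trans ((hf'.reg 13 rfl).trans hi)
      have h27 : M₁.reg 27 = j := (hf₁.reg 27 rfl).trans hj'
      refine (Total.seq' (T' := 2) (distProg_total (d := d) (i := j * d)
        (i' := i * (m * d) + v * d) h2 ?_ ?_) ?_).mono (by omega) fun _ _ h => h
      · intro M₂ hf₂
        simp [hf₂.reg 27 rfl, hf₂.reg 2 rfl, h27, h2]
      · intro M₂ hf₂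
        exact vertexPos_eval ((hf₂.reg 1 rfl).trans h1) ((hf₂.reg 2 rfl).trans h2)
          ((hf₂.reg 13 rfl).trans h13) ((hf₂.reg 28 rfl).trans hv')
      intro M₂ hf₂ h23
      rw [sqDist_inputCurve, hf₁.arr 0 rfl, hf'.arr 0 rfl, hf₁.arr 2 rfl, hf'.arr 2 rfl, ← hA] at h23
      have k1 : M₂.reg 1 = m := (hf₂.reg 1 rfl).trans h1
      have k27 : M₂.reg 27 = j := (hf₂.reg 27 rfl).trans h27
      have k28 : M₂.reg 28 = v := (hf₂.reg 28 rfl).trans hv'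
      have k30 : M₂.reg 30 = ρ ^ 2 :=
        (hf₂.reg 30 rfl).trans ((hf₁.reg 30 rfl).trans ((hf'.reg 30 rfl).trans hρ))
      have k3 : M₂.arr 3 = M₁.arr 3 := hf₂.arr 3 rfl
      have e1 : (reg 27).eval M₂ = j := k27
      have e2 : (reg 28).eval M₂ = v := k28
      have e3 : (reg 27 + 1).eval M₂ = (j + 1 : ℕ) := by simp [k27]
      have e4 : (reg 28 + 1).eval M₂ = (v + 1 : ℕ) := by simp [k28]
      have hcond : (Cond.and (.le (reg 23) (reg 30))
          (.lt 0 (read 3 (tablePos (reg 27) (reg 28)) + read 3 (tablePos (reg 27) (reg 28 + 1)) +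
            read 3 (tablePos (reg 27 + 1) (reg 28))))).Holds M₂ ↔ Reach G j v := by
        rw [Cond.holds_and, Cond.holds_le, Cond.holds_lt]
        simp only [Expr.eval_add, Expr.eval_read, Expr.eval_zero, tablePos_eval k1 e1 e2,
          tablePos_eval k1 e1 e4, tablePos_eval k1 e3 e2, k3]
        rw [Expr.eval_reg, Expr.eval_reg, h23, k30]
        constructor
        · rintro ⟨hg, hp⟩
          exact (hI₁.predecessor hv hg).1 hp
        · intro h
          exact ⟨h.holds, (hI₁.predecessor hv h.holds).2 h⟩
      refine Total.ite (fun hc => Total.write fun _ => ?_) fun hc => Total.write fun _ => ?_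
      · rw [hcond] at hc
        rw [tablePos_eval k1 e3 e4, Memory.setReg_arr, Memory.setArr_arr, if_pos rfl, k3]
        exact hI₁.update hv (by simp) (by simpa using hc)
      · rw [hcond] at hc
        rw [tablePos_eval k1 e3 e4, Memory.setReg_arr, Memory.setArr_arr, if_pos rfl, k3]
        exact hI₁.update hv (by simp) (by simpa using hc)
    · intro M'' _ _ hI''
      exact fun _ => by simpa using hI''.next_row
  · intro M' _ _ hI
    exact ⟨⟨hI.border, hI.border', hI.nonneg⟩, fun a ha b hb => hI.entry a b hb (.inl ha)⟩

/-! ### Keys -/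

/-- The vector is bounded by `W` on its first `K` entries. -/
def Bounded (W K : ℕ) (z : ℕ → ℤ) : Prop := ∀ t < K, |z t| ≤ W

theorem horner_bounds {W K : ℕ} {z : ℕ → ℤ} (h : Bounded W K z) :
    0 ≤ horner W z K ∧ horner W z K + 1 ≤ (2 * W + 1) ^ K := by
  induction K with
  | zero => simp [horner]
  | succ K ih =>
    have ih := ih fun t ht => h t (by omega)
    have := abs_le.1 (h K (by omega))
    rw [horner, pow_succ]
    constructor
    · have : 0 ≤ horner W z K * (2 * W + 1) := mul_nonneg ih.1 (by positivity)
      linarith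
    · have : (horner W z K + 1) * (2 * W + 1) ≤ (2 * W + 1) ^ K * (2 * W + 1) :=
        mul_le_mul_of_nonneg_right ih.2 (by positivity)
      linarith

/-- The shifted coordinates lie in {0, …, 2W}, so they are the digits of the Horner value in base 2W
+ 1. -/
theorem horner_inj {W K : ℕ} {z z' : ℕ → ℤ} (h : Bounded W K z) (h' : Bounded W K z')
    (heq : horner W z K = horner W z' K) : ∀ t < K, z t = z' t := by
  induction K with
  | zero => intro t ht; omega
  | succ K ih =>
    have b := abs_le.1 (h K (by omega))
    have b' := abs_le.1 (h' K (by omega))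
    rw [horner, horner] at heq
    have e1 : horner W z K = horner W z' K := by
      have a1 : (2 * (W : ℤ) + 1) * horner W z K ≤ (2 * W + 1) * horner W z' K + 2 * W := by linarith
      have a2 : (2 * (W : ℤ) + 1) * horner W z' K ≤ (2 * W + 1) * horner W z K + 2 * W := by linarith
      have hW : (0 : ℤ) ≤ W := by positivity
      apply le_antisymm
      · by_contra! hc
        nlinarith
      · by_contra! hc
        nlinarith
    intro t ht
    rcases Nat.lt_or_ge t K with htK | htK
    · exact ih (fun t ht => h t (by omega)) (fun t ht => h' t (by omega)) e1 t htK
    · obtain rfl : t = K := by omega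
      rw [e1] at heq
      linarith

theorem horner_congr {W K : ℕ} {z z' : ℕ → ℤ} (h : ∀ t < K, z t = z' t) :
    horner W z K = horner W z' K := by
  induction K with
  | zero => rfl
  | succ K ih => rw [horner, horner, ih fun t ht => h t (by omega), h K (by omega)]

/-- The key of a bounded integer vector. -/
def keyOf (W K : ℕ) (z : ℕ → ℤ) : ℕ := (horner W z K + 1).toNat

theorem keyOf_cast {W K : ℕ} {z : ℕ → ℤ} (h : Bounded W K z) :
    ((keyOf W K z : ℕ) : ℝ) = horner W z K + 1 := by
  have h1 := (horner_bounds h).1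
  have h2 : ((keyOf W K z : ℕ) : ℤ) = horner W z K + 1 := by rw [keyOf]; omega
  exact_mod_cast congrArg (Int.cast : ℤ → ℝ) h2

theorem keyOf_pos {W K : ℕ} {z : ℕ → ℤ} (h : Bounded W K z) : 0 < keyOf W K z := by
  have h1 := (horner_bounds h).1
  rw [keyOf]; omega

theorem keyOf_le {W K : ℕ} {z : ℕ → ℤ} (h : Bounded W K z) : keyOf W K z ≤ (2 * W + 1) ^ K := by
  have h1 := (horner_bounds h).2
  rw [keyOf, Int.toNat_le]
  exact_mod_cast h1

theorem keyOf_inj {W K : ℕ} {z z' : ℕ → ℤ} (h : Bounded W K z) (h' : Bounded W K z')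
    (heq : keyOf W K z = keyOf W K z') : ∀ t < K, z t = z' t := by
  have h1 := (horner_bounds h).1
  have h2 := (horner_bounds h').1
  refine horner_inj h h' ?_
  rw [keyOf, keyOf] at heq
  omega

/-! ### The parameters of an instance and the bound on grid coordinates -/

/-- The parameters of an instance: its sizes, `ε` and `r`, the input array, and a bound `W` on the
coordinates, in units of the grid. -/
structure Params : Type where
  (n m d k W : ℕ)
  (ε r : ℝ)
  A : ℕ → ℝ
  hm : 1 ≤ m
  hd : 1 ≤ d
  hk : 1 ≤ k
  hε : 0 < ε
  hε1 : ε ≤ 1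
  hr : 0 < r
  hW : ∀ a < n * (m * d), |A a| + 2 * r ≤ W * (ε * r / Real.sqrt d)

namespace Params

variable (P : Params)

/-- The number of coordinates of a query. -/
def K : ℕ := P.k * P.d
/-- The edge length of the grid. -/
noncomputable def δ : ℝ := P.ε * P.r / Real.sqrt P.d
/-- The distance up to which grid curves are stored. -/
noncomputable def ρ : ℝ := (1 + P.ε / 2) * P.r
/-- The base of coordinate digits. -/
noncomputable def R : ℕ := digitBase P.ε
/-- The number of candidates per input curve. -/
noncomputable def G : ℕ := (2048 * P.R) ^ P.K
/-- A strict upper bound on keys. -/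
def U : ℕ := (2 * P.W + 1) ^ P.K + 1

theorem δ_pos : 0 < P.δ :=
  div_pos (mul_pos P.hε P.hr) (Real.sqrt_pos.2 (by exact_mod_cast P.hd))
theorem ρ_nonneg : 0 ≤ P.ρ := by have := P.hε; have := P.hr; unfold ρ; positivity
theorem R_pos : 0 < P.R := Nat.succ_pos _

/-- The grid curve with coordinates `z` is near the input curve with index `i`. -/
def NearInput (i : ℕ) (z : ℕ → ℤ) : Prop :=
  Reach (NearRows P.d (fun t => P.δ * z t) (inputCurve P.A P.m P.d i) P.ρ) (P.k - 1) (P.m - 1)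

theorem reach_congr {B B' : ℕ → ℝ} (h : ∀ t < P.K, B t = B' t) (A : ℕ → ℝ) :
    Reach (NearRows P.d B A P.ρ) (P.k - 1) (P.m - 1) →
      Reach (NearRows P.d B' A P.ρ) (P.k - 1) (P.m - 1) := by
  refine fun hr => hr.imp fun j hj v _ hnear => ?_
  rw [NearRows, ← sqDist_congr (fun t ht => ?_) fun _ _ => rfl]
  · exact hnear
  · have := P.hk
    exact h _ (add_lt_mul_of_lt (by omega) ht)

theorem NearInput.congr {P : Params} {i : ℕ} {z z' : ℕ → ℤ} (h : P.NearInput i z)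
    (hz : ∀ t < P.K, z t = z' t) : P.NearInput i z' :=
  P.reach_congr (fun t ht => by rw [hz t ht]) _ h

/-- Every vertex is matched to an input vertex within ρ ≤ 2r, so each of its coordinates differs
from an input coordinate by at most 2r; `P.W` was chosen with this margin. -/
theorem NearInput.bounded {P : Params} {i : ℕ} {z : ℕ → ℤ} (h : P.NearInput i z) (hi : i < P.n) :
    Bounded P.W P.K z := by
  obtain ⟨v, -, hvm, hv⟩ := h.exists_monotone
  have hd := P.hd
  have hk := P.hk
  have hm := P.hm
  have hr := P.hr
  have hδ := P.δ_pos
  intro t ht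
  have hj : t / P.d < P.k := Nat.div_lt_of_lt_mul (by rwa [mul_comm])
  have h1 := hv (t / P.d) (by omega)
  have hvt := hvm (t / P.d)
  have h2 : (P.δ * z t - inputCurve P.A P.m P.d i (v (t / P.d) * P.d + t % P.d)) ^ 2 ≤ P.ρ ^ 2 := by
    refine le_trans ?_ h1
    have := Finset.single_le_sum (f := fun s => (P.δ * z (t / P.d * P.d + s) -
      inputCurve P.A P.m P.d i (v (t / P.d) * P.d + s)) ^ 2) (fun s _ => sq_nonneg _)
      (Finset.mem_range.2 (Nat.mod_lt t hd))
    rw [mul_comm (t / P.d)] at this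
    simp only [Nat.div_add_mod] at this
    rw [sqDist, mul_comm (t / P.d)]
    exact this
  have h3 := abs_le_of_sq_le_sq' h2 P.ρ_nonneg
  have hpos : i * (P.m * P.d) + (v (t / P.d) * P.d + t % P.d) < P.n * (P.m * P.d) :=
    add_lt_mul_of_lt hi (add_lt_mul_of_lt (by omega) (Nat.mod_lt t hd))
  have h4 := P.hW _ hpos
  have h5 : P.ρ ≤ 2 * P.r := by have := P.hε1; unfold ρ; nlinarith
  change _ ≤ _ * P.δ at h4
  rw [inputCurve] at h3
  have h6 := abs_le.1 (le_refl |P.A (i * (P.m * P.d) + (v (t / P.d) * P.d + t % P.d))|)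
  have h7 : |(z t : ℝ)| ≤ P.W := by
    rw [abs_le]
    constructor
    · by_contra! hc
      nlinarith
    · by_contra! hc
      nlinarith
  exact_mod_cast h7

/-- The memory holds the parameters. -/
structure Ready (M : Memory) : Prop where
  n : M.reg 0 = P.n
  m : M.reg 1 = P.m
  d : M.reg 2 = P.d
  k : M.reg 3 = P.k
  r : M.reg 5 = P.r
  K : M.reg 6 = P.K
  δ : M.reg 7 = P.δ
  R : M.reg 8 = P.R
  G : M.reg 9 = P.G
  digits : M.reg 10 = (P.R ^ P.K : ℕ)
  W : M.reg 11 = P.W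
  base : M.reg 29 = 2 * P.W + 1
  ρ : M.reg 30 = P.ρ ^ 2
  U : M.reg 31 = P.U
  A : M.arr 0 = P.A

theorem Ready.frame {P : Params} {s : Program} {M M' : Memory} (h : P.Ready M) (hf : Frame s M M')
    (hs : [0, 1, 2, 3, 5, 6, 7, 8, 9, 10, 11, 29, 30, 31].all (fun x => !s.writesReg x) = true)
    (hs' : s.writesArr 0 = false) : P.Ready M' := by
  have key : ∀ x ∈ [0, 1, 2, 3, 5, 6, 7, 8, 9, 10, 11, 29, 30, 31], M'.reg x = M.reg x := by
    intro x hx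
    refine hf.reg x ?_
    simpa using List.all_eq_true.1 hs x hx
  exact ⟨(key 0 (by simp)).trans h.n, (key 1 (by simp)).trans h.m, (key 2 (by simp)).trans h.d,
    (key 3 (by simp)).trans h.k, (key 5 (by simp)).trans h.r, (key 6 (by simp)).trans h.K,
    (key 7 (by simp)).trans h.δ, (key 8 (by simp)).trans h.R, (key 9 (by simp)).trans h.G,
    (key 10 (by simp)).trans h.digits, (key 11 (by simp)).trans h.W, (key 29 (by simp)).trans h.base,
    (key 30 (by simp)).trans h.ρ, (key 31 (by simp)).trans h.U, (hf.arr 0 hs').trans h.A⟩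

/-! ### The list of keys of near grid curves and its label table -/

/-- The memory holds the list `L` of keys of grid curves near input curves, with labels; it
contains the keys of all `z` near the input curve `i` with `Done i z`. -/
structure Dict (Done : ℕ → (ℕ → ℤ) → Prop) (L : List ℕ) (M : Memory) : Prop where
  nodup : L.Nodup
  size : M.reg 12 = L.length
  keys : ∀ (p : ℕ) (h : p < L.length), M.arr 5 p = L[p]
  label : ∀ x ∈ L, ∃ i < P.n, M.arr 6 x = i + 1 ∧ ∃ z, P.NearInput i z ∧ keyOf P.W P.K z = x
  zero : ∀ x ∉ L, M.arr 6 x = 0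
  complete : ∀ i < P.n, ∀ z, Done i z → P.NearInput i z → keyOf P.W P.K z ∈ L

theorem Dict.congr {P : Params} {Done Done' : ℕ → (ℕ → ℤ) → Prop} {L : List ℕ} {M M' : Memory}
    (h : P.Dict Done L M) (h12 : M'.reg 12 = M.reg 12) (h5 : M'.arr 5 = M.arr 5)
    (h6 : M'.arr 6 = M.arr 6) (hD : ∀ i < P.n, ∀ z, Done' i z → P.NearInput i z → Done i z) :
    P.Dict Done' L M' :=
  ⟨h.nodup, h12 ▸ h.size, h5 ▸ h.keys, h6 ▸ h.label, h6 ▸ h.zero,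
    fun i hi z hz hn => h.complete i hi z (hD i hi z hz hn) hn⟩

theorem insertProg_total {P : Params} {M : Memory} {Done : ℕ → (ℕ → ℤ) → Prop} {L : List ℕ} {i : ℕ}
    {z : ℕ → ℤ} (hP : P.Ready M) (hD : P.Dict Done L M) (hi : i < P.n) (h13 : M.reg 13 = i)
    (h20 : M.reg 20 = horner P.W z P.K + 1)
    (h3 : 0 < M.arr 3 (P.k * (P.m + 1) + P.m) ↔ P.NearInput i z) :
    Total insertProg M 6 fun M' => ∃ L' : List ℕ, L'.length ≤ L.length + 1 ∧
      P.Dict (fun i' z' => Done i' z' ∨ (i' = i ∧ ∀ t < P.K, z' t = z t)) L' M' := by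
  have hcond : (Cond.and (.lt 0 (read 3 (tablePos (reg 3) (reg 1)))) (.le (read 6 (reg 20)) 0)).Holds
      M ↔ P.NearInput i z ∧ keyOf P.W P.K z ∉ L := by
    rw [Cond.holds_and, Cond.holds_lt, Cond.holds_le, Expr.eval_read, Expr.eval_zero,
      tablePos_eval hP.m (show (reg 3).eval M = _ from hP.k) (show (reg 1).eval M = _ from hP.m), h3]
    -- Only for a near candidate is the number in register `20` known to be a valid key. Labels are
    -- stored increased by one, so a zero entry means that the key is new.
    refine and_congr_right fun hn => ?_
    rw [Expr.eval_read, Expr.eval_reg, h20, ← keyOf_cast (hn.bounded hi), Nat.floor_natCast]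
    constructor
    · intro hle hmem
      obtain ⟨i', -, h, -⟩ := hD.label _ hmem
      rw [h] at hle
      have : (0 : ℝ) ≤ i' := by positivity
      linarith
    · intro h
      rw [hD.zero _ h]
  refine Total.ite (T := 5) (fun hc => ?_) fun hc => ?_
  · rw [hcond] at hc
    obtain ⟨hn, hnew⟩ := hc
    have hkey : M.reg 20 = (keyOf P.W P.K z : ℕ) := by rw [h20, keyOf_cast (hn.bounded hi)]
    refine Total.seq_write (Total.seq_write (Total.assign ⟨L ++ [keyOf P.W P.K z], by simp, ?_⟩))
    refine ⟨?_, ?_, ?_, ?_, ?_, ?_⟩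
    · rw [List.nodup_append]
      simpa using ⟨hD.nodup, fun a ha h => hnew (h ▸ ha)⟩
    · simp [hD.size]
    · intro p hp
      rw [List.getElem_append]
      by_cases hpL : p < L.length
      · simp [hpL, hD.size, hD.keys p hpL, hpL.ne]
      · have : p = L.length := by simp at hp; omega
        simp [this, hD.size, hkey]
    · intro x hx
      simp only [Memory.setReg_arr, Memory.setArr_arr_apply, Expr.eval_reg, hkey, Nat.floor_natCast]
      by_cases hxk : x = keyOf P.W P.K z
      · exact ⟨i, hi, by simp [hxk, h13], z, hn, hxk.symm⟩
      · obtain ⟨i', hi', h, hz⟩ := hD.label x (by simpa [hxk] using hx)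
        exact ⟨i', hi', by simp [hxk, h], hz⟩
    · intro x hx
      simp only [List.mem_append, List.mem_singleton, not_or] at hx
      simp [hkey, hx.2, hD.zero x hx.1]
    · rintro i' hi' z' (hd | ⟨rfl, hz⟩) hn'
      · exact List.mem_append_left _ (hD.complete i' hi' z' hd hn')
      · rw [show keyOf P.W P.K z' = keyOf P.W P.K z by rw [keyOf, horner_congr hz, keyOf]]
        exact List.mem_append_right _ (List.mem_singleton.2 rfl)
  · rw [hcond] at hc
    refine (Total.skip ⟨L, by omega, hD.nodup, hD.size, hD.keys, hD.label, hD.zero, ?_⟩).mono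
      (by omega) fun _ _ h => h
    rintro i' hi' z' (hd | ⟨rfl, hz⟩) hn'
    · exact hD.complete i' hi' z' hd hn'
    · by_contra hnot
      refine hc ⟨hn'.congr hz, fun h => hnot ?_⟩
      rwa [keyOf, horner_congr hz]

/-! ### Enumerating the candidates of an input curve -/

/-- The time to process a candidate. -/
def candidateTime : ℕ :=
  P.K * (12 * (11 * P.K) + 30) + 10 + (P.k * (P.m * (4 * P.d + 11) + 6) + 5) + 20

/-- The integer vector of a candidate. -/
noncomputable def candidate (rep : ℕ → ℕ) (i q : ℕ) : ℕ → ℤ :=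
  decodeVec (inputCurve P.A P.m P.d i) rep P.d P.R P.δ (q / P.R ^ P.K, q % P.R ^ P.K)

theorem candidateProg_total {P : Params} {M : Memory} {Done : ℕ → (ℕ → ℤ) → Prop} {L : List ℕ}
    {i q : ℕ} {rep : ℕ → ℕ} (hP : P.Ready M) (hD : P.Dict Done L M) (hi : i < P.n)
    (h13 : M.reg 13 = i) (h14 : M.reg 14 = q) (hq : q < P.G) (hrep : ∀ l, M.arr 4 l = rep l)
    (hborder : TableBorder P.m (M.arr 3)) :
    Total candidateProg M P.candidateTime fun M' => TableBorder P.m (M'.arr 3) ∧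
      ∃ L' : List ℕ, L'.length ≤ L.length + 1 ∧ P.Dict
        (fun i' z' => Done i' z' ∨ (i' = i ∧ ∀ t < P.K, z' t = P.candidate rep i q t)) L' M' := by
  set z := P.candidate rep i q with hz
  refine Total.mono (T := (P.K * (12 * (11 * P.K) + 30) + 10 +
    ((P.k * (P.m * (4 * P.d + 11) + 6) + 5) + 6 + 1) + 1) + 2 + 2) ?_
    (by unfold candidateTime; omega) fun _ _ h => h
  have hRK : 0 < P.R ^ P.K := Nat.pow_pos P.R_pos
  have e15 : ((⌊M.reg 14 / M.reg 10⌋ : ℤ) : ℝ) = ((q / P.R ^ P.K : ℕ) : ℝ) := by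
    rw [h14, hP.digits, natCast_div_floor]
  refine Total.seq_assign (Total.seq_assign ?_)
  refine Total.seq' (T := P.K * (12 * (11 * P.K) + 30) + 10)
    (T' := (P.k * (P.m * (4 * P.d + 11) + 6) + 5) + 6 + 1) (decodeProg_total (m := P.m) (d := P.d) (i := i) (K := P.K) (R := P.R) (W := P.W)
    (b := q / P.R ^ P.K) (g := q % P.R ^ P.K) (β := 11 * P.K) (δ := P.δ) (rep := rep)
    ?_ ?_ ?_ ?_ ?_ ?_ ?_ ?_ ?_ ?_ ?_ ?_) ?_
  · simpa using hP.m
  · simpa using hP.d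
  · simpa using hP.K
  · simpa using hP.δ
  · simpa using hP.R
  · simpa using hP.W
  · simpa using h13
  · simpa using e15
  · have := natCast_mod_eq q (P.R ^ P.K)
    simpa [h14, hP.digits] using this
  · simpa using hP.base
  · simpa using hrep
  -- The candidate number q is split as (q / R^K, q % R^K); the factor 2048^K = 2^(11K) in `P.G` is
  -- the room for the unary part.
  · rw [Nat.div_lt_iff_lt_mul hRK]
    have : P.G = 2 ^ (11 * P.K) * P.R ^ P.K := by
      rw [G, mul_pow, pow_mul]
      norm_num
    rwa [← this]
  · rintro M₁ hf₁ ⟨h2, h20⟩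
    have hP₁ : P.Ready M₁ := hP.frame (Frame.seq_assign (e := 0) (Frame.seq_assign (e := 0) hf₁)) rfl rfl
    have ha : ∀ a, Program.writesArr a decodeProg = false → M₁.arr a = M.arr a := hf₁.arr
    have h13₁ : M₁.reg 13 = i := (hf₁.reg 13 rfl).trans (by simpa using h13)
    have h12₁ : M₁.reg 12 = M.reg 12 := (hf₁.reg 12 rfl).trans (by simp)
    rw [Memory.setReg_arr, Memory.setReg_arr, hP.A] at h2 h20
    change ∀ t < P.K, M₁.arr 2 t = P.δ * z t at h2
    change M₁.reg 20 = horner P.W z P.K + 1 at h20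
    refine Total.seq' (T := P.k * (P.m * (4 * P.d + 11) + 6) + 5) (T' := 6) (checkProg_total (i := i) (ρ := P.ρ) hP₁.m hP₁.d hP₁.k h13₁ hP₁.ρ (by
      rw [ha 3 rfl]; exact hborder)) ?_
    rintro M₂ hf₂ ⟨hb₂, h3⟩
    have hP₂ : P.Ready M₂ := hP₁.frame hf₂ rfl rfl
    refine (insertProg_total (z := z) hP₂ (hD.congr (Done' := Done) ((hf₂.reg 12 rfl).trans h12₁)
      ((hf₂.arr 5 rfl).trans (ha 5 rfl)) ((hf₂.arr 6 rfl).trans (ha 6 rfl))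
      fun _ _ _ h _ => h) hi ((hf₂.reg 13 rfl).trans h13₁) ((hf₂.reg 20 rfl).trans h20) ?_).mono
      le_rfl fun M₃ hf₃ h => ⟨by rw [hf₃.arr 3 rfl]; exact hb₂, h⟩
    have hk := P.hk
    have hm := P.hm
    have := h3 (P.k - 1) (by omega) (P.m - 1) (by omega)
    rw [Nat.sub_add_cancel hk, Nat.sub_add_cancel hm] at this
    rw [this, hP₁.A]
    exact ⟨P.reach_congr h2 _, P.reach_congr (fun t ht => (h2 t ht).symm) _⟩

/-- The time to collect the keys. -/
noncomputable def collectTime : ℕ :=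
  P.n * (P.m * (4 * P.d + 13) + 7 + (P.G * (P.candidateTime + 3) + 3) + 1 + 3) + 3

theorem collectProg_total {P : Params} {M : Memory} (hP : P.Ready M) (h12 : M.reg 12 = 0)
    (harr : ∀ a, 2 ≤ a → M.arr a = fun _ => 0) :
    Total collectProg M P.collectTime fun M' => ∃ L : List ℕ, L.length ≤ P.n * P.G ∧
      P.Dict (fun _ _ => True) L M' := by
  refine Total.forLoop P.n (fun i M' => (∃ rep : ℕ → ℕ, ∀ l, M'.arr 4 l = rep l) ∧
    TableBorder P.m (M'.arr 3) ∧ ∃ L : List ℕ, L.length ≤ i * P.G ∧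
      P.Dict (fun i' _ => i' < i) L M') rfl ?_ ?_ ?_ ?_
  · intro M' hf
    exact (hf.reg 0 rfl).trans hP.n
  · refine ⟨⟨fun _ => 0, by simp [harr 4]⟩, ⟨?_, ?_, ?_⟩, [], by simp, ?_⟩
    · simp [harr 3]
    · simp [harr 3]
    · simp [harr 3]
    · exact ⟨List.nodup_nil, by simp [h12], by simp, by simp, by simp [harr 6], by simp⟩
  · rintro i hi M₁ hf₁ h13 ⟨hrep, hb, L, hL, hD⟩
    have hP₁ : P.Ready M₁ := hP.frame hf₁ rfl rfl
    refine Total.seq' (greedyProg_total hP₁.m hP₁.d hP₁.r h13 hrep) ?_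
    rintro M₂ hf₂ ⟨rep, hrep, hgreedy⟩
    have hP₂ : P.Ready M₂ := hP₁.frame hf₂ rfl rfl
    rw [hP₁.A] at hgreedy
    refine Total.forLoop P.G (fun q M' => TableBorder P.m (M'.arr 3) ∧ ∃ L : List ℕ,
      L.length ≤ i * P.G + q ∧ P.Dict (fun i' z => i' < i ∨ (i' = i ∧ ∃ q' < q, ∀ t < P.K,
        z t = P.candidate rep i q' t)) L M') rfl ?_ ?_ ?_ ?_
    · intro M' hf
      exact (hf.reg 9 rfl).trans hP₂.G
    · refine ⟨by simpa [hf₂.arr 3 rfl] using hb, L, by simpa using hL, hD.congr ?_ ?_ ?_ ?_⟩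
      · simp [hf₂.reg 12 rfl]
      · simp [hf₂.arr 5 rfl]
      · simp [hf₂.arr 6 rfl]
      · rintro i' - z (h | ⟨-, q', hq', -⟩) -
        · exact h
        · omega
    · rintro q hq M₃ hf₃ h14 ⟨hb₃, L₃, hL₃, hD₃⟩
      have h13₃ : M₃.reg 13 = i := (hf₃.reg 13 rfl).trans ((hf₂.reg 13 rfl).trans h13)
      refine (candidateProg_total (rep := rep) (hP₂.frame hf₃ rfl rfl) hD₃ hi h13₃ h14 hq
        (by rw [hf₃.arr 4 rfl]; exact hrep) hb₃).mono le_rfl ?_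
      rintro M₄ hf₄ ⟨hb₄, L₄, hL₄, hD₄⟩ -
      refine ⟨by simpa using hb₄, L₄, by omega, hD₄.congr ?_ ?_ ?_ ?_⟩
      · simp
      · simp
      · simp
      · rintro i' - z (h | ⟨rfl, q', hq', hz⟩) -
        · exact .inl (.inl h)
        · rcases Nat.lt_or_ge q' q with h | h
          · exact .inl (.inr ⟨rfl, q', h, hz⟩)
          · obtain rfl : q' = q := by omega
            exact .inr ⟨rfl, hz⟩
    · rintro M₃ hf₃ _ ⟨hb₃, L₃, hL₃, hD₃⟩ -
      refine ⟨⟨rep, by simpa [hf₃.arr 4 rfl] using hrep⟩, by simpa using hb₃, L₃, by linarith,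
        hD₃.congr ?_ ?_ ?_ ?_⟩
      · simp
      · simp
      · simp
      · intro i' _ z hi' hn
        rcases Nat.lt_or_ge i' i with h | h
        · exact .inl h
        · obtain rfl : i' = i := by omega
          -- Completeness for the current curve: every near grid curve has a code, hence agrees on
          -- its K coordinates with a candidate that has been processed.
          obtain ⟨b, g, hb, hg, hz⟩ := exists_decode P.hd P.hm P.hk P.hε P.hε1 P.hr rfl hgreedy hn
          change b < 2 ^ (11 * P.K) at hb
          change g < P.R ^ P.K at hg
          have hdiv : (g + P.R ^ P.K * b) / P.R ^ P.K = b := by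
            rw [Nat.add_mul_div_left _ _ (Nat.pow_pos P.R_pos), Nat.div_eq_of_lt hg, zero_add]
          have hmod : (g + P.R ^ P.K * b) % P.R ^ P.K = g := by
            rw [Nat.add_mul_mod_self_left, Nat.mod_eq_of_lt hg]
          refine .inr ⟨rfl, g + P.R ^ P.K * b, ?_, fun t ht => ?_⟩
          · have : P.G = P.R ^ P.K * 2 ^ (11 * P.K) := by
              rw [G, mul_pow, pow_mul, mul_comm]
              norm_num
            rw [this]
            calc g + P.R ^ P.K * b < P.R ^ P.K + P.R ^ P.K * b := Nat.add_lt_add_right hg _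
              _ = P.R ^ P.K * (b + 1) := by ring
              _ ≤ _ := Nat.mul_le_mul_left _ hb
          · rw [candidate, hdiv, hmod]
            exact hz t ht
  · rintro M' _ _ ⟨-, -, L, hL, hD⟩
    exact ⟨L, hL, hD.congr rfl rfl rfl fun i hi _ _ _ => hi⟩

end Params

/-! ### Setting up the parameters -/

theorem boundProg_total {M : Memory} {n m d : ℕ} {r δ : ℝ} {A : ℕ → ℝ} (hn : M.reg 0 = n)
    (hm : M.reg 1 = m) (hd : M.reg 2 = d) (hr : M.reg 5 = r) (hδ : M.reg 7 = δ) (hA : M.arr 0 = A)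
    (hr0 : 0 < r) (hδ0 : 0 < δ) :
    Total boundProg M (8 * (n * (m * d)) + 7) fun M' => ∃ W : ℕ, M'.reg 11 = W ∧
      ∀ a < n * (m * d), |A a| + 2 * r ≤ W * δ := by
  refine Total.seq_assign (T := 8 * (n * (m * d)) + 5) (Total.mono
    (T := (n * (m * d) * (5 + 3) + 3) + 1 + 1) ?_ (by linarith) fun _ _ h => h)
  refine Total.seq' (T := n * (m * d) * (5 + 3) + 3) (T' := 1) (Total.forLoop (n * (m * d)) (fun j M' => 0 ≤ M'.reg 11 ∧
    ∀ a < j, |A a| ≤ M'.reg 11) (Q := fun M' => 0 ≤ M'.reg 11 ∧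
    ∀ a < n * (m * d), |A a| ≤ M'.reg 11) rfl ?_ ?_ ?_ ?_) ?_
  · intro M' hf
    have h0 : M'.reg 0 = n := (hf.reg 0 rfl).trans (by simpa using hn)
    have h1 : M'.reg 1 = m := (hf.reg 1 rfl).trans (by simpa using hm)
    have h2 : M'.reg 2 = d := (hf.reg 2 rfl).trans (by simpa using hd)
    simp [h0, h1, h2]
  · simp
  · rintro j hj M' hf h17 ⟨h0, hI⟩
    have hAj : M'.arr 0 j = A j := by rw [hf.arr 0 rfl]; simp [hA]
    refine Total.seq' (T := 2) (T' := 2) (P := fun M'' => (M''.arr 0 j = A j ∧ M''.reg 17 = j) ∧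
      A j ≤ M''.reg 11 ∧ M'.reg 11 ≤ M''.reg 11)
      (Total.ite (fun hc => Total.assign ?_) fun hc => Total.skip ?_) ?_
    · rw [Cond.holds_lt] at hc
      simp only [Expr.eval_reg, Expr.eval_read, h17, Nat.floor_natCast, hAj] at hc
      simp [hAj, h17, hc.le]
    · rw [Cond.holds_lt, not_lt] at hc
      simp only [Expr.eval_reg, Expr.eval_read, h17, Nat.floor_natCast, hAj] at hc
      exact ⟨⟨hAj, h17⟩, hc, le_rfl⟩
    rintro M₁ - ⟨⟨hAj₁, h17₁⟩, h1, h2⟩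
    have finish : ∀ {x : ℝ}, M₁.reg 11 ≤ x → -A j ≤ x → 0 ≤ x ∧ ∀ a < j + 1, |A a| ≤ x := by
      intro x h3 h4
      refine ⟨by linarith, fun a ha => ?_⟩
      rcases Nat.lt_or_ge a j with haj | haj
      · have := hI a haj
        linarith
      · obtain rfl : a = j := by omega
        rw [abs_le]
        constructor <;> linarith
    refine Total.ite (T := 1) (fun hc => Total.assign fun _ => ?_) fun hc => Total.skip fun _ => ?_
    · rw [Cond.holds_lt] at hc
      simp only [Expr.eval_reg, Expr.eval_read, Expr.eval_sub, Expr.eval_zero, h17₁,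
        Nat.floor_natCast, hAj₁, zero_sub] at hc
      simpa [hAj₁, h17₁] using finish hc.le le_rfl
    · rw [Cond.holds_lt, not_lt] at hc
      simp only [Expr.eval_reg, Expr.eval_read, Expr.eval_sub, Expr.eval_zero, h17₁,
        Nat.floor_natCast, hAj₁, zero_sub] at hc
      simpa using finish le_rfl hc
  · rintro M' _ _ hI
    exact hI
  · rintro M' hf ⟨h0, hI⟩
    have h5 : M'.reg 5 = r := (hf.reg 5 rfl).trans (by simpa using hr)
    have h7 : M'.reg 7 = δ := (hf.reg 7 rfl).trans (by simpa using hδ)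
    -- Register `11` holds the largest absolute value of an input coordinate. The result is
    -- independent of any coordinate of a query.
    refine Total.assign ⟨⌊(M'.reg 11 + 2 * r) / δ⌋₊ + 1, ?_, fun a ha => ?_⟩
    · simp only [Memory.setReg_reg, if_true, Expr.eval_add, Expr.eval_floor, Expr.eval_div,
        Expr.eval_mul, Expr.eval_ofNat, Expr.eval_reg, Expr.eval_one, h5, h7]
      rw [← natCast_floor_eq_intCast_floor (by positivity)]
      push_cast
      rfl
    · have h1 := (Nat.lt_floor_add_one ((M'.reg 11 + 2 * r) / δ)).le
      rw [div_le_iff₀ hδ0] at h1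
      have := hI a ha
      push_cast
      linarith

theorem setupProg_total {M : Memory} {n m d k : ℕ} {ε r : ℝ} {A : ℕ → ℝ} (hn : M.reg 0 = n)
    (hm : M.reg 1 = m) (hd : M.reg 2 = d) (hk : M.reg 3 = k) (hε : M.reg 4 = ε) (hr : M.reg 5 = r)
    (hA : M.arr 0 = A) (hm1 : 1 ≤ m) (hd1 : 1 ≤ d) (hk1 : 1 ≤ k) (hε0 : 0 < ε) (hε1 : ε ≤ 1)
    (hr0 : 0 < r) :
    Total setupProg M (8 * (n * (m * d)) + 8 * (k * d) + 40) fun M' => ∃ P : Params,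
      (P.n = n ∧ P.m = m ∧ P.d = d ∧ P.k = k ∧ P.ε = ε ∧ P.r = r ∧ P.A = A) ∧ P.Ready M' := by
  set δ := ε * r / Real.sqrt d with hδ
  have hδ0 : 0 < δ := div_pos (mul_pos hε0 hr0) (Real.sqrt_pos.2 (by exact_mod_cast hd1))
  refine Total.mono (T := (8 * (n * (m * d)) + 7) + (k * d * (5 + 3) + 3 + 1 + 1 + 2 + 2 + 2 + 2) + 1
    + 2 + 2 + 2 + 2) ?_ (by linarith) fun _ _ h => h
  refine Total.seq_assign (Total.seq_assign (Total.seq_assign (Total.seq_assign ?_)))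
  refine Total.seq' (T := 8 * (n * (m * d)) + 7) (boundProg_total (n := n) (m := m) (d := d) (r := r)
    (δ := δ) (A := A) ?_ ?_ ?_ ?_ ?_ ?_ hr0 hδ0) ?_
  · simpa using hn
  · simpa using hm
  · simpa using hd
  · simpa using hr
  · simp [hε, hr, hd, hδ]
  · simpa using hA
  rintro M₁ hf₁ ⟨W, h11, hW⟩
  let P : Params := ⟨n, m, d, k, W, ε, r, A, hm1, hd1, hk1, hε0, hε1, hr0, hW⟩
  have h8 : M₁.reg 8 = P.R := by
    rw [hf₁.reg 8 rfl]
    simp only [Memory.setReg_reg, Expr.eval_add, Expr.eval_floor, Expr.eval_div, Expr.eval_one,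
      Expr.eval_reg, hε]
    simp only [Params.R, digitBase, P]
    push_cast
    rw [natCast_floor_eq_intCast_floor (by positivity)]
  have h6 : M₁.reg 6 = P.K := by
    rw [hf₁.reg 6 rfl]
    simp [hk, hd, Params.K, P]
  refine Total.seq_assign (Total.seq_assign (Total.seq_assign (Total.seq_assign ?_)))
  refine Total.seq' (T := k * d * (5 + 3) + 3) (T' := 1) (Total.forLoop (k * d)
    (fun j M' => M'.reg 9 = ((2048 * P.R) ^ j : ℕ) ∧ M'.reg 10 = (P.R ^ j : ℕ) ∧
      M'.reg 31 = ((2 * W + 1) ^ j : ℕ)) (Q := fun M' => M'.reg 9 = ((2048 * P.R) ^ (k * d) : ℕ) ∧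
      M'.reg 10 = (P.R ^ (k * d) : ℕ) ∧ M'.reg 31 = ((2 * W + 1) ^ (k * d) : ℕ)) rfl ?_ ?_ ?_ ?_) ?_
  · intro M' hf
    exact (hf.reg 6 rfl).trans (by simpa [Params.K, P] using h6)
  · simp
  · rintro j hj M' hf _ ⟨h9, h10, h31⟩
    have e8 : M'.reg 8 = P.R := (hf.reg 8 rfl).trans (by simpa using h8)
    have e29 : M'.reg 29 = 2 * W + 1 := (hf.reg 29 rfl).trans (by simp [h11])
    refine Total.seq_assign (Total.seq_assign (Total.assign fun _ => ⟨?_, ?_, ?_⟩))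
    · simp [h9, e8, pow_succ]
    · simp [h10, e8, pow_succ]
    · simp [h31, e29, pow_succ]
  · exact fun _ _ _ h => h
  · rintro M₂ hf₂ ⟨h9, h10, h31⟩
    refine Total.assign ⟨P, ⟨rfl, rfl, rfl, rfl, rfl, rfl, rfl⟩, ?_⟩
    have hr2 : ∀ x, Program.writesReg x setupProg = false → M₂.reg x = M.reg x := by
      intro x hx
      simp only [setupProg, Program.writesReg, Bool.or_eq_false_iff, beq_eq_false_iff_ne] at hx
      obtain ⟨h6, h7, h8, h30, hb, h29, h9, h10, h31, hl, -⟩ := hx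
      rw [hf₂.reg x hl, Memory.setReg_reg, if_neg h31, Memory.setReg_reg, if_neg h10,
        Memory.setReg_reg, if_neg h9, Memory.setReg_reg, if_neg h29, hf₁.reg x hb,
        Memory.setReg_reg, if_neg h30, Memory.setReg_reg, if_neg h8, Memory.setReg_reg, if_neg h7,
        Memory.setReg_reg, if_neg h6]
    have h2 : ∀ x, x ∉ [9, 10, 17, 29, 31] → M₂.reg x = M₁.reg x := by
      intro x hx
      simp only [List.mem_cons, not_or, List.not_mem_nil] at hx
      rw [hf₂.reg x (by simp [Program.forLoop, Program.writesReg, hx])]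
      simp [hx]
    refine ⟨?_, ?_, ?_, ?_, ?_, ?_, ?_, ?_, ?_, ?_, ?_, ?_, ?_, ?_, ?_⟩
    · simpa [hr2 0 rfl] using hn
    · simpa [hr2 1 rfl] using hm
    · simpa [hr2 2 rfl] using hd
    · simpa [hr2 3 rfl] using hk
    · simpa [hr2 5 rfl] using hr
    · simpa [h2 6 (by decide)] using h6
    · simp [h2 7 (by decide), hf₁.reg 7 rfl, hε, hr, hd, Params.δ, P]
    · simpa [h2 8 (by decide)] using h8
    · simpa [Params.G, Params.K, P] using h9
    · simpa [Params.K, P] using h10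
    · simpa [h2 11 (by decide)] using h11
    · simp [hf₂.reg 29 rfl, h11, P]
    · simp [h2 30 (by decide), hf₁.reg 30 rfl, hε, hr, Params.ρ, P, sq]
    · simp [h31, Params.U, Params.K, P]
    · rw [Memory.setReg_arr, hf₂.arr 0 rfl]
      simp only [Memory.setReg_arr]
      rw [hf₁.arr 0 rfl]
      simpa using hA

/-! ### Buckets -/

/-- The keys in `L` with hash value `i`. -/
def bucket (Mod S a : ℕ) (L : List ℕ) (i : ℕ) : List ℕ := L.filter fun x => hash Mod S a x = i

theorem mem_bucket {Mod S a : ℕ} {L : List ℕ} {i x : ℕ} :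
    x ∈ bucket Mod S a L i ↔ x ∈ L ∧ hash Mod S a x = i := by simp [bucket]

theorem length_bucket_le {Mod S a : ℕ} (L : List ℕ) (i : ℕ) :
    (bucket Mod S a L i).length ≤ L.length := List.length_filter_le _ _

theorem bucket_append (Mod S a : ℕ) (L : List ℕ) (x i : ℕ) :
    bucket Mod S a (L ++ [x]) i =
      if i = hash Mod S a x then bucket Mod S a L i ++ [x] else bucket Mod S a L i := by
  rw [bucket, List.filter_append]
  split_ifs with h
  · simp [bucket, h]
  · simp [bucket, Ne.symm h]

/-- The memory holds the first `S` buckets of `L`. -/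
structure Buckets (Mod S a : ℕ) (L : List ℕ) (M : Memory) : Prop where
  size : ∀ i < S, M.arr 7 i = (bucket Mod S a L i).length
  entry : ∀ i < S, ∀ (p : ℕ) (h : p < (bucket Mod S a L i).length),
    M.arr 8 (i * S + p) = (bucket Mod S a L i)[p]

/-- The sum of the squared bucket sizes. -/
def sumSq (Mod S a : ℕ) (L : List ℕ) : ℕ :=
  ∑ i ∈ Finset.range S, (bucket Mod S a L i).length ^ 2

/-- A bucket of size b that receives a key contributes (b + 1)² - b² = 2b + 1 more, so the program
can keep the sum up to date. -/
theorem sumSq_append {Mod S a : ℕ} (hM : 0 < Mod) (hS : 0 < S) (L : List ℕ) (x : ℕ) :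
    sumSq Mod S a (L ++ [x]) =
      sumSq Mod S a L + (2 * (bucket Mod S a L (hash Mod S a x)).length + 1) := by
  have : ∀ i ∈ Finset.range S, (bucket Mod S a (L ++ [x]) i).length ^ 2 =
      (bucket Mod S a L i).length ^ 2 + if i = hash Mod S a x then
        (2 * (bucket Mod S a L (hash Mod S a x)).length + 1) else 0 := by
    intro i _
    rw [bucket_append]
    split_ifs with h
    · rw [List.length_append, h]
      simp
      ring
    · rfl
  rw [sumSq, Finset.sum_congr rfl this, Finset.sum_add_distrib, Finset.sum_ite_eq',
    if_pos (Finset.mem_range.2 (hash_lt hM hS)), sumSq]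

theorem hashExpr_eval {M : Memory} {e₁ e₂ e₃ e₄ : Expr} {Mod S a x : ℕ} (h₁ : e₁.eval M = Mod)
    (h₂ : e₂.eval M = S) (h₃ : e₃.eval M = a) (h₄ : e₄.eval M = x) :
    (hashExpr e₁ e₂ e₃ e₄).eval M = hash Mod S a x := by
  rw [← hash_eq_floor]
  simp [hashExpr, h₁, h₂, h₃, h₄]

theorem mul_add_ne {S i p i' p' : ℕ} (hp : p < S) (hp' : p' < S) (h : i ≠ i' ∨ p ≠ p') :
    i * S + p ≠ i' * S + p' := by
  have key : ∀ i p : ℕ, p < S → (i * S + p) / S = i ∧ (i * S + p) % S = p := by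
    intro i p hp
    rw [mul_comm, Nat.mul_add_div (by omega), Nat.mul_add_mod, Nat.div_eq_of_lt hp,
      Nat.mod_eq_of_lt hp]
    simp
  intro heq
  have h1 := key i p hp
  rw [heq] at h1
  have h2 := key i' p' hp'
  omega

theorem bucketProg_total {M : Memory} {L : List ℕ} {Mod S a : ℕ} (hMod : 0 < Mod)
    (hS : S = L.length + 1) (h12 : M.reg 12 = L.length) (h33 : M.reg 33 = S)
    (h32 : M.reg 32 = Mod) (h35 : M.reg 35 = a)
    (h5 : ∀ (p : ℕ) (h : p < L.length), M.arr 5 p = L[p]) :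
    Total bucketProg M (16 * L.length + 14) fun M' =>
      Buckets Mod S a L M' ∧ M'.reg 34 = sumSq Mod S a L := by
  have hS0 : 0 < S := by omega
  refine Total.mono (T := (S * (1 + 3) + 3) + ((L.length * (9 + 3) + 3) + 2) + 1) ?_
    (by omega) fun _ _ h => h
  refine Total.seq' (Total.forLoop S (fun j M' => ∀ i < j, M'.arr 7 i = 0)
    (Q := fun M' => ∀ i < S, M'.arr 7 i = 0) rfl ?_ ?_ ?_ ?_) ?_
  · intro M' hf
    exact (hf.reg 33 rfl).trans h33
  · simp
  · intro j hj M' hf h17 hI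
    refine Total.write fun _ i hi => ?_
    by_cases hij : i = j
    · simp [hij, h17]
    · simp [hij, h17, hI i (by omega)]
  · exact fun _ _ _ h => h
  intro M₁ hf₁ hzero
  refine Total.seq_assign ?_
  refine Total.forLoop L.length (fun j M' => Buckets Mod S a (L.take j) M' ∧
    M'.reg 34 = sumSq Mod S a (L.take j)) rfl ?_ ?_ ?_ ?_
  · intro M' hf
    exact (hf.reg 12 rfl).trans (by simpa [hf₁.reg 12 rfl] using h12)
  · refine ⟨⟨fun i hi => ?_, fun i hi p hp => ?_⟩, ?_⟩
    · simpa [bucket] using hzero i hi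
    · simp [bucket] at hp
    · simp [sumSq, bucket]
  · rintro j hj M₂ hf₂ h17 ⟨hB, h34⟩
    have e32 : M₂.reg 32 = Mod := (hf₂.reg 32 rfl).trans (by simpa [hf₁.reg 32 rfl] using h32)
    have e33 : M₂.reg 33 = S := (hf₂.reg 33 rfl).trans (by simpa [hf₁.reg 33 rfl] using h33)
    have e35 : M₂.reg 35 = a := (hf₂.reg 35 rfl).trans (by simpa [hf₁.reg 35 rfl] using h35)
    have e5 : M₂.arr 5 j = L[j] := by
      rw [hf₂.arr 5 rfl, Memory.setReg_arr, hf₁.arr 5 rfl]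
      exact h5 j hj
    obtain ⟨x, hx⟩ : ∃ x, x = L[j] := ⟨_, rfl⟩
    obtain ⟨h, hh⟩ : ∃ h, h = hash Mod S a x := ⟨_, rfl⟩
    have hhS : h < S := hh ▸ hash_lt hMod hS0
    obtain ⟨B, hB'⟩ : ∃ B, B = bucket Mod S a (L.take j) := ⟨_, rfl⟩
    have hsize : ∀ i < S, M₂.arr 7 i = (B i).length := hB' ▸ hB.size
    have hentry : ∀ i < S, ∀ (p : ℕ) (h : p < (B i).length), M₂.arr 8 (i * S + p) = (B i)[p] := by
      rw [hB']
      exact hB.entry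
    rw [← hx] at e5
    -- Buckets are stored with stride S = s + 1, more than any of them can hold, so they do not
    -- overlap.
    have hlen : ∀ i, (B i).length < S := fun i => by
      rw [hB']
      have := length_bucket_le (Mod := Mod) (S := S) (a := a) (L.take j) i
      rw [List.length_take] at this
      omega
    have htake : L.take (j + 1) = L.take j ++ [x] := by
      rw [List.take_succ_eq_append_getElem hj, hx]
    have hBnext : ∀ i, bucket Mod S a (L.take (j + 1)) i = if i = h then B i ++ [x] else B i := by
      intro i
      rw [htake, bucket_append, hh, hB']
    have e36 : (hashExpr (reg 32) (reg 33) (reg 35) (reg 37)).eval (M₂.setReg 37 x) = h :=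
      hh ▸ hashExpr_eval (by simpa using e32) (by simpa using e33) (by simpa using e35) (by simp)
    refine Total.seq_assign ?_
    rw [show (read 5 (reg 17)).eval M₂ = x by simp [h17, e5]]
    refine Total.seq_assign ?_
    rw [e36]
    have e7 : M₂.arr 7 h = (B h).length := hsize h hhS
    have eidx : ⌊(reg 36 * reg 33 + read 7 (reg 36)).eval ((M₂.setReg 37 x).setReg 36 h)⌋₊ =
        h * S + (B h).length := floor_eq_of_eq (by simp [e33, e7])
    refine Total.seq_write ?_
    rw [eidx]
    refine Total.seq_assign (Total.write fun _ => ⟨⟨fun i hi => ?_, fun i hi p hp => ?_⟩, ?_⟩)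
    · rw [hBnext]
      by_cases hih : i = h
      · simp [hih, e7]
      · simp [hih, hsize i hi]
    · have hval : ∀ {l : List ℕ} (heq : bucket Mod S a (L.take (j + 1)) i = l),
          ((bucket Mod S a (L.take (j + 1)) i)[p] : ℝ) = l[p]'(heq ▸ hp) := by
        rintro l rfl
        rfl
      rw [hval (hBnext i)]
      rw [hBnext] at hp
      by_cases hih : i = h
      · subst hih
        simp only [if_true] at hp ⊢
        rw [List.length_append, List.length_singleton] at hp
        by_cases hpl : p < (B i).length
        · simp [hpl, hpl.ne, hentry i hhS p hpl]
        · obtain rfl : p = (B i).length := by omega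
          simp
      · rw [if_neg hih] at hp
        have := mul_add_ne (hp.trans (hlen i)) (hlen h) (.inl hih)
        simp [this, hih, hentry i hi p hp]
    · rw [htake, sumSq_append hMod hS0]
      rw [← hh, ← hB']
      simp [h34, e7]
  · rintro M' _ _ ⟨hB, h34⟩
    rw [List.take_length] at hB h34
    exact ⟨hB, h34⟩

theorem Spec.total_seq {s u : Program} {M : Memory} {T : ℕ} {T' : ℝ≥0∞} {P Q : Memory → Prop}
    (h : Total s M T P) (h' : ∀ M', Frame s M M' → P M' → Spec u M' T' Q) :
    Spec (.seq s u) M (T + T' + 1) Q :=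
  Spec.seq (Spec.of_total (h.mono le_rfl h'))

theorem Spec.assign_seq {u : Program} {M : Memory} {x : ℕ} {e : Expr} {T : ℝ≥0∞}
    {Q : Memory → Prop} (h : Spec u (M.setReg x (e.eval M)) T Q) :
    Spec (.seq (.assign x e) u) M (T + 2) Q := by
  refine (Spec.total_seq (T := 1) (P := fun M' => Spec u M' T Q) (Total.assign h)
    fun _ _ h => h).mono (le_of_eq ?_) fun _ h => h
  push_cast
  ring

theorem Frame.assign (x : ℕ) (M : Memory) (v : ℝ) : Frame (.assign x 0) M (M.setReg x v) := by
  refine ⟨fun y hy => ?_, fun a _ => rfl⟩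
  simp only [Program.writesReg, beq_eq_false_iff_ne] at hy
  simp [hy]

/-! ### First hashing level -/

namespace Params

variable (P : Params)

/-- The modulus of the hash functions for `s` keys. -/
def modulus (s : ℕ) : ℕ := P.U * (12 * s * s + s + 1)

theorem modulus_pos (s : ℕ) : 0 < P.modulus s := Nat.mul_pos (Nat.succ_pos _) (by omega)

/-- The keys in `L` have been distributed to buckets by a hash function with multiplier `a`. -/
structure Distributed (L : List ℕ) (a : ℕ) (M : Memory) : Prop where
  ready : P.Ready M
  dict : P.Dict (fun _ _ => True) L M
  S : M.reg 33 = (L.length + 1 : ℕ)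
  modulus : M.reg 32 = P.modulus L.length
  multiplier : M.reg 35 = a
  buckets : Buckets (P.modulus L.length) (L.length + 1) a L M
  sum : sumSq (P.modulus L.length) (L.length + 1) a L ≤ 14 * L.length

variable {P}

theorem Dict.frame {Done : ℕ → (ℕ → ℤ) → Prop} {L : List ℕ} {s : Program} {M M' : Memory}
    (h : P.Dict Done L M) (hf : Frame s M M') (hs : s.writesReg 12 = false)
    (hs5 : s.writesArr 5 = false) (hs6 : s.writesArr 6 = false) : P.Dict Done L M' :=
  h.congr (hf.reg 12 hs) (hf.arr 5 hs5) (hf.arr 6 hs6) fun _ _ _ h _ => h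

theorem Dict.key_spec {Done : ℕ → (ℕ → ℤ) → Prop} {L : List ℕ} {M : Memory} (h : P.Dict Done L M)
    {x : ℕ} (hx : x ∈ L) : 0 < x ∧ x < P.U := by
  obtain ⟨i, hi, -, z, hz, rfl⟩ := h.label x hx
  exact ⟨keyOf_pos (hz.bounded hi), Nat.lt_succ_of_le (keyOf_le (hz.bounded hi))⟩

theorem Distributed.frame {L : List ℕ} {a : ℕ} {s : Program} {M M' : Memory}
    (h : P.Distributed L a M) (hf : Frame s M M')
    (hs : [0, 1, 2, 3, 5, 6, 7, 8, 9, 10, 11, 29, 30, 31].all (fun x => !s.writesReg x) = true)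
    (hs' : [12, 32, 33, 35].all (fun x => !s.writesReg x) = true)
    (ha : [0, 5, 6, 7, 8].all (fun x => !s.writesArr x) = true) : P.Distributed L a M' := by
  have key : ∀ x ∈ [12, 32, 33, 35], s.writesReg x = false := by
    intro x hx
    simpa using List.all_eq_true.1 hs' x hx
  have key' : ∀ x ∈ [0, 5, 6, 7, 8], s.writesArr x = false := by
    intro x hx
    simpa using List.all_eq_true.1 ha x hx
  refine ⟨h.ready.frame hf hs (key' 0 (by simp)), h.dict.frame hf (key 12 (by simp))
    (key' 5 (by simp)) (key' 6 (by simp)), (hf.reg 33 (key 33 (by simp))).trans h.S,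
    (hf.reg 32 (key 32 (by simp))).trans h.modulus,
    (hf.reg 35 (key 35 (by simp))).trans h.multiplier, ⟨?_, ?_⟩, h.sum⟩
  · rw [hf.arr 7 (key' 7 (by simp))]
    exact h.buckets.size
  · rw [hf.arr 8 (key' 8 (by simp))]
    exact h.buckets.entry

theorem random_bound {M : Memory} {s : ℕ} (h : M.reg 32 = P.modulus s) :
    ⌊(reg 32 - 1).eval M⌋₊ + 1 = P.modulus s := by
  have := P.modulus_pos s
  rw [floor_eq_of_eq (n := P.modulus s - 1)]
  · omega
  · simp [h, Nat.cast_sub this]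

theorem primaryProg_spec {M : Memory} {L : List ℕ} (hP : P.Ready M)
    (hD : P.Dict (fun _ _ => True) L M) (h1 : M.arr 1 = fun _ => 0) :
    Spec primaryProg M (32 * L.length + 41 : ℕ) fun M' => M'.arr 1 = (fun _ => 0) ∧
      ∃ a, P.Distributed L a M' := by
  set s := L.length with hs
  refine Spec.mono (T := 2 * ((16 * s + 14 : ℕ) : ℝ≥0∞) + 7 + 2 + 2 + 2) ?_ (by
    norm_cast
    omega) fun _ h => h
  refine Spec.assign_seq (Spec.assign_seq (Spec.assign_seq ?_))
  -- The loop invariant contains the desired conclusion under the hypothesis that the guard fails.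
  -- So the outcome of the successful trial is available after the loop, whichever multiplier was
  -- drawn.
  refine Spec.mono (Spec.retry (B := P.modulus s) (fun M' => P.Ready M' ∧
    P.Dict (fun _ _ => True) L M' ∧ M'.arr 1 = (fun _ => 0) ∧ M'.reg 33 = (s + 1 : ℕ) ∧
    M'.reg 32 = P.modulus s ∧ (¬ (Cond.lt (14 * reg 12) (reg 34)).Holds M' →
      ∃ a, P.Distributed L a M')) (P.modulus_pos s) ?_ _
    (half_le_card_sum_sq (P.modulus_pos s) hD.nodup (fun x hx => (hD.key_spec hx).2) ?_) ?_ ?_)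
    le_rfl ?_
  · rintro M' ⟨-, -, -, -, h, -⟩
    exact random_bound h
  -- The modulus U·(12s² + s + 1) leaves room for U·(s + 1) here and for U·12b², b ≤ s, on the
  -- second level.
  · exact Nat.mul_le_mul_left _ (by omega)
  · rintro M' ⟨hP', hD', h1', h33, h32, -⟩ v
    have hf₁ := Frame.assign 35 M' ((v : ℕ) : ℝ)
    have hP₁ := hP'.frame hf₁ rfl rfl
    have hD₁ := hD'.frame hf₁ rfl rfl rfl
    refine (bucketProg_total (L := L) (Mod := P.modulus s) (S := s + 1) (a := v) (P.modulus_pos s)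
      rfl hD₁.size ?_ ?_ ?_ hD₁.keys).mono le_rfl ?_
    · simpa using h33
    · simpa using h32
    · simp
    rintro M₂ hf₂ ⟨hB, h34⟩
    have hP₂ := hP₁.frame hf₂ rfl rfl
    have hD₂ := hD₁.frame hf₂ rfl rfl rfl
    have e32 : M₂.reg 32 = P.modulus s := (hf₂.reg 32 rfl).trans ((hf₁.reg 32 rfl).trans h32)
    have e33 : M₂.reg 33 = (s + 1 : ℕ) := (hf₂.reg 33 rfl).trans ((hf₁.reg 33 rfl).trans h33)
    have e35 : M₂.reg 35 = (v : ℕ) := (hf₂.reg 35 rfl).trans (by simp)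
    have hiff : (Cond.lt (14 * reg 12) (reg 34)).Holds M₂ ↔
        ¬ sumSq (P.modulus s) (s + 1) v L ≤ 14 * s := by
      rw [Cond.holds_lt, not_le, ← Nat.cast_lt (α := ℝ)]
      simp [hD₂.size, h34, hs]
    refine ⟨⟨hP₂, hD₂, ?_, e33, e32, fun h => ?_⟩, fun hv => ?_⟩
    · rw [hf₂.arr 1 rfl]
      exact h1'
    · rw [hiff, not_not] at h
      exact ⟨v, hP₂, hD₂, e33, e32, e35, hB, h⟩
    · rw [hiff, not_not]
      exact (Finset.mem_filter.1 hv).2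
  · refine ⟨hP.frame (Frame.seq_assign (x := 33) (e := 0) (Frame.seq_assign (x := 32) (e := 0)
      (Frame.assign 34 _ _))) rfl rfl, hD.frame (Frame.seq_assign (x := 33) (e := 0)
      (Frame.seq_assign (x := 32) (e := 0) (Frame.assign 34 _ _))) rfl rfl rfl, by simpa using h1,
      by simp [hD.size, hs], ?_, ?_⟩
    · simp [hP.U, hD.size, hs, modulus]
    -- Register `34` starts at 14s + 1, which makes the guard true and enforces a first trial.
    · intro h
      refine absurd ?_ h
      rw [Cond.holds_lt]
      simp
  · rintro M' ⟨⟨-, -, h, -, -, h'⟩, hb⟩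
    exact ⟨h, h' hb⟩

end Params

/-! ### Second hashing level: slots and look-up -/

namespace Params

variable (P : Params)

/-- The keys in `L` with hash value `i`, for the primary multiplier `a`. -/
def part (L : List ℕ) (a i : ℕ) : List ℕ := bucket (P.modulus L.length) (L.length + 1) a L i

/-- The number of slots for the bucket `i`. -/
def slots (L : List ℕ) (a i : ℕ) : ℕ := 12 * (P.part L a i).length * (P.part L a i).length

/-- The number of slots for the buckets before `i`. -/
def offset (L : List ℕ) (a i : ℕ) : ℕ := ∑ j ∈ Finset.range i, P.slots L a j

/-- The position of the first slot. -/
def slotBase (L : List ℕ) : ℕ := 5 + 3 * (L.length + 1)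

/-- The position of the slot of `x` in bucket `i`, for the secondary multiplier `v`. -/
def slotPos (L : List ℕ) (a i v x : ℕ) : ℕ :=
  slotBase L + 2 * (P.offset L a i + hash (P.modulus L.length) (P.slots L a i) v x)

/-- Every slot is empty or holds a key of `L` with its label. -/
def Slots (L : List ℕ) (lab D : ℕ → ℝ) : Prop :=
  ∀ σ, D (slotBase L + 2 * σ) = 0 ∨
    ∃ x ∈ L, D (slotBase L + 2 * σ) = x ∧ D (slotBase L + 2 * σ + 1) = lab x

/-- The bucket `i` can be looked up in `D`. -/
def Lookup (L : List ℕ) (a : ℕ) (D : ℕ → ℝ) (i : ℕ) : Prop :=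
  ∃ v : ℕ, D (5 + 3 * i) = v ∧ D (6 + 3 * i) = P.offset L a i ∧ D (7 + 3 * i) = P.slots L a i ∧
    ∀ x ∈ P.part L a i, D (P.slotPos L a i v x) = x

variable {P}

/-- The invariant only says that whatever a slot contains is a stored key with the right label. It
survives failed trials, whose stale entries are left in place. -/
theorem Slots.write {L : List ℕ} {lab D : ℕ → ℝ} (h : Slots L lab D) {x : ℕ} (hx : x ∈ L) (σ : ℕ) :
    Slots L lab (Function.update (Function.update D (slotBase L + 2 * σ) x)
      (slotBase L + 2 * σ + 1) (lab x)) := by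
  intro σ'
  rcases eq_or_ne σ' σ with rfl | hne
  · exact .inr ⟨x, hx, by simp, by simp⟩
  · have h1 : slotBase L + 2 * σ' ≠ slotBase L + 2 * σ := by omega
    have h2 : slotBase L + 2 * σ' ≠ slotBase L + 2 * σ + 1 := by omega
    have h3 : slotBase L + 2 * σ' + 1 ≠ slotBase L + 2 * σ := by omega
    have h4 : slotBase L + 2 * σ' + 1 ≠ slotBase L + 2 * σ + 1 := by omega
    simpa [Function.update_apply, h1, h2, h3, h4, hne] using h σ'

theorem slot_lt_offset {L : List ℕ} {a i v x : ℕ} (hx : x ∈ P.part L a i) :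
    P.offset L a i + hash (P.modulus L.length) (P.slots L a i) v x < P.offset L a (i + 1) := by
  have h1 : 0 < (P.part L a i).length := List.length_pos_of_mem hx
  have h2 : 0 < P.slots L a i := Nat.mul_pos (Nat.mul_pos (by omega) h1) h1
  rw [offset, offset, Finset.sum_range_succ]
  exact Nat.add_lt_add_left (hash_lt (P.modulus_pos _) h2) _

/-- The look-up in bucket `i` reads only its three header cells and, for keys of the bucket, slots
before the offset of the next bucket. -/
theorem Lookup.congr {L : List ℕ} {a i : ℕ} {D D' : ℕ → ℝ} (h : P.Lookup L a D i)
    (hlow : ∀ j, j < 5 + 3 * (i + 1) → D' j = D j)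
    (hslot : ∀ j, slotBase L ≤ j → j < slotBase L + 2 * P.offset L a (i + 1) → D' j = D j) :
    P.Lookup L a D' i := by
  obtain ⟨v, h5, h6, h7, hx⟩ := h
  refine ⟨v, ?_, ?_, ?_, fun x hxm => ?_⟩
  · rw [hlow _ (by omega), h5]
  · rw [hlow _ (by omega), h6]
  · rw [hlow _ (by omega), h7]
  · have := slot_lt_offset (v := v) hxm
    rw [← hx x hxm, slotPos]
    exact hslot _ (Nat.le_add_right _ _) (by omega)

theorem slotProg_eval {L : List ℕ} {a i v : ℕ} {M : Memory} (hM : P.Distributed L a M)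
    (h38 : M.reg 38 = P.offset L a i) (h39 : M.reg 39 = i) (h40 : M.reg 40 = P.slots L a i)
    (h42 : M.reg 42 = v) (hi : i < L.length + 1) {j : ℕ} (hj : j < (P.part L a i).length)
    (h17 : M.reg 17 = j) :
    Total slotProg M 3 fun M' => M'.arr = M.arr ∧ M'.reg 37 = (P.part L a i)[j] ∧
      M'.reg 43 = P.slotPos L a i v (P.part L a i)[j] := by
  have e : (read 8 (reg 39 * reg 33 + reg 17)).eval M = (P.part L a i)[j] := by
    rw [Expr.eval_read, floor_eq_of_eq (n := i * (L.length + 1) + j)]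
    · exact hM.buckets.entry i hi j hj
    · simp [h39, hM.S, h17]
  refine Total.seq_assign (Total.assign ⟨rfl, ?_, ?_⟩)
  · simp [e]
  · rw [e]
    have hh : (hashExpr (reg 32) (reg 40) (reg 42) (reg 37)).eval
        (M.setReg 37 ((P.part L a i)[j] : ℕ)) = _ :=
      hashExpr_eval (Mod := P.modulus L.length) (S := P.slots L a i) (a := v)
        (x := (P.part L a i)[j]) (by simp [hM.modulus]) (by simp [h40]) (by simp [h42]) (by simp)
    simp [hh, slotPos, slotBase, hM.S, h38]

/-- Colliding keys overwrite each other, so after all keys have been written, a second pass that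
finds every key in its own slot certifies success. All writes go to slots from the offset of the
bucket on, hence earlier buckets stay intact. -/
theorem placeProg_total {L : List ℕ} {a i v : ℕ} {M : Memory} (hM : P.Distributed L a M)
    (h38 : M.reg 38 = P.offset L a i) (h39 : M.reg 39 = i) (h40 : M.reg 40 = P.slots L a i)
    (h42 : M.reg 42 = v) (hi : i < L.length + 1) (hS : Slots L (M.arr 6) (M.arr 1)) :
    Total placeProg M (19 * (P.part L a i).length + 9) fun M' => Slots L (M'.arr 6) (M'.arr 1) ∧
      (∀ p < slotBase L + 2 * P.offset L a i, M'.arr 1 p = M.arr 1 p) ∧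
      (¬ 0 < M'.reg 41 → ∀ x ∈ P.part L a i, M'.arr 1 (P.slotPos L a i v x) = x) ∧
      ((∀ x ∈ P.part L a i, ∀ y ∈ P.part L a i, hash (P.modulus L.length) (P.slots L a i) v x =
        hash (P.modulus L.length) (P.slots L a i) v y → x = y) → ¬ 0 < M'.reg 41) := by
  obtain ⟨B, hB⟩ : ∃ B, B = P.part L a i := ⟨_, rfl⟩
  obtain ⟨pos, hpos⟩ : ∃ pos, pos = P.slotPos L a i v := ⟨_, rfl⟩
  have hBL : ∀ x ∈ B, x ∈ L := fun x hx => (mem_bucket.1 (hB ▸ hx)).1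
  have hslot : ∀ {M' : Memory}, (∀ x, x ∉ [17, 37, 41, 43] → M'.reg x = M.reg x) →
      (∀ b, b ≠ 1 → M'.arr b = M.arr b) → ∀ {j : ℕ} (hj : j < B.length), M'.reg 17 = j →
      Total slotProg M' 3 fun M'' => M''.arr = M'.arr ∧ M''.reg 37 = B[j] ∧
        M''.reg 43 = pos B[j] := by
    rintro M' hr ha j hj h17
    subst hB hpos
    refine slotProg_eval (M := M') (hM.frame (s := .seq (.assign 17 0) (.seq (.assign 37 0)
      (.seq (.assign 41 0) (.seq (.assign 43 0) (.write 1 0 0))))) ⟨fun x hx => hr x ?_, fun b hb =>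
      ha b ?_⟩ rfl rfl rfl) ((hr 38 (by decide)).trans h38) ((hr 39 (by decide)).trans h39)
      ((hr 40 (by decide)).trans h40) ((hr 42 (by decide)).trans h42) hi hj h17
    · simp [Program.writesReg] at hx
      simpa using hx
    · simpa [Program.writesArr] using hb
  have hsize : ∀ {M' : Memory}, M'.arr 7 = M.arr 7 → M'.reg 39 = M.reg 39 →
      (read 7 (reg 39)).eval M' = (B.length : ℝ) := by
    intro M' h7 h39'
    rw [Expr.eval_read, floor_eq_of_eq (n := i) (by simp [h39', h39]), h7, hB]
    exact hM.buckets.size i hi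
  obtain ⟨Inj, hInj⟩ : ∃ Inj : Prop, Inj = ∀ x ∈ B, ∀ y ∈ B,
    hash (P.modulus L.length) (P.slots L a i) v x =
        hash (P.modulus L.length) (P.slots L a i) v y → x = y := ⟨_, rfl⟩
  rw [← hB, ← hpos, ← hInj]
  refine Total.mono (T := ((B.length * (7 + 3) + 3) + (B.length * (6 + 3) + 3) + 1) + 2) ?_ (by omega)
    fun _ _ h => h
  refine Total.seq_assign ?_
  refine Total.seq' (T := B.length * (7 + 3) + 3) (T' := B.length * (6 + 3) + 3)
    (Total.forLoop B.length (fun j M' => Slots L (M'.arr 6) (M'.arr 1) ∧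
      (∀ p < slotBase L + 2 * P.offset L a i, M'.arr 1 p = M.arr 1 p) ∧
      (Inj → ∀ (p : ℕ) (h : p < B.length), p < j → M'.arr 1 (pos B[p]) = B[p]))
      (Q := fun M' => Slots L (M'.arr 6) (M'.arr 1) ∧
      (∀ p < slotBase L + 2 * P.offset L a i, M'.arr 1 p = M.arr 1 p) ∧
      (Inj → ∀ (p : ℕ) (h : p < B.length), M'.arr 1 (pos B[p]) = B[p])) rfl ?_ ?_ ?_ ?_) ?_
  · intro M' hf
    exact hsize (hf.arr 7 rfl) (hf.reg 39 rfl)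
  · exact ⟨by simpa using hS, fun p _ => rfl, fun _ p _ h => absurd h (Nat.not_lt_zero _)⟩
  · rintro j hj M₁ hf₁ h17 ⟨hS₁, hlow, hinj⟩
    refine Total.mono (T := 3 + 3 + 1) (Total.seq' (hslot (M' := M₁) ?_ ?_ hj h17) ?_)
      le_rfl fun _ _ h => h
    · intro x hx
      simp only [List.mem_cons, not_or, List.not_mem_nil] at hx
      rw [hf₁.reg x (by simp [Program.forLoop, Program.writesReg, slotProg, hx])]
      simp [hx]
    · intro b hb
      rw [hf₁.arr b (by simp [Program.forLoop, Program.writesArr, slotProg, hb])]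
      simp
    rintro M₂ - ⟨harr, h37, h43⟩
    refine Total.seq_write (Total.write fun hf => ?_)
    have h43' : ((pos B[j] : ℕ) : ℝ) + 1 = ((pos B[j] + 1 : ℕ) : ℝ) := by push_cast; rfl
    simp only [Expr.eval_reg, Expr.eval_add, Expr.eval_one, Expr.eval_read, Memory.setArr_reg, h37,
      h43, Nat.floor_natCast, h43', Memory.setReg_arr]
    have hD : ∀ w : ℝ, (((M₂.setArr 1 (pos B[j]) B[j]).setArr 1 (pos B[j] + 1) w).arr 1) =
        Function.update (Function.update (M₁.arr 1) (pos B[j]) (B[j] : ℝ)) (pos B[j] + 1) w := by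
      intro w
      simp [Memory.setArr, harr]
    have h6 : ∀ w : ℝ, (((M₂.setArr 1 (pos B[j]) B[j]).setArr 1 (pos B[j] + 1) w).arr 6) =
        M₁.arr 6 := by
      intro w
      simp [Memory.setArr, harr]
    rw [hD, h6]
    have hw : (M₂.setArr 1 (pos B[j]) B[j]).arr 6 B[j] = M₁.arr 6 B[j] := by
      simp [harr]
    rw [hw]
    have hpj : pos B[j] = slotBase L + 2 * (P.offset L a i +
      hash (P.modulus L.length) (P.slots L a i) v B[j]) := by rw [hpos, slotPos]
    refine ⟨?_, fun p hp => ?_, fun hI p hp hpj' => ?_⟩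
    · rw [hpj]
      exact hS₁.write (hBL _ (List.getElem_mem hj)) _
    · rw [Function.update_of_ne (by omega), Function.update_of_ne (by omega), hlow p hp]
    · have hpp : pos B[p] = slotBase L + 2 * (P.offset L a i +
        hash (P.modulus L.length) (P.slots L a i) v B[p]) := by rw [hpos, slotPos]
      rw [Function.update_of_ne (by omega)]
      rw [Function.update_apply]
      split_ifs with heq
      · have : B[p] = B[j] := by
          rw [hInj] at hI
          exact hI _ (List.getElem_mem hp) _ (List.getElem_mem hj) (by omega)
        rw [this]
      · have : p ≠ j := fun h => heq (by subst h; rfl)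
        exact hinj hI p hp (by omega)
  · rintro M' _ _ ⟨h1, h2, h3⟩
    exact ⟨h1, h2, fun hI p hp => h3 hI p hp hp⟩
  rintro M₁ hf₁ ⟨hS₁, hlow, hinj⟩
  have h41 : M₁.reg 41 = 0 := (hf₁.reg 41 rfl).trans (by simp)
  refine Total.forLoop B.length (fun j M' => (¬ 0 < M'.reg 41 → ∀ (p : ℕ) (h : p < B.length),
    p < j → M₁.arr 1 (pos B[p]) = B[p]) ∧ (Inj → ¬ 0 < M'.reg 41)) rfl ?_ ?_ ?_ ?_
  · intro M' hf
    exact hsize ((hf.arr 7 rfl).trans (hf₁.arr 7 rfl)) ((hf.reg 39 rfl).trans (hf₁.reg 39 rfl))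
  · refine ⟨fun _ p _ h => absurd h (Nat.not_lt_zero _), fun _ => ?_⟩
    simp [h41]
  · rintro j hj M₂ hf₂ h17 ⟨hchk, hI⟩
    refine Total.mono (T := 3 + 2 + 1) (Total.seq' (hslot (M' := M₂) ?_ ?_ hj h17) ?_)
      le_rfl fun _ _ h => h
    · intro x hx
      simp only [List.mem_cons, not_or, List.not_mem_nil] at hx
      rw [hf₂.reg x (by simp [Program.forLoop, Program.writesReg, slotProg, hx]),
        hf₁.reg x (by simp [Program.forLoop, Program.writesReg, slotProg, hx])]
      simp [hx]
    · intro b hb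
      rw [hf₂.arr b (by simp [Program.forLoop, Program.writesArr, slotProg]),
        hf₁.arr b (by simp [Program.forLoop, Program.writesArr, slotProg, hb])]
      simp
    rintro M₃ hf₃ ⟨harr, h37, h43⟩
    have e41 : M₃.reg 41 = M₂.reg 41 := hf₃.reg 41 rfl
    have ea : M₃.arr 1 = M₁.arr 1 := by rw [harr, hf₂.arr 1 rfl]
    have hc : (Cond.eq (read 1 (reg 43)) (reg 37)).Holds M₃ ↔ M₁.arr 1 (pos B[j]) = B[j] := by
      rw [Cond.holds_eq]
      simp [h43, h37, ea]
    refine Total.ite (T := 1) (fun h => Total.skip fun _ => ?_) fun h => Total.assign fun _ => ?_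
    · rw [hc] at h
      simp only [Memory.setReg_reg, show (41 : ℕ) ≠ 17 by decide, if_false, e41]
      refine ⟨fun h0 p hp hpj => ?_, hI⟩
      rcases Nat.lt_or_ge p j with hlt | hge
      · exact hchk h0 p hp hlt
      · obtain rfl : p = j := by omega
        exact h
    · rw [hc] at h
      simp only [Memory.setReg_reg, show (41 : ℕ) ≠ 17 by decide, if_false, if_true, Expr.eval_one]
      exact ⟨fun h0 => absurd one_pos h0, fun hI' => absurd (hinj hI' j hj) h⟩
  · rintro M₂ hf₂ _ ⟨hchk, hI⟩
    have ea : M₂.arr 1 = M₁.arr 1 := by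
      have := hf₂.arr 1 rfl
      simpa using this
    have e6 : M₂.arr 6 = M₁.arr 6 := by
      have := hf₂.arr 6 rfl
      simpa using this
    rw [ea, e6]
    refine ⟨hS₁, hlow, fun h x hx => ?_, hI⟩
    obtain ⟨p, hp, rfl⟩ := List.getElem_of_mem hx
    exact hchk h p hp hp

end Params

/-! ### Filling the buckets one after the other -/

namespace Params

variable {P : Params}

/-- The state of the preprocessing program before placing the keys of bucket `i`. -/
structure Placed (P : Params) (L : List ℕ) (a i : ℕ) (M : Memory) : Prop where
  distributed : P.Distributed L a M
  offset : M.reg 38 = P.offset L a i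
  slots : Slots L (M.arr 6) (M.arr 1)
  lookup : ∀ j < i, P.Lookup L a (M.arr 1) j

theorem offset_mono {L : List ℕ} {a i j : ℕ} (h : i ≤ j) : P.offset L a i ≤ P.offset L a j :=
  Finset.sum_le_sum_of_subset (Finset.range_mono h)

theorem Lookup.of_agree {L : List ℕ} {a i j : ℕ} {D D' : ℕ → ℝ} (h : P.Lookup L a D j) (hj : j < i)
    (hi : i < L.length + 1)
    (hlow : ∀ p < slotBase L + 2 * P.offset L a i, D' p = D p) : P.Lookup L a D' j := by
  have hm : P.offset L a (j + 1) ≤ P.offset L a i := offset_mono hj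
  refine h.congr (fun p hp => hlow p ?_) fun p _ hp => hlow p (by omega)
  unfold slotBase
  omega

theorem Slots.congr {L : List ℕ} {lab D D' : ℕ → ℝ} (h : Slots L lab D)
    (hD : ∀ p, slotBase L ≤ p → D' p = D p) : Slots L lab D' := by
  intro σ
  rw [hD _ (by omega), hD _ (by omega)]
  exact h σ

theorem finishBucket_total {L : List ℕ} {a i v : ℕ} {M : Memory} (hM : P.Placed L a i M)
    (h39 : M.reg 39 = i) (h40 : M.reg 40 = P.slots L a i) (h42 : M.reg 42 = v)
    (hi : i < L.length + 1)
    (hv : ∀ x ∈ P.part L a i, M.arr 1 (P.slotPos L a i v x) = x) :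
    Total (.write 1 (5 + 3 * reg 39) (reg 42) ;; .write 1 (6 + 3 * reg 39) (reg 38) ;;
      .write 1 (7 + 3 * reg 39) (reg 40) ;; 38 ::= reg 38 + reg 40) M 7 fun M' =>
        M'.reg 39 = i ∧ P.Placed L a (i + 1) M' := by
  have e : ∀ c : ℕ, ⌊(c : ℝ) + 3 * (i : ℝ)⌋₊ = c + 3 * i := fun c =>
    floor_eq_of_eq (by push_cast; ring)
  have e5 := e 5
  have e6 := e 6
  have e7 := e 7
  push_cast at e5 e6 e7
  refine Total.seq_write (Total.seq_write (Total.seq_write (Total.assign ?_)))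
  simp only [Expr.eval_add, Expr.eval_mul, Expr.eval_ofNat, Expr.eval_reg, h39, h42, h40,
    Memory.setArr_reg, hM.offset, e5, e6, e7]
  set D := ((((M.setArr 1 (5 + 3 * i) v).setArr 1 (6 + 3 * i) (P.offset L a i)).setArr 1
    (7 + 3 * i) (P.slots L a i)).arr 1) with hD
  have hDp : ∀ p, D p = if p = 7 + 3 * i then (P.slots L a i : ℝ) else if p = 6 + 3 * i then
      (P.offset L a i : ℝ) else if p = 5 + 3 * i then (v : ℝ) else M.arr 1 p := by
    intro p
    simp [hD]
  have hlow : ∀ p < 5 + 3 * i, D p = M.arr 1 p := by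
    intro p hp
    rw [hDp, if_neg (by omega), if_neg (by omega), if_neg (by omega)]
  -- The header cells of bucket i end at 7 + 3i, below the first slot because i ≤ s.
  have hhigh : ∀ p, slotBase L ≤ p → D p = M.arr 1 p := by
    intro p hp
    unfold slotBase at hp
    rw [hDp, if_neg (by omega), if_neg (by omega), if_neg (by omega)]
  have hf := Frame.seq_write (i := 0) (e := 0) (Frame.seq_write (i := 0) (e := 0)
    (Frame.seq_write (i := 0) (e := 0) (M := (M.setArr 1 (5 + 3 * i) v).setArr 1 (6 + 3 * i)
      (P.offset L a i)) (Frame.assign 38 (((M.setArr 1 (5 + 3 * i) v).setArr 1 (6 + 3 * i)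
        (P.offset L a i)).setArr 1 (7 + 3 * i) (P.slots L a i))
          ((P.offset L a i : ℝ) + P.slots L a i))))
  refine ⟨by simpa using h39, hM.distributed.frame hf rfl rfl rfl, ?_, ?_, ?_⟩
  · simp [Params.offset, Finset.sum_range_succ]
  · rw [Memory.setReg_arr, ← hD]
    have e6 := hf.arr 6 rfl
    rw [Memory.setReg_arr] at e6
    rw [e6]
    exact hM.slots.congr hhigh
  · intro j hj
    rw [Memory.setReg_arr, ← hD]
    rcases Nat.lt_succ_iff_lt_or_eq.1 hj with hj | rfl
    · exact (hM.lookup j hj).congr (fun p hp => hlow p (by omega))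
        fun p hp _ => hhigh p hp
    · refine ⟨v, ?_, ?_, ?_, fun x hx => ?_⟩
      · rw [hDp, if_neg (by omega), if_neg (by omega), if_pos rfl]
      · rw [hDp, if_neg (by omega), if_pos rfl]
      · rw [hDp, if_pos rfl]
      · rw [← hv x hx]
        exact hhigh _ (Nat.le_add_right _ _)

theorem placeBucket_spec {L : List ℕ} {a i : ℕ} {M : Memory} (hM : P.Placed L a i M)
    (h39 : M.reg 39 = i) (hi : i < L.length + 1) :
    Spec (40 ::= 12 * read 7 (reg 39) * read 7 (reg 39) ;; 41 ::= 1 ;;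
      .loop (.lt 0 (reg 41)) (.random 42 (reg 32 - 1) ;; placeProg) ;;
      .write 1 (5 + 3 * reg 39) (reg 42) ;; .write 1 (6 + 3 * reg 39) (reg 38) ;;
      .write 1 (7 + 3 * reg 39) (reg 40) ;; 38 ::= reg 38 + reg 40) M
      (38 * (P.part L a i).length + 37 : ℕ) fun M' => M'.reg 39 = i ∧ P.Placed L a (i + 1) M' := by
  set b := (P.part L a i).length with hb
  refine Spec.mono (T := 2 * ((19 * b + 9 : ℕ) : ℝ≥0∞) + 7 + (7 : ℕ) + 1 + 2 + 2) ?_ (by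
    norm_cast
    omega) fun _ h => h
  have hsize : M.arr 7 i = b := hM.distributed.buckets.size i hi
  refine Spec.assign_seq (Spec.assign_seq (Spec.seq ?_))
  refine Spec.mono (Spec.retry (B := P.modulus L.length) (fun M' => P.Placed L a i M' ∧
    M'.reg 39 = i ∧ M'.reg 40 = P.slots L a i ∧ (¬ (Cond.lt 0 (reg 41)).Holds M' →
      ∃ v : ℕ, M'.reg 42 = v ∧ ∀ x ∈ P.part L a i, M'.arr 1 (P.slotPos L a i v x) = x))
    (P.modulus_pos _) ?_ _ (half_le_card_injOn (L := P.part L a i) (U := P.U)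
      (hM.distributed.dict.nodup.filter _)
      (fun x hx => (hM.distributed.dict.key_spec (mem_bucket.1 hx).1).2) rfl ?_) ?_ ?_) le_rfl ?_
  · rintro M' ⟨h, -⟩
    exact random_bound h.distributed.modulus
  -- A bucket has at most s keys, so 12b² is at most 12s² and the common modulus is large enough.
  · have : b ≤ L.length := length_bucket_le L i
    refine Nat.mul_le_mul_left _ ?_
    have h1 := Nat.mul_le_mul (Nat.mul_le_mul_left 12 this) this
    rw [← hb]
    omega
  · rintro M' ⟨hM', h39', h40', -⟩ v
    have hf := Frame.assign 42 M' ((v : ℕ) : ℝ)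
    refine (placeProg_total (v := v) (hM'.distributed.frame hf rfl rfl rfl) ?_ ?_ ?_ ?_ hi ?_).mono
      le_rfl ?_
    · simpa using hM'.offset
    · simpa using h39'
    · simpa using h40'
    · simp
    · simpa using hM'.slots
    rintro M₂ hf₂ ⟨hS, hlow, hok, hinj⟩
    have hh : (Cond.lt 0 (reg 41)).Holds M₂ ↔ 0 < M₂.reg 41 := by
      rw [Cond.holds_lt]
      simp
    rw [hh]
    refine ⟨⟨⟨(hM'.distributed.frame hf rfl rfl rfl).frame hf₂ rfl rfl rfl, ?_, hS, ?_⟩, ?_, ?_, ?_⟩,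
      ?_⟩
    · rw [hf₂.reg 38 rfl]
      simpa using hM'.offset
    · intro j hj
      refine (hM'.lookup j hj).of_agree hj hi fun p hp => ?_
      rw [hlow p hp]
      simp
    · rw [hf₂.reg 39 rfl]
      simpa using h39'
    · rw [hf₂.reg 40 rfl]
      simpa using h40'
    · intro h
      refine ⟨v, ?_, hok h⟩
      rw [hf₂.reg 42 rfl]
      simp
    · intro hv
      exact hinj (Finset.mem_filter.1 hv).2
  · have hf := Frame.seq_assign (e := 0) (Frame.assign 41 (M.setReg 40
      ((12 * read 7 (reg 39) * read 7 (reg 39)).eval M)) ((1 : Expr).eval (M.setReg 40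
      ((12 * read 7 (reg 39) * read 7 (reg 39)).eval M))))
    refine ⟨⟨hM.distributed.frame hf rfl rfl rfl, ?_, ?_, ?_⟩, ?_, ?_, ?_⟩
    · simpa using hM.offset
    · simpa using hM.slots
    · simpa using hM.lookup
    · simpa using h39
    · simp [h39, hsize, Params.slots, hb]
    · intro h
      refine absurd ?_ h
      rw [Cond.holds_lt]
      simp
  · rintro M' ⟨⟨hM', h39', h40', h⟩, hc⟩
    obtain ⟨v, h42, hv⟩ := h hc
    exact Spec.of_total (finishBucket_total hM' h39' h40' h42 hi hv)

theorem sum_length_part_le {L : List ℕ} {a : ℕ}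
    (h : sumSq (P.modulus L.length) (L.length + 1) a L ≤ 14 * L.length) :
    ∑ i ∈ Finset.range (L.length + 1), (P.part L a i).length ≤ 14 * L.length :=
  (Finset.sum_le_sum fun _ _ => Nat.le_self_pow two_ne_zero _).trans h

/-- The slot count of a bucket is 12 times its squared size; this is where the first level's control
of the sum of squares turns into linear space, 12·14 = 168. -/
theorem offset_le {L : List ℕ} {a : ℕ}
    (h : sumSq (P.modulus L.length) (L.length + 1) a L ≤ 14 * L.length) :
    P.offset L a (L.length + 1) ≤ 168 * L.length := by
  have : P.offset L a (L.length + 1) = 12 * sumSq (P.modulus L.length) (L.length + 1) a L := by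
    rw [sumSq, Finset.mul_sum]
    refine Finset.sum_congr rfl fun i _ => ?_
    rw [slots, part]
    ring
  omega

theorem secondaryProg_spec {L : List ℕ} {a : ℕ} {M : Memory} (hM : P.Distributed L a M)
    (h1 : M.arr 1 = fun _ => 0) :
    Spec secondaryProg M (572 * L.length + 45 : ℕ) (P.Placed L a (L.length + 1)) := by
  refine Spec.mono (T := ∑ i ∈ Finset.range (L.length + 1),
    (((38 * (P.part L a i).length + 37 : ℕ) : ℝ≥0∞) + 3) + 3 + 2) ?_ ?_ fun _ h => h
  · refine Spec.assign_seq (Spec.forLoop (L.length + 1) _ (P.Placed L a) ?_ ?_ ?_ fun _ h => h)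
    · rintro j M' h
      exact h.distributed.S
    · refine ⟨hM.frame (Frame.seq_assign (e := 0) (Frame.assign 39 (M.setReg 38 ((0 : Expr).eval M))
        0)) rfl rfl rfl, ?_, ?_, ?_⟩
      · simp [Params.offset]
      · intro σ
        left
        simp [h1]
      · exact fun j hj => absurd hj (Nat.not_lt_zero _)
    · intro j hj M' h39 h
      refine (placeBucket_spec h h39 hj).mono le_rfl fun M'' ⟨h39', h'⟩ => ⟨h39', ?_⟩
      refine ⟨h'.distributed.frame (Frame.assign 39 M'' _) rfl rfl rfl, ?_, ?_, ?_⟩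
      · simpa using h'.offset
      · simpa using h'.slots
      · simpa using h'.lookup
  -- The total is at most 38·14s + 40(s + 1) + 5 = 572s + 45, with the sum of sizes crudely bounded
  -- by the sum of their squares.
  · have := sum_length_part_le hM.sum
    norm_cast
    rw [Finset.sum_add_distrib, Finset.sum_add_distrib, ← Finset.mul_sum]
    simp only [Finset.sum_const, Finset.card_range, smul_eq_mul]
    omega

/-! ### The finished data structure -/

/-- A data structure, as an array. -/
structure Stored (P : Params) (L : List ℕ) (lab : ℕ → ℝ) (a : ℕ) (D : ℕ → ℝ) : Prop where
  δ : D 0 = P.δ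
  W : D 1 = P.W
  modulus : D 2 = P.modulus L.length
  multiplier : D 3 = a
  S : D 4 = (L.length + 1 : ℕ)
  slots : Slots L lab D
  lookup : ∀ i < L.length + 1, P.Lookup L a D i

theorem headerProg_total {L : List ℕ} {a : ℕ} {M : Memory} (hM : P.Placed L a (L.length + 1) M) :
    Total headerProg M 11 fun M' => P.Dict (fun _ _ => True) L M' ∧
      M'.reg 0 = (slotBase L + 2 * P.offset L a (L.length + 1) : ℕ) ∧
      P.Stored L (M'.arr 6) a (M'.arr 1) := by
  refine (show Total headerProg M 11 fun M' => (∀ p, M'.arr 1 p = if p = 4 then M.reg 33 else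
    if p = 3 then M.reg 35 else if p = 2 then M.reg 32 else if p = 1 then M.reg 11 else
    if p = 0 then M.reg 7 else M.arr 1 p) ∧ M'.reg 0 = 5 + 3 * M.reg 33 + 2 * M.reg 38 from
    Total.seq_write (Total.seq_write (Total.seq_write (Total.seq_write (Total.seq_write
      (Total.assign ⟨fun p => ?_, ?_⟩)))))).mono le_rfl ?_
  · simp
  · simp
  rintro M' hf ⟨hD, h0⟩
  have hhigh : ∀ p, 5 ≤ p → M'.arr 1 p = M.arr 1 p := by
    intro p hp
    rw [hD, if_neg (by omega), if_neg (by omega), if_neg (by omega), if_neg (by omega),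
      if_neg (by omega)]
  have hd := hM.distributed
  refine ⟨hd.dict.frame hf rfl rfl rfl, ?_, ?_, ?_, ?_, ?_, ?_, ?_, ?_⟩
  · rw [h0, hd.S, hM.offset, slotBase]
    push_cast
    ring
  · simp [hD, hd.ready.δ]
  · simp [hD, hd.ready.W]
  · simp [hD, hd.modulus]
  · simp [hD, hd.multiplier]
  · simp [hD, hd.S]
  · rw [hf.arr 6 rfl]
    refine hM.slots.congr fun p hp => hhigh p ?_
    unfold slotBase at hp
    omega
  · intro i hi
    obtain ⟨v, h5, h6, h7, hx⟩ := hM.lookup i hi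
    refine ⟨v, ?_, ?_, ?_, fun x hxm => ?_⟩
    · rw [hhigh _ (by omega), h5]
    · rw [hhigh _ (by omega), h6]
    · rw [hhigh _ (by omega), h7]
    · rw [hhigh _ (by unfold slotPos slotBase; omega), hx x hxm]

end Params

/-! ### Time bounds and the whole preprocessing program -/

namespace Params

variable {P : Params}

theorem G_pos (P : Params) : 0 < P.G := Nat.pow_pos (Nat.mul_pos (by norm_num) P.R_pos)

/-- Writing m, d, k as one plus a natural number makes every claim a comparison of polynomials in
nonnegative variables. The common bound m·K² absorbs decoding, quadratic in K, and the table, of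
order m·k·d. -/
theorem le_mul_sq_K (P : Params) : P.m * P.d ≤ P.m * P.K ^ 2 ∧ P.m ≤ P.m * P.K ^ 2 ∧
    1 ≤ P.m * P.K ^ 2 ∧ P.candidateTime + 3 ≤ 221 * (P.m * P.K ^ 2) := by
  obtain ⟨m, hm⟩ := Nat.exists_eq_add_of_le P.hm
  obtain ⟨d, hd⟩ := Nat.exists_eq_add_of_le P.hd
  obtain ⟨k, hk⟩ := Nat.exists_eq_add_of_le P.hk
  unfold candidateTime K
  rw [hm, hd, hk]
  refine ⟨?_, ?_, ?_, ?_⟩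
  all_goals
    ring_nf
    nlinarith [Nat.zero_le (m * d), Nat.zero_le (m * k), Nat.zero_le (d * k), Nat.zero_le (m * d * k),
      Nat.zero_le (m * d ^ 2), Nat.zero_le (m * k ^ 2), Nat.zero_le (d ^ 2 * k), Nat.zero_le (d * k ^ 2),
      Nat.zero_le (m * d ^ 2 * k), Nat.zero_le (m * d * k ^ 2), Nat.zero_le (d ^ 2 * k ^ 2),
      Nat.zero_le (m * d ^ 2 * k ^ 2), Nat.zero_le (d ^ 2), Nat.zero_le (k ^ 2)]

theorem collectTime_le (P : Params) (hn : 1 ≤ P.n) :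
    P.collectTime ≤ 255 * (P.n * (P.m * P.K ^ 2) * P.G) := by
  obtain ⟨h1, h2, h3, h4⟩ := P.le_mul_sq_K
  unfold collectTime
  set X := P.m * P.K ^ 2
  have hG := P.G_pos
  have hX : X ≤ X * P.G := Nat.le_mul_of_pos_right _ hG
  have h5 : P.G * (P.candidateTime + 3) ≤ 221 * (X * P.G) := by
    calc _ ≤ P.G * (221 * X) := Nat.mul_le_mul_left _ h4
      _ = _ := by ring
  have h6 : P.m * (4 * P.d + 13) = 4 * (P.m * P.d) + 13 * P.m := by ring
  have h7 : P.m * (4 * P.d + 13) + 7 + (P.G * (P.candidateTime + 3) + 3) + 1 + 3 ≤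
      252 * (X * P.G) := by omega
  have h8 := Nat.mul_le_mul_left P.n h7
  have h9 : 1 ≤ P.n * (X * P.G) := Nat.mul_pos hn (by omega)
  calc _ ≤ P.n * (252 * (X * P.G)) + 3 := by omega
    _ = 252 * (P.n * (X * P.G)) + 3 := by ring
    _ ≤ 255 * (P.n * (X * P.G)) := by omega
    _ = _ := by ring

end Params

theorem prepProg_spec {M : Memory} {n m d k : ℕ} {ε r : ℝ} {A : ℕ → ℝ} (hn : M.reg 0 = n)
    (hm : M.reg 1 = m) (hd : M.reg 2 = d) (hk : M.reg 3 = k) (hε : M.reg 4 = ε) (hr : M.reg 5 = r)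
    (h12 : M.reg 12 = 0) (hA : M.arr 0 = A) (harr : ∀ a, 1 ≤ a → M.arr a = fun _ => 0)
    (hn1 : 1 ≤ n) (hm1 : 1 ≤ m) (hd1 : 1 ≤ d) (hk1 : 1 ≤ k) (hε0 : 0 < ε) (hε1 : ε ≤ 1)
    (hr0 : 0 < r) :
    Spec prepProg M (1024 * (n * (m * (k * d) ^ 2) * (2048 * digitBase ε) ^ (k * d)) : ℕ) fun M' =>
      ∃ P : Params, (P.n = n ∧ P.m = m ∧ P.d = d ∧ P.k = k ∧ P.ε = ε ∧ P.r = r ∧ P.A = A) ∧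
        ∃ L a, L.length ≤ n * P.G ∧ P.Dict (fun _ _ => True) L M' ∧
          M'.reg 0 = (Params.slotBase L + 2 * P.offset L a (L.length + 1) : ℕ) ∧
          P.Stored L (M'.arr 6) a (M'.arr 1) ∧ P.offset L a (L.length + 1) ≤ 168 * L.length := by
  obtain ⟨N, hN⟩ : ∃ N, N = n * (m * (k * d) ^ 2) * (2048 * digitBase ε) ^ (k * d) := ⟨_, rfl⟩
  rw [← hN]
  have hG : 1 ≤ (2048 * digitBase ε) ^ (k * d) := Nat.pow_pos (Nat.mul_pos (by norm_num)
    (Nat.succ_pos _))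
  have hK : 1 ≤ k * d := Nat.mul_pos hk1 hd1
  have hmK : m ≤ m * (k * d) ^ 2 := Nat.le_mul_of_pos_right _ (by positivity)
  have b1 : n * (2048 * digitBase ε) ^ (k * d) ≤ N := by
    rw [hN]
    refine Nat.mul_le_mul_right _ (Nat.le_mul_of_pos_right _ (by omega))
  have b2 : n * (m * d) ≤ N := by
    rw [hN]
    refine (Nat.mul_le_mul_left n (Nat.mul_le_mul_left m ?_)).trans (Nat.le_mul_of_pos_right _ hG)
    calc d ≤ k * d := Nat.le_mul_of_pos_left _ hk1
      _ ≤ _ := Nat.le_self_pow two_ne_zero _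
  have b3 : k * d ≤ N := by
    rw [hN]
    calc k * d ≤ (k * d) ^ 2 := Nat.le_self_pow two_ne_zero _
      _ ≤ m * (k * d) ^ 2 := Nat.le_mul_of_pos_left _ hm1
      _ ≤ n * (m * (k * d) ^ 2) := Nat.le_mul_of_pos_left _ hn1
      _ ≤ _ := Nat.le_mul_of_pos_right _ hG
  have b4 : 1 ≤ N := hK.trans b3
  refine Spec.mono (T := ((8 * (n * (m * d)) + 8 * (k * d) + 40 : ℕ) : ℝ≥0∞) + (960 * N : ℕ) + 1)
    (Spec.total_seq (setupProg_total hn hm hd hk hε hr hA hm1 hd1 hk1 hε0 hε1 hr0) ?_)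
    (by norm_cast; omega) fun _ h => h
  rintro M₁ hf₁ ⟨P, hP, hR⟩
  have hPN : P.n * (P.m * P.K ^ 2) * P.G = N := by
    obtain ⟨e1, e2, e3, e4, e5, -, -⟩ := hP
    simp only [hN, Params.G, Params.K, Params.R, e1, e2, e3, e4, e5]
  have hPG : P.n * P.G = n * (2048 * digitBase ε) ^ (k * d) := by
    obtain ⟨e1, e2, e3, e4, e5, -, -⟩ := hP
    simp only [Params.G, Params.K, Params.R, e1, e3, e4, e5]
  have hPn := hP.1
  have harr₁ : ∀ a, 1 ≤ a → M₁.arr a = fun _ => 0 := by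
    intro a ha
    rw [hf₁.arr a (by simp [setupProg, boundProg, Program.forLoop, Program.writesArr])]
    exact harr a ha
  have hct := P.collectTime_le (by omega)
  rw [hPN] at hct
  -- Collecting takes at most 255N; both hashing levels and the header need 604s + 98 steps plus
  -- sequencing, within 704N since s ≤ N and 1 ≤ N.
  have htime : ((P.collectTime : ℕ) : ℝ≥0∞) + (704 * N : ℕ) + 1 ≤ (960 * N : ℕ) := by
    generalize P.collectTime = c at hct
    norm_cast
    omega
  refine Spec.mono (T := (P.collectTime : ℝ≥0∞) + (704 * N : ℕ) + 1) (Spec.total_seq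
    (P.collectProg_total hR ?_ fun a ha => harr₁ a (by omega)) ?_) htime fun _ h => h
  · rw [hf₁.reg 12 rfl]
    exact h12
  rintro M₂ hf₂ ⟨L, hL, hD⟩
  have hR₂ := hR.frame hf₂ rfl rfl
  have h1₂ : M₂.arr 1 = fun _ => 0 := by
    rw [hf₂.arr 1 rfl]
    exact harr₁ 1 le_rfl
  have hLN : L.length ≤ N := by
    rw [hPG] at hL
    exact hL.trans b1
  refine Spec.mono (T := ((32 * L.length + 41 : ℕ) : ℝ≥0∞) + (((572 * L.length + 45 : ℕ) : ℝ≥0∞) +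
    (11 : ℕ) + 1) + 1) (Spec.seq ((Params.primaryProg_spec hR₂ hD h1₂).mono le_rfl ?_))
    (by norm_cast; omega) fun _ h => h
  rintro M₃ ⟨h1₃, a, hd₃⟩
  refine Spec.seq ((Params.secondaryProg_spec hd₃ h1₃).mono le_rfl fun M₄ h₄ => ?_)
  refine Spec.of_total ((Params.headerProg_total h₄).mono le_rfl ?_)
  rintro M₅ - ⟨hD₅, h0, hS⟩
  exact ⟨P, hP, L, a, hPn ▸ hL, hD₅, h0, hS, Params.offset_le hd₃.sum⟩

/-! ### The query program -/

theorem roundProg_total {M : Memory} {K W : ℕ} {δ : ℝ} {q : ℕ → ℝ} (h3 : M.reg 3 = K)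
    (h4 : M.reg 4 = 0) (h5 : M.reg 5 = 0) (hδ : M.arr 0 0 = δ) (hW : M.arr 0 1 = W)
    (hq : M.arr 1 = q) :
    Total roundProg M (9 * K + 3) fun M' =>
      M'.reg 4 = horner W (fun t => round (q t / δ)) K ∧
      (0 < M'.reg 5 ↔ ¬ Bounded W K fun t => round (q t / δ)) := by
  refine Total.mono (T := K * (6 + 3) + 3) ?_ (by omega) fun _ _ h => h
  set z : ℕ → ℤ := fun t => round (q t / δ) with hz
  refine Total.forLoop K (fun j M' => M'.reg 4 = horner W z j ∧ (0 < M'.reg 5 ↔ ¬ Bounded W j z))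
    rfl ?_ ?_ ?_ ?_
  · intro M' hf
    exact (hf.reg 3 rfl).trans (by simpa using h3)
  · simp [h4, h5, horner, Bounded]
  · rintro j hj M' hf h6 ⟨h4', h5'⟩
    have e0 : M'.arr 0 = M.arr 0 := (hf.arr 0 rfl).trans (by simp)
    have e1 : M'.arr 1 = q := (hf.arr 1 rfl).trans (by simpa using hq)
    have h7 : (Expr.floor (read 1 (reg 6) / read 0 0 + 1 / 2)).eval M' = z j := by
      simp [h6, e0, e1, hδ, hz, round_eq]
    refine Total.mono (T := (2 + 1 + 1) + 2) (Total.seq_assign ?_) le_rfl fun _ _ h => h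
    rw [h7]
    have hbs : Bounded W (j + 1) z ↔ Bounded W j z ∧ |z j| ≤ W := by
      refine ⟨fun h => ⟨fun t ht => h t (by omega), h j (by omega)⟩, fun h t ht => ?_⟩
      rcases Nat.lt_succ_iff_lt_or_eq.1 ht with ht | rfl
      · exact h.1 t ht
      · exact h.2
    have hzj : |z j| ≤ W ↔ -(W : ℝ) ≤ z j ∧ (z j : ℝ) ≤ W := by
      rw [abs_le]
      norm_cast
    refine Total.seq' (T := 2) (T' := 1) (P := fun M'' => M''.arr 0 = M.arr 0 ∧ M''.reg 6 = j ∧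
      M''.reg 7 = z j ∧ M''.reg 4 = horner W z j ∧ (0 < M''.reg 5 ↔ ¬ Bounded W (j + 1) z)) ?_ ?_
    · have hc : (Cond.and (.le (0 - read 0 1) (reg 7)) (.le (reg 7) (read 0 1))).Holds
          (M'.setReg 7 (z j)) ↔ |z j| ≤ W := by
        rw [hzj, Cond.holds_and, Cond.holds_le, Cond.holds_le]
        simp [e0, hW]
      refine Total.ite (T := 1) (fun h => Total.skip ?_) fun h => Total.assign ?_
      · rw [hc] at h
        simpa [e0, h6, h4', hbs, h] using h5'
      · rw [hc] at h
        simp [e0, h6, h4', hbs, h]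
    · rintro M₁ - ⟨a0, a6, a7, a4, a5⟩
      refine Total.assign fun _ => ⟨?_, ?_⟩
      · simp [a0, hW, a4, a7, horner]
      · simpa using a5
  · exact fun _ _ _ h => h

namespace Params

/-- The slot of `x` can be stale, can belong to another bucket (an empty bucket has no slots) or can
lie beyond the end, where zeros are read. None of this matters: keys are positive, a slot containing
`x` proves x ∈ L and carries its label, and a stored key is found in its own slot. -/
theorem lookupProg_total {P : Params} {M : Memory} {L : List ℕ} {lab D : ℕ → ℝ} {a x len : ℕ}
    (hS : P.Stored L lab a D) (hD : ∀ p, M.arr 0 p = if p < len then D p else 0)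
    (hlen : len = slotBase L + 2 * P.offset L a (L.length + 1)) (hx : 0 < x) (h4 : M.reg 4 = x) :
    Total lookupProg M 6 fun M' => M'.reg 0 = if x ∈ L then lab x else 0 := by
  obtain ⟨i, hi⟩ : ∃ i, i = hash (P.modulus L.length) (L.length + 1) a x := ⟨_, rfl⟩
  have hiS : i < L.length + 1 := hi ▸ hash_lt (P.modulus_pos _) (Nat.succ_pos _)
  obtain ⟨v, h5, h6, h7, hv⟩ := hS.lookup i hiS
  have hlow : ∀ p < slotBase L, M.arr 0 p = D p := fun p hp => by
    rw [hD, if_pos (by omega)]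
  have hbase : slotBase L = 5 + 3 * (L.length + 1) := rfl
  have e2 : (read 0 2).eval M = (P.modulus L.length : ℕ) := by
    simp [hlow 2 (by omega), hS.modulus]
  have e3 : (read 0 3).eval M = a := by simp [hlow 3 (by omega), hS.multiplier]
  have e4 : (read 0 4).eval M = (L.length + 1 : ℕ) := by simp [hlow 4 (by omega), hS.S]
  have e8 : (5 + 3 * hashExpr (read 0 2) (read 0 4) (read 0 3) (reg 4)).eval M =
      (5 + 3 * i : ℕ) := by
    have := hashExpr_eval (x := x) (e₄ := reg 4) e2 e4 e3 h4
    simp [this, hi]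
  refine Total.mono (T := 1 + 1 + 2 + 2) (Total.seq_assign (Total.seq_assign ?_)) le_rfl
    fun _ _ h => h
  rw [e8]
  set M₁ := M.setReg 8 (5 + 3 * i : ℕ) with hM₁
  have f5 : (read 0 (reg 8)).eval M₁ = v := by
    rw [Expr.eval_read, floor_eq_of_eq (n := 5 + 3 * i) (by simp [hM₁])]
    simp [hM₁, hlow _ (show 5 + 3 * i < slotBase L by omega), h5]
  have f6 : (read 0 (reg 8 + 1)).eval M₁ = P.offset L a i := by
    rw [Expr.eval_read, floor_eq_of_eq (n := 6 + 3 * i) (by simp [hM₁]; ring)]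
    simp [hM₁, hlow _ (show 6 + 3 * i < slotBase L by omega), h6]
  have f7 : (read 0 (reg 8 + 2)).eval M₁ = P.slots L a i := by
    rw [Expr.eval_read, floor_eq_of_eq (n := 7 + 3 * i) (by simp [hM₁]; ring)]
    simp [hM₁, hlow _ (show 7 + 3 * i < slotBase L by omega), h7]
  have f2 : (read 0 2).eval M₁ = (P.modulus L.length : ℕ) := by simpa [hM₁] using e2
  have f4 : (read 0 4).eval M₁ = (L.length + 1 : ℕ) := by simpa [hM₁] using e4
  have e9 : (5 + 3 * read 0 4 + 2 * (read 0 (reg 8 + 1) +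
      hashExpr (read 0 2) (read 0 (reg 8 + 2)) (read 0 (reg 8)) (reg 4))).eval M₁ =
      (P.slotPos L a i v x : ℕ) := by
    have := hashExpr_eval (x := x) (e₄ := reg 4) f2 f7 f5 (by simpa [hM₁] using h4)
    simp only [Expr.eval_add, Expr.eval_mul, Expr.eval_ofNat, this, f4, f6, slotPos, slotBase]
    push_cast
    ring
  rw [e9]
  set M₂ := M₁.setReg 9 (P.slotPos L a i v x : ℕ) with hM₂
  have g9 : (read 0 (reg 9)).eval M₂ = M.arr 0 (P.slotPos L a i v x) := by
    simp [hM₂, hM₁]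
  have g9' : (read 0 (reg 9 + 1)).eval M₂ = M.arr 0 (P.slotPos L a i v x + 1) := by
    rw [Expr.eval_read, floor_eq_of_eq (n := P.slotPos L a i v x + 1) (by simp [hM₂])]
    simp [hM₂, hM₁]
  have g4 : (reg 4).eval M₂ = x := by simpa [hM₂, hM₁] using h4
  have hx0 : (x : ℝ) ≠ 0 := by positivity
  obtain ⟨σ, hσ⟩ : ∃ σ, P.slotPos L a i v x = slotBase L + 2 * σ := ⟨_, rfl⟩
  -- A nonzero cell of the slot area holds a stored key, so reading `x` there excludes false
  -- positives.
  have hmem : M.arr 0 (P.slotPos L a i v x) = x → x ∈ L ∧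
      (P.slotPos L a i v x + 1 < len → D (P.slotPos L a i v x + 1) = lab x) := by
    intro h
    rw [hD] at h
    split_ifs at h with hlt
    · rw [hσ] at h ⊢
      rcases hS.slots σ with h0 | ⟨y, hy, h1, h2⟩
      · exact absurd (h.symm.trans h0) hx0
      · obtain rfl : x = y := by exact_mod_cast h.symm.trans h1
        exact ⟨hy, fun _ => h2⟩
    · exact absurd h.symm hx0
  -- The second cell of the slot, with the label, still lies inside the data structure, because the
  -- slot comes before the end of the last bucket.
  have hpart : x ∈ L → M.arr 0 (P.slotPos L a i v x) = x ∧ P.slotPos L a i v x + 1 < len := by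
    intro hxL
    have hxp : x ∈ P.part L a i := mem_bucket.2 ⟨hxL, hi.symm⟩
    have h1 := slot_lt_offset (v := v) hxp
    have h2 : P.offset L a (i + 1) ≤ P.offset L a (L.length + 1) := offset_mono hiS
    have hlt : P.slotPos L a i v x + 1 < len := by unfold slotPos; omega
    rw [hD, if_pos (by omega)]
    exact ⟨hv x hxp, hlt⟩
  refine Total.ite (T := 1) (fun h => Total.assign ?_) fun h => Total.assign ?_
  · rw [Cond.holds_eq, g9, g4] at h
    obtain ⟨hxL, hl⟩ := hmem h
    have hlt := (hpart hxL).2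
    rw [if_pos hxL, g9', Memory.setReg_reg, if_pos rfl, hD, if_pos hlt, hl hlt]
  · rw [Cond.holds_eq, g9, g4] at h
    rw [if_neg fun hxL => h (hpart hxL).1]
    simp

-- Vectors with a coordinate beyond `P.W` are rejected before the look-up: no near grid curve has
-- such a coordinate, and outside of this range keys would not be injective.
open Classical in
theorem queryProg_total {P : Params} {M : Memory} {L : List ℕ} {lab D q : ℕ → ℝ} {a len : ℕ}
    (hS : P.Stored L lab a D) (hD : ∀ p, M.arr 0 p = if p < len then D p else 0)
    (hlen : len = slotBase L + 2 * P.offset L a (L.length + 1)) (hk : M.reg 1 = P.k)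
    (hd : M.reg 2 = P.d) (hq : M.arr 1 = q) :
    Total queryProg M (9 * P.K + 20) fun M' => M'.reg 0 =
      if (Bounded P.W P.K fun t => round (q t / P.δ)) ∧
        keyOf P.W P.K (fun t => round (q t / P.δ)) ∈ L
      then lab (keyOf P.W P.K fun t => round (q t / P.δ)) else 0 := by
  have hbase : slotBase L = 5 + 3 * (L.length + 1) := rfl
  have h0 : M.arr 0 0 = P.δ := by rw [hD, if_pos (by omega), hS.δ]
  have h1 : M.arr 0 1 = P.W := by rw [hD, if_pos (by omega), hS.W]
  obtain ⟨z, hz⟩ : ∃ z : ℕ → ℤ, z = fun t => round (q t / P.δ) := ⟨_, rfl⟩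
  refine Total.mono (T := (9 * P.K + 3) + (7 + 2) + 1 + 2 + 2 + 2) (Total.seq_assign
    (Total.seq_assign (Total.seq_assign (Total.seq' (roundProg_total (K := P.K) (W := P.W) (δ := P.δ)
      (q := q) ?_ ?_ ?_ ?_ ?_ ?_) ?_)))) (by omega) fun _ _ h => h
  · simp [hk, hd, K]
  · simp
  · simp
  · simpa using h0
  · simpa using h1
  · simpa using hq
  rw [← hz]
  rintro M₁ hf₁ ⟨h4, h5⟩
  refine Total.seq_assign (Total.ite (T := 6) (fun h => ?_) fun h => ?_)
  · rw [Cond.holds_lt] at h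
    have hnb : ¬ Bounded P.W P.K z := h5.1 (by simpa using h)
    refine (Total.assign ?_).mono (T := 1) (by omega) fun _ _ h => h
    rw [if_neg fun h => hnb h.1]
    simp
  · rw [Cond.holds_lt] at h
    have hb : Bounded P.W P.K z := by
      by_contra hnb
      exact h (by simpa using h5.2 hnb)
    have e0 : M₁.arr 0 = M.arr 0 := (hf₁.arr 0 rfl).trans (by simp)
    refine (lookupProg_total (x := keyOf P.W P.K z) hS (len := len) ?_ hlen (keyOf_pos hb) ?_).mono
      le_rfl fun M' _ h => ?_
    · simpa [e0] using hD
    · simp [h4, keyOf_cast hb]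
    · rw [h]
      simp [hb]

end Params

/-! ### From keys back to curves -/

/-- The coordinates of a curve, rounded to multiples of `δ`, in units of `δ`. -/
noncomputable def gridCoords {d k : ℕ} (δ : ℝ) (Q : Curve d k) (t : ℕ) : ℤ :=
  round (curveArray Q t / δ)

theorem curveArray_roundCurve {d k : ℕ} (δ : ℝ) (Q : Curve d k) (t : ℕ) :
    curveArray (roundCurve δ Q) t = δ * gridCoords δ Q t := by
  unfold gridCoords curveArray
  split_ifs with h
  · rfl
  · simp

theorem gridCoords_roundCurve {d k : ℕ} {δ : ℝ} (hδ : δ ≠ 0) (Q : Curve d k) :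
    gridCoords δ (roundCurve δ Q) = gridCoords δ Q := by
  funext t
  rw [gridCoords, curveArray_roundCurve, mul_div_cancel_left₀ _ hδ, round_intCast]

theorem roundCurve_roundCurve {d k : ℕ} {δ : ℝ} (hδ : δ ≠ 0) (Q : Curve d k) :
    roundCurve δ (roundCurve δ Q) = roundCurve δ Q := by
  funext j
  ext t
  simp [roundCurve, mul_div_cancel_left₀ _ hδ]

namespace Params

variable {P : Params} {C : Fin P.n → Curve P.d P.m}

theorem nearInput_gridCoords (hA : P.A = familyArray C) (Q : Curve P.d P.k) {i : ℕ} (hi : i < P.n) :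
    P.NearInput i (gridCoords P.δ Q) ↔ dfd (roundCurve P.δ Q) (C ⟨i, hi⟩) ≤ P.ρ := by
  rw [dfd_le_iff_reach P.ρ_nonneg P.hk P.hm (A := fun t => P.δ * gridCoords P.δ Q t)
    (B := inputCurve P.A P.m P.d i)]
  · rfl
  · exact fun t _ => (curveArray_roundCurve _ _ _).symm
  · intro t ht
    rw [inputCurve, hA, familyArray_apply C hi ht]

/-- Rounding costs εr/2 in each direction: r + εr/2 = ρ for completeness and εr/2 + ρ = (1 + ε)r for
soundness. -/
theorem solvesANNC {answer : Curve P.d P.k → Option (Fin P.n)}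
    (h : ∀ Q j, answer Q = some j → dfd (roundCurve P.δ Q) (C j) ≤ P.ρ)
    (h' : ∀ Q i, dfd (roundCurve P.δ Q) (C i) ≤ P.ρ → ∃ j, answer Q = some j) :
    SolvesANNC C P.ε P.r answer := by
  have hε := P.hε
  have hr := P.hr
  have herr : Real.sqrt P.d * (P.δ / 2) = P.ε / 2 * P.r := by
    have : Real.sqrt P.d ≠ 0 := (Real.sqrt_pos.2 (by exact_mod_cast P.hd)).ne'
    unfold δ
    field_simp
  have hround : ∀ Q : Curve P.d P.k, dfd Q (roundCurve P.δ Q) ≤ P.ε / 2 * P.r := fun Q =>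
    herr ▸ dfd_roundCurve_le P.δ_pos P.hk Q
  have h0 : 0 ≤ P.ε / 2 * P.r := by positivity
  refine fun Q => ⟨fun ⟨i, hi⟩ => h' Q i ?_, fun j hj => ?_⟩
  · refine (dfd_triangle_le h0 hr.le P.hk P.hk P.hm
      (dfd_comm_le h0 P.hk P.hk (hround Q)) hi).trans (le_of_eq ?_)
    unfold ρ
    ring
  · refine (dfd_triangle_le h0 P.ρ_nonneg P.hk P.hk P.hm (hround Q) (h Q j hj)).trans (le_of_eq ?_)
    unfold ρ
    ring

/-- For `S` take the curves fixed by rounding that receive an answer. As simplification of an input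
curve choose any curve of length k within ρ of it, if there is one; a stored curve is then within 2ρ
≤ 4r of it through the input curve. -/
theorem isGridDictionary (hn : 1 ≤ P.n) {answer : Curve P.d P.k → Option (Fin P.n)}
    (h : ∀ Q j, answer Q = some j → dfd (roundCurve P.δ Q) (C j) ≤ P.ρ)
    (hround : ∀ Q, answer (roundCurve P.δ Q) = answer Q) :
    IsGridDictionary C P.ε P.r answer := by
  classical
  have hr := P.hr
  have hρ : P.ρ ≤ 2 * P.r := by have := P.hε1; unfold ρ; nlinarith
  -- The default label `⟨0, hn⟩` and the default simplification `0` are never used for members of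
  -- `S`.
  refine ⟨{Z | roundCurve P.δ Z = Z ∧ answer Z ≠ none}, fun Z => (answer Z).getD ⟨0, hn⟩,
    fun i => if hi : ∃ Z, dfd Z (C i) ≤ P.ρ then hi.choose else 0, ?_, fun Q => ?_⟩
  · rintro Z ⟨hZ, hne⟩
    obtain ⟨i, hi⟩ := Option.ne_none_iff_exists'.1 hne
    have hnear : dfd Z (C i) ≤ P.ρ := by
      have := h Z i hi
      rwa [hZ] at this
    have hex : ∃ Z : Curve P.d P.k, dfd Z (C i) ≤ P.ρ := ⟨Z, hnear⟩
    have hs := dfd_comm_le P.ρ_nonneg P.hk P.hm hex.choose_spec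
    simp only [hi, Option.getD_some, dif_pos hex]
    refine ⟨fun j t => ⟨round (Z j t / P.δ), ?_⟩, hs.trans hρ, ?_⟩
    · conv_lhs => rw [← hZ]
      rfl
    · have := dfd_triangle_le P.ρ_nonneg P.ρ_nonneg P.hk P.hm P.hk hnear hs
      linarith
  · have hiff : roundCurve P.δ (roundCurve P.δ Q) = roundCurve P.δ Q ∧
        answer (roundCurve P.δ Q) ≠ none ↔ answer Q ≠ none := by
      simp [hround, roundCurve_roundCurve P.δ_pos.ne']
    have hQ : answer (roundCurve (P.ε * P.r / Real.sqrt P.d) Q) = answer Q := hround Q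
    simp only [hQ]
    split_ifs with hc
    · obtain ⟨i, hi⟩ := Option.ne_none_iff_exists'.1 (hiff.1 hc)
      simp [hi]
    · exact not_not.1 fun hne => hc (hiff.2 hne)

open Classical in
/-- A dictionary answers near-neighbor queries. -/
theorem Dict.exists_answer {L : List ℕ} {M : Memory} (hD : P.Dict (fun _ _ => True) L M)
    (hn : 1 ≤ P.n) (hA : P.A = familyArray C) :
    ∃ answer : Curve P.d P.k → Option (Fin P.n),
      (∀ Q, answerCode (answer Q) = if Bounded P.W P.K (gridCoords P.δ Q) ∧
        keyOf P.W P.K (gridCoords P.δ Q) ∈ L then M.arr 6 (keyOf P.W P.K (gridCoords P.δ Q)) else 0) ∧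
      SolvesANNC C P.ε P.r answer ∧ IsGridDictionary C P.ε P.r answer := by
  have hlab := hD.label
  choose! ix hix using hlab
  let found : (ℕ → ℤ) → Option (Fin P.n) := fun z =>
    if h : Bounded P.W P.K z ∧ keyOf P.W P.K z ∈ L then some ⟨ix (keyOf P.W P.K z), (hix _ h.2).1⟩
    else none
  have hnear : ∀ (Q : Curve P.d P.k) j, found (gridCoords P.δ Q) = some j →
      dfd (roundCurve P.δ Q) (C j) ≤ P.ρ := by
    intro Q j hj
    simp only [found] at hj
    split_ifs at hj with h
    obtain ⟨hb, hmem⟩ := h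
    obtain ⟨hi, -, z, hz, hkey⟩ := hix _ hmem
    obtain rfl := Option.some.inj hj
    rw [← nearInput_gridCoords hA Q hi]
    -- The stored label vouches for some vector with this key; injectivity of keys identifies it
    -- with the rounded query.
    exact hz.congr (keyOf_inj (hz.bounded hi) hb hkey)
  refine ⟨fun Q => found (gridCoords P.δ Q), fun Q => ?_, solvesANNC hnear fun Q i hi => ?_,
    isGridDictionary hn hnear fun Q => ?_⟩
  · simp only [found]
    split_ifs with h
    · exact (hix _ h.2).2.1.symm
    · rfl
  · have hN := (nearInput_gridCoords hA Q i.2).2 hi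
    simp only [found]
    rw [dif_pos ⟨hN.bounded i.2, hD.complete i i.2 _ trivial hN⟩]
    exact ⟨_, rfl⟩
  · rw [gridCoords_roundCurve P.δ_pos.ne']

end Params

/-! ### Absorbing polynomial factors into the constant -/

theorem digitBase_le {ε : ℝ} (hε : 0 < ε) (hε1 : ε ≤ 1) : (digitBase ε : ℝ) ≤ 2 / ε := by
  have h1 : 1 ≤ 1 / ε := (le_div_iff₀ hε).2 (by linarith)
  have h2 := Nat.floor_le (zero_le_one.trans h1)
  rw [digitBase]
  push_cast
  have h3 : 2 / ε = 1 / ε + 1 / ε := by ring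
  linarith

/-- Since K ≥ 1, the factors 1024 and K² are at most 1024^K and 4^K, and digitBase ε ≤ 2/ε; the
product 2^10 · 2^2 · 2^11 · 2 is the constant 2^24. -/
theorem mul_sq_mul_pow_le {ε : ℝ} {K : ℕ} (hε : 0 < ε) (hε1 : ε ≤ 1) (hK : 1 ≤ K) :
    1024 * (K : ℝ) ^ 2 * (2048 * digitBase ε) ^ K ≤ (2 ^ 24 / ε) ^ K := by
  have h1 : (1024 : ℝ) ≤ 1024 ^ K := le_self_pow₀ (by norm_num) (by omega)
  have h2 : (K : ℝ) ^ 2 ≤ 4 ^ K := by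
    have : (K : ℝ) ≤ 2 ^ K := by exact_mod_cast Nat.lt_two_pow_self.le
    calc (K : ℝ) ^ 2 ≤ (2 ^ K) ^ 2 := by gcongr
      _ = 4 ^ K := by rw [← pow_mul, mul_comm, pow_mul]; norm_num
  calc 1024 * (K : ℝ) ^ 2 * (2048 * digitBase ε) ^ K
      ≤ 1024 ^ K * 4 ^ K * (2048 * (2 / ε)) ^ K := by gcongr; exact digitBase_le hε hε1
    _ = (2 ^ 24 / ε) ^ K := by
      rw [← mul_pow, ← mul_pow]
      congr 1
      ring

theorem length_dataStructure {M : Memory} {len : ℕ} (h : M.reg 0 = len) :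
    (dataStructure M).length = len := by
  simp [dataStructure, h]

theorem getD_dataStructure {M : Memory} {len : ℕ} (h : M.reg 0 = len) (p : ℕ) :
    (dataStructure M).getD p 0 = if p < len then M.arr 1 p else 0 := by
  rw [dataStructure, h, Nat.floor_natCast]
  split_ifs with hp
  · simp [hp]
  · simp [hp]

end CurveANN

theorem theorem4p2 :
    ∃ (c : ℝ) (prep query : CurveANN.Program), 0 < c ∧
      ∀ (n m d k : ℕ), 1 ≤ n → 1 ≤ m → 1 ≤ d → 1 ≤ k →
      ∀ (ε r : ℝ), 0 < ε → ε ≤ 1 → 0 < r →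
      ∀ C : Fin n → CurveANN.Curve d m,
        CurveANN.expectedTime prep (CurveANN.prepInput C k ε r) ≤
            ENNReal.ofReal (n * m * (c * d * Real.log m + (c / ε) ^ (k * d))) ∧
        ∀ M : CurveANN.Memory, CurveANN.IsOutcome prep (CurveANN.prepInput C k ε r) M →
          ((CurveANN.dataStructure M).length : ℝ) ≤ n * (c / ε) ^ (d * k) ∧
          ∃ answer : CurveANN.Curve d k → Option (Fin n),
            (∀ Q : CurveANN.Curve d k,
              CurveANN.ReturnsWithin query (CurveANN.queryInput (CurveANN.dataStructure M) Q)
                (c * (k * d)) (CurveANN.answerCode (answer Q))) ∧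
            CurveANN.SolvesANNC C ε r answer ∧
            CurveANN.IsGridDictionary C ε r answer := by
  refine ⟨2 ^ 24, CurveANN.prepProg, CurveANN.queryProg, by norm_num, ?_⟩
  intro n m d k hn hm hd hk ε r hε hε1 hr C
  have hK : 1 ≤ k * d := Nat.mul_pos hk hd
  have hspec := CurveANN.prepProg_spec (M := CurveANN.prepInput C k ε r) (n := n) (m := m) (d := d)
    (k := k) (ε := ε) (r := r) rfl rfl rfl rfl rfl rfl rfl rfl
    (fun a ha => if_neg (Nat.one_le_iff_ne_zero.1 ha)) hn hm hd hk hε hε1 hr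
  have hbound := CurveANN.mul_sq_mul_pow_le hε hε1 hK
  refine ⟨hspec.expectedTime_le.trans ?_, fun M hM => ?_⟩
  · rw [← ENNReal.ofReal_natCast]
    refine ENNReal.ofReal_le_ofReal ?_
    have hlog : 0 ≤ Real.log m := Real.log_natCast_nonneg m
    calc ((1024 * (n * (m * (k * d) ^ 2) * (2048 * CurveANN.digitBase ε) ^ (k * d)) : ℕ) : ℝ)
        = n * m * (1024 * ((k * d : ℕ) : ℝ) ^ 2 * (2048 * CurveANN.digitBase ε) ^ (k * d)) := by
          push_cast
          ring
      _ ≤ n * m * (2 ^ 24 * d * Real.log m + (2 ^ 24 / ε) ^ (k * d)) := by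
          gcongr
          -- The exponential summand alone covers the whole running time; the summand with log m is
          -- only added.
          exact hbound.trans (le_add_of_nonneg_left (by positivity))
  obtain ⟨P, ⟨rfl, rfl, rfl, rfl, rfl, rfl, hA⟩, L, a, hL, hD, h0, hS, hoff⟩ :=
    hspec.of_isOutcome hM
  obtain ⟨answer, hans, hsol, hdict⟩ := hD.exists_answer hn hA
  refine ⟨?_, answer, fun Q => ?_, hsol, hdict⟩
  · rw [CurveANN.length_dataStructure h0, mul_comm P.d]
    have hG := P.G_pos
    have hnG : 1 ≤ P.n * P.G := Nat.mul_pos hn hG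
    -- The size is at most 5 + 3(s + 1) + 2·168s = 339s + 8, and both s and 1 are at most n·G.
    have hlen : CurveANN.Params.slotBase L + 2 * P.offset L a (L.length + 1) ≤
        347 * (P.n * P.G) := by
      unfold CurveANN.Params.slotBase
      omega
    have hK2 : (1 : ℝ) ≤ ((P.k * P.d : ℕ) : ℝ) ^ 2 := one_le_pow₀ (by exact_mod_cast hK)
    calc ((CurveANN.Params.slotBase L + 2 * P.offset L a (L.length + 1) : ℕ) : ℝ)
        ≤ (347 * (P.n * P.G) : ℕ) := by exact_mod_cast hlen
      _ = P.n * (347 * 1 * (2048 * CurveANN.digitBase P.ε) ^ (P.k * P.d)) := by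
          simp only [CurveANN.Params.G, CurveANN.Params.K, CurveANN.Params.R]
          push_cast
          ring
      _ ≤ P.n * (1024 * ((P.k * P.d : ℕ) : ℝ) ^ 2 *
          (2048 * CurveANN.digitBase P.ε) ^ (P.k * P.d)) := by
          gcongr
          norm_num
      _ ≤ _ := by gcongr
  · rw [hans Q]
    refine (CurveANN.Params.queryProg_total (q := CurveANN.curveArray Q) hS
      (CurveANN.getD_dataStructure h0) rfl rfl rfl rfl).returnsWithin ?_
    have hK' : (1 : ℝ) ≤ P.k * P.d := by exact_mod_cast hK
    simp only [CurveANN.Params.K]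
    push_cast
    linarith
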